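/- **Setting.** Let $U$ be a reflexive separable real Banach space, $V,W$ Hilbert spaces and $Z$ a Banach space with continuous dense embeddings $U\hookrightarrow V\hookrightarrow W\hookrightarrow Z$ such that $U\hookrightarrow W$ is compact; identify $W=W^*$, so that $Z^*\hookrightarrow W\hookrightarrow V^*\hookrightarrow U^*$. Let $\mathbb M$ be an automorphism of $U^*$ whose restriction $\mathbb M_{|W}\colon W\to W$ is continuous, symmetric and uniformly positive definite, and let $\mathbb V\colon V\to V^*$ be linear, continuous, symmetric and uniformly positive definite; put $|w|_{\mathbb M}^2=\langle\mathbb Mw,w\rangle_W$, $|v|_{\mathbb V}^2=\langle\mathbb Vv,v\rangle_V$. Let $\mathcal R\colon Z\to[0,\infty)$ be convex, positively homogeneous of degree one, with $\rho_1\|z\|_Z\le\mathcal R(z)\le\rho_2\|z\|_Z$ for some $0<\rho_1\le\rho_2$. Let $T>0$ and $\mathcal E\colon[0,T]\times U\to[0,+\infty]$ have proper domain $[0,T]\times D$, $D\neq\emptyset$. Here $\partial^U,\partial^Z$ are Fréchet subdifferentials and $V_{\mathcal R}(f;a,b)=\sup\sum_k\mathcal R(f(t_k)-f(t_{k-1}))$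 over partitions of $[a,b]$. For a Banach space $Y$, $B([0,T];Y)$ is the set of everywhere defined bounded measurable functions, and $C_{\rm w}([0,T];Y)$ its subset of weakly continuous ones. Assume: * (E1) $\mathcal E(t,\cdot)$ is weakly lower semicontinuous on $U$ for every $t\in[0,T]$; * (E2) $\mathcal E(\cdot,u)\in AC([0,T])$ for every $u\in D$, and there is a nonnegative $b\in L^1(0,T)$ such that for a.e. $t$, for every $u\in D$, $\partial_t\mathcal E(t,u)$ exists and $|\partial_t\mathcal E(t,u)|\le b(t)(\mathcal E(t,u)+1)$; * (E3) $\mathcal E(0,\cdot)$ has bounded sublevels; * (E4) for all $M>0$ there are $\gamma_M\in L^1(0,T)$ and a modulus of continuity $\omega_M$ with $|\partial_t\mathcal E(t,u_1)-\partial_t\mathcal E(t,u_2)|\le\gamma_M(t)\,\omega_M(|u_1-u_2|_W)$ for a.e. $t$ and all $u_1,u_2\in\{\mathcal E(0,\cdot)\le M\}$; * (E5') there are a Banach space $X$ with $U\hookrightarrow X$ and $\mu>0$ such that for all $t\in[0,T]$, $\theta\in(0,1)$, $u_1,u_2\in U$ $$\mathcal E(t,\theta u_1+(1-\theta)u_2)\le\theta\mathcal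 E(t,u_1)+(1-\theta)\mathcal E(t,u_2)-\tfrac\mu2\theta(1-\theta)\|u_1-u_2\|_X^2 .$$ For $\varepsilon>0$ put $\mathcal R_\varepsilon(v)=\frac\varepsilon2|v|_{\mathbb V}^2+\mathcal R(v)$ on $V$, with Fenchel conjugate $\mathcal R_\varepsilon^*$ on $V^*$. A *dissipative dynamic solution* with data $u_0^\varepsilon\in D$, $u_1^\varepsilon\in V$ is a function $u^\varepsilon\colon[0,T]\to D$ in $C_{\rm w}([0,T];U)\cap W^{1,2}(0,T;V)\cap C^1_{\rm w}([0,T];W)\cap W^{2,2}(0,T;U^*)$ with $\mathcal E(\cdot,u^\varepsilon(\cdot))\in L^\infty(0,T)$, $u^\varepsilon(0)=u^\varepsilon_0$, $\dot u^\varepsilon(0)=u_1^\varepsilon$, such that for some (measurable) $\eta^\varepsilon(t)\in\partial^Z\mathcal R(\dot u^\varepsilon(t))$, $\xi^\varepsilon(t)\in\partial^U\mathcal E(t,u^\varepsilon(t))$ one has $\varepsilon^2\mathbb M\ddot u^\varepsilon+\varepsilon\mathbb V\dot u^\varepsilon+\eta^\varepsilon+\xi^\varepsilon=0$ in $U^*$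 a.e. in $[0,T]$ and, for all $t\in[0,T]\setminus N$ with some null set $N\subseteq(0,T]$, $$\tfrac{\varepsilon^2}2|\dot u^\varepsilon(t)|_{\mathbb M}^2+\mathcal E(t,u^\varepsilon(t))+\int_0^t\mathcal R_\varepsilon(\dot u^\varepsilon)+\mathcal R_\varepsilon^*(-\varepsilon^2\mathbb M\ddot u^\varepsilon-\xi^\varepsilon)\,dr=\tfrac{\varepsilon^2}2|u_1^\varepsilon|_{\mathbb M}^2+\mathcal E(0,u_0^\varepsilon)+\int_0^t\partial_t\mathcal E(r,u^\varepsilon(r))\,dr .$$ **Theorem (uniformly convex case).** Let $u^\varepsilon$ be dissipative dynamic solutions for a sequence $\varepsilon\to0^+$ such that $\varepsilon u_1^\varepsilon\to0$ in $W$, $u_0^\varepsilon\rightharpoonup u_0$ weakly in $U$ and $\mathcal E(0,u^\varepsilon_0)\to\mathcal E(0,u_0)$, where $\mathcal E(0,u_0)\le\mathcal E(0,x)+\mathcal R(x-u_0)$ for all $x\in U$. Then there are a subsequence (not relabelled) and $u\colon[0,T]\to D$ in $B([0,T];U)\cap BV([0,T];Z)$ such that $u^\varepsilon(t)\rightharpoonup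 u(t)$ weakly in $U$ for all $t\in[0,T]$, $\varepsilon\dot u^\varepsilon(t)\to0$ in $V$ for a.e. $t$, and: 1. $u$ is an essential energetic solution, that is: $u(0)=u_0$; $\mathcal E(t,u(t))\le\mathcal E(t,x)+\mathcal R(x-u(t))$ for all $x\in U$ and all $t\in[0,T]$ outside the jump set $J_u$ of $u$ in $Z$; and, for all $0\le s\le t\le T$, $$\mathcal E(t,u^+(t))+V_{\mathcal R}(u_{\rm co};s,t)+\sum_{r\in[s,t],\,u^+(r)\ne u^-(r)}\mathcal R(u^+(r)-u^-(r))=\mathcal E(s,u^-(s))+\int_s^t\partial_t\mathcal E(r,u(r))\,dr,$$ where $u^\pm$ are the one-sided limits of $u$ in $Z$ (with $u^-(0)=u(0)$, $u^+(T)=u(T)$) and $u_{\rm co}$ is the continuous part of $u$ as a $BV$ function with values in $Z$; 2. $u\in C([0,T];X)$ and $u\in C_{\rm w}([0,T];U)$; 3. $u$ is an energetic solution: for all $t\in[0,T]$, $\mathcal E(t,u(t))\le\mathcal E(t,x)+\mathcal R(x-u(t))$ for all $x\in U$, and $\mathcal E(t,u(t))+V_{\mathcal R}(u;0,t)=\mathcal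 E(0,u_0)+\int_0^t\partial_t\mathcal E(r,u(r))\,dr$; 4. if moreover (E4') holds, i.e. for all $M>0$ there is $\gamma_M\in L^1(0,T)$ with $|\partial_t\mathcal E(t,u_1)-\partial_t\mathcal E(t,u_2)|\le\gamma_M(t)\|u_1-u_2\|_X$ for a.e. $t$ and all $u_1,u_2\in\{\mathcal E(0,\cdot)\le M\}$, then $u\in AC([0,T];X)$; 5. if, in addition to (E4'), $X\hookrightarrow Z$ (compatibly with $U\hookrightarrow Z$) and $X$ is reflexive, then $u$ is differentiable in $X$ a.e. in $[0,T]$, $\partial^Z\mathcal R(\dot u(t))+\partial^U\mathcal E(t,u(t))\ni0$ in $U^*$ for a.e. $t\in[0,T]$, and $u(0)=u_0$. -/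

import Mathlib

open MeasureTheory Set Filter Topology
open scoped ENNReal RealInnerProductSpace

namespace RateIndependent

noncomputable section

/-! ### Function spaces on `[0, T]`

Functions on `[0, T]` are modelled by functions on `ℝ` of which only the values on `[0, T]`
are used. -/

section FunctionSpaces

variable {X : Type*} [NormedAddCommGroup X] [NormedSpace ℝ X]

/-- `B([0,T]; X)`: everywhere defined, (strongly) measurable and bounded functions. -/
def MemB (T : ℝ) (f : ℝ → X) : Prop :=
  StronglyMeasurable ((Icc (0 : ℝ) T).domRestrict f) ∧ ∃ C : ℝ, ∀ t ∈ Icc (0 : ℝ) T, ‖f t‖ ≤ C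

/-- `C_w([0,T]; X)`: elements of `B([0,T]; X)` continuous for the weak topology of `X`. -/
def MemCw (T : ℝ) (f : ℝ → X) : Prop :=
  MemB T f ∧ ∀ L : StrongDual ℝ X, ContinuousOn (fun t => L (f t)) (Icc 0 T)

/-- `f ∈ C¹_w([0,T]; X)` with derivative `g`: both are weakly continuous and `g` is the
derivative of `f` (one-sided at the endpoints) for the weak topology of `X`. -/
def MemC1w (T : ℝ) (f g : ℝ → X) : Prop :=
  MemCw T f ∧ MemCw T g ∧ ∀ L : StrongDual ℝ X, ∀ t ∈ Icc (0 : ℝ) T,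
    HasDerivWithinAt (fun s => L (f s)) (L (g t)) (Icc 0 T) t

/-- `f ∈ AC([0,T]; X)`. -/
def MemAC (T : ℝ) (f : ℝ → X) : Prop :=
  ∃ φ : ℝ → ℝ, IntervalIntegrable φ volume 0 T ∧ (∀ t ∈ Icc (0 : ℝ) T, 0 ≤ φ t) ∧
    ∀ s ∈ Icc (0 : ℝ) T, ∀ t ∈ Icc (0 : ℝ) T, ‖f t - f s‖ ≤ |∫ r in s..t, φ r|

/-- `f` is the continuous representative of an element of the Bochner–Sobolev space
`W^{1,2}(0,T; X)` and `g ∈ L²(0,T; X)` is its derivative. -/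
def MemW12 (T : ℝ) (f g : ℝ → X) : Prop :=
  MemLp f 2 (volume.restrict (Icc 0 T)) ∧ MemLp g 2 (volume.restrict (Icc 0 T)) ∧
    ∀ t ∈ Icc (0 : ℝ) T, f t = f 0 + ∫ r in (0 : ℝ)..t, g r

/-- Reflexivity: the canonical map into the bidual is onto. -/
def IsReflexive (X : Type*) [NormedAddCommGroup X] [NormedSpace ℝ X] : Prop :=
  Function.Surjective (NormedSpace.inclusionInDoubleDual ℝ X)

/-- Weak convergence of a sequence. -/
def WeakTendsto (x : ℕ → X) (y : X) : Prop :=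
  ∀ L : StrongDual ℝ X, Tendsto (fun n => L (x n)) atTop (𝓝 (L y))

/-- The Fréchet subdifferential of `Φ : X → (-∞, +∞]`: those `ζ ∈ X*` with
`liminf_{y → x} (Φ y - Φ x - ⟨ζ, y - x⟩) / ‖y - x‖ ≥ 0`; it is empty where `Φ x = +∞`. -/
def frechetSubdiff (Φ : X → EReal) (x : X) : Set (StrongDual ℝ X) :=
  {ζ | Φ x ≠ ⊤ ∧ ∀ δ : ℝ, 0 < δ → ∀ᶠ y in 𝓝 x,
    Φ x + ((ζ (y - x) - δ * ‖y - x‖ : ℝ) : EReal) ≤ Φ y}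

/-- The Fenchel conjugate of `Φ : X → (-∞, +∞]`. -/
def fenchelConj (Φ : X → EReal) (ζ : StrongDual ℝ X) : EReal :=
  ⨆ y : X, (((ζ y : ℝ) : EReal) - Φ y)

/-- A modulus of continuity `[0,∞) → [0,∞)`. -/
def IsModulus (ω : ℝ → ℝ) : Prop :=
  MonotoneOn ω (Ici 0) ∧ ω 0 = 0 ∧ ContinuousWithinAt ω (Ici 0) 0

end FunctionSpaces

/-! ### Functional framework -/

/-- The continuous and dense embeddings `U ↪ V ↪ W ↪ Z`, with `U ↪ W` compact. -/
structure Embeddings (U V W Z : Type*)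
    [NormedAddCommGroup U] [NormedSpace ℝ U] [NormedAddCommGroup V] [InnerProductSpace ℝ V]
    [NormedAddCommGroup W] [InnerProductSpace ℝ W] [NormedAddCommGroup Z] [NormedSpace ℝ Z] where
  UV : U →L[ℝ] V
  VW : V →L[ℝ] W
  WZ : W →L[ℝ] Z
  injective_UV : Function.Injective UV
  injective_VW : Function.Injective VW
  injective_WZ : Function.Injective WZ
  denseRange_UV : DenseRange UV
  denseRange_VW : DenseRange VW
  denseRange_WZ : DenseRange WZ
  compact_UW : IsCompactOperator (VW ∘L UV)

section Setting

variable {U V W Z : Type*}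
  [NormedAddCommGroup U] [NormedSpace ℝ U] [NormedAddCommGroup V] [InnerProductSpace ℝ V]
  [NormedAddCommGroup W] [InnerProductSpace ℝ W] [NormedAddCommGroup Z] [NormedSpace ℝ Z]

namespace Embeddings

variable (e : Embeddings U V W Z)

/-- The embedding `U ↪ W`. -/
def UW : U →L[ℝ] W := e.VW ∘L e.UV

/-- The embedding `V ↪ Z`. -/
def VZ : V →L[ℝ] Z := e.WZ ∘L e.VW

/-- The embedding `U ↪ Z`. -/
def UZ : U →L[ℝ] Z := e.WZ ∘L e.UW

/-- The embedding `W = W* ↪ U*`, sending `w` to `u ↦ ⟪w, u⟫_W`. -/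
def WdualU (w : W) : StrongDual ℝ U := (innerSL ℝ w) ∘L e.UW

/-- The embedding `V* ↪ U*`, by restriction. -/
def VdualU (ζ : StrongDual ℝ V) : StrongDual ℝ U := ζ ∘L e.UV

/-- The embedding `Z* ↪ U*`, by restriction. -/
def ZdualU (η : StrongDual ℝ Z) : StrongDual ℝ U := η ∘L e.UZ

end Embeddings

/-- `M` is an automorphism of `U*` whose restriction to `W` is `MW : W → W`, and `MW` is
continuous, symmetric and (uniformly) positive definite. -/
structure IsMassOperator (e : Embeddings U V W Z)
    (M : StrongDual ℝ U ≃L[ℝ] StrongDual ℝ U) (MW : W →L[ℝ] W) : Prop where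
  restrict : ∀ w : W, M (e.WdualU w) = e.WdualU (MW w)
  symmetric : ∀ w w' : W, ⟪MW w, w'⟫ = ⟪w, MW w'⟫
  posDef : ∃ c : ℝ, 0 < c ∧ ∀ w : W, c * ‖w‖ ^ 2 ≤ ⟪MW w, w⟫

/-- The viscosity operator is continuous, symmetric and (uniformly) positive definite. -/
structure IsViscosityOperator (Vis : V →L[ℝ] StrongDual ℝ V) : Prop where
  symmetric : ∀ v v' : V, Vis v v' = Vis v' v
  posDef : ∃ c : ℝ, 0 < c ∧ ∀ v : V, c * ‖v‖ ^ 2 ≤ Vis v v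

/-- Rate-independent dissipation potentials: convex, positively one-homogeneous and comparable
with the norm of `Z`. -/
structure IsDissipationPotential (R : Z → ℝ) : Prop where
  convex : ConvexOn ℝ univ R
  homogeneous : ∀ a : ℝ, 0 < a → ∀ z : Z, R (a • z) = a * R z
  bounds : ∃ ρ₁ ρ₂ : ℝ, 0 < ρ₁ ∧ ρ₁ ≤ ρ₂ ∧ ∀ z : Z, ρ₁ * ‖z‖ ≤ R z ∧ R z ≤ ρ₂ * ‖z‖

/-! ### The potential energy `E : [0,T] × U → [0,+∞]` -/

/-- The power `∂ₜ E(t, u)`. -/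
def power (E : ℝ → U → ℝ≥0∞) (t : ℝ) (u : U) : ℝ :=
  deriv (fun s => (E s u).toReal) t

/-- The subdifferential `∂^U E(t, u)`. -/
def energySubdiff (E : ℝ → U → ℝ≥0∞) (t : ℝ) (u : U) : Set (StrongDual ℝ U) :=
  frechetSubdiff (fun x => (E t x : EReal)) u

/-- The subdifferential `∂^Z R(z)`. -/
def dissSubdiff (R : Z → ℝ) (z : Z) : Set (StrongDual ℝ Z) :=
  frechetSubdiff (fun x => (R x : EReal)) z

/-- The proper domain of `E` is `[0,T] × D`, with `D` nonempty. -/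
def HasDomain (T : ℝ) (E : ℝ → U → ℝ≥0∞) (D : Set U) : Prop :=
  D.Nonempty ∧ ∀ t ∈ Icc (0 : ℝ) T, ∀ u : U, E t u ≠ ⊤ ↔ u ∈ D

/-- Weak lower semicontinuity. -/
def WeaklyLSC (T : ℝ) (E : ℝ → U → ℝ≥0∞) : Prop :=
  ∀ t ∈ Icc (0 : ℝ) T, LowerSemicontinuous (fun x : WeakSpace ℝ U => E t ((toWeakSpace ℝ U).symm x))

/-- Power control. -/
def PowerControl (T : ℝ) (E : ℝ → U → ℝ≥0∞) (D : Set U) : Prop :=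
  (∀ u ∈ D, MemAC T (fun t => (E t u).toReal)) ∧
  ∃ b : ℝ → ℝ, IntervalIntegrable b volume 0 T ∧
    ∀ᵐ t ∂(volume.restrict (Icc 0 T)), 0 ≤ b t ∧ ∀ u ∈ D,
      DifferentiableAt ℝ (fun s => (E s u).toReal) t ∧
        |power E t u| ≤ b t * ((E t u).toReal + 1)

/-- Coercivity: `E(0,·)` has bounded sublevels. -/
def Coercive (E : ℝ → U → ℝ≥0∞) : Prop :=
  ∀ c : ℝ, Bornology.IsBounded {u : U | E 0 u ≤ ENNReal.ofReal c}

/-- Power continuity. -/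
def PowerContinuity (e : Embeddings U V W Z) (T : ℝ) (E : ℝ → U → ℝ≥0∞) : Prop :=
  ∀ K : ℝ, 0 < K → ∃ γ ω : ℝ → ℝ, IntervalIntegrable γ volume 0 T ∧ IsModulus ω ∧
    ∀ᵐ t ∂(volume.restrict (Icc 0 T)), ∀ u₁ u₂ : U,
      E 0 u₁ ≤ ENNReal.ofReal K → E 0 u₂ ≤ ENNReal.ofReal K →
        |power E t u₁ - power E t u₂| ≤ γ t * ω ‖e.UW (u₁ - u₂)‖

/-- Lipschitz power condition with respect to `X`, for an embedding `i : U ↪ X`. -/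
def LipschitzPower {X : Type*} [NormedAddCommGroup X] [NormedSpace ℝ X]
    (T : ℝ) (E : ℝ → U → ℝ≥0∞) (i : U →L[ℝ] X) : Prop :=
  ∀ K : ℝ, 0 < K → ∃ γ : ℝ → ℝ, IntervalIntegrable γ volume 0 T ∧
    ∀ᵐ t ∂(volume.restrict (Icc 0 T)), ∀ u₁ u₂ : U,
      E 0 u₁ ≤ ENNReal.ofReal K → E 0 u₂ ≤ ENNReal.ofReal K →
        |power E t u₁ - power E t u₂| ≤ γ t * ‖i (u₁ - u₂)‖

/-- Uniform convexity with respect to `X`, for an embedding `i : U ↪ X`. -/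
def UniformlyConvexEnergy {X : Type*} [NormedAddCommGroup X] [NormedSpace ℝ X]
    (T : ℝ) (E : ℝ → U → ℝ≥0∞) (i : U →L[ℝ] X) : Prop :=
  ∃ μ : ℝ, 0 < μ ∧ ∀ t ∈ Icc (0 : ℝ) T, ∀ θ ∈ Ioo (0 : ℝ) 1, ∀ u₁ u₂ : U,
    E t (θ • u₁ + (1 - θ) • u₂)
        + ENNReal.ofReal (μ / 2 * θ * (1 - θ) * ‖i (u₁ - u₂)‖ ^ 2)
      ≤ ENNReal.ofReal θ * E t u₁ + ENNReal.ofReal (1 - θ) * E t u₂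

/-- Global stability of `u` at time `t`. -/
def GloballyStable (e : Embeddings U V W Z) (R : Z → ℝ) (E : ℝ → U → ℝ≥0∞)
    (t : ℝ) (u : U) : Prop :=
  ∀ x : U, E t u ≤ E t x + ENNReal.ofReal (R (e.UZ (x - u)))

/-! ### Dissipative dynamic solutions -/

/-- `R_ε(v) = ε/2 |v|²_𝕍 + R(v)` on `V`. -/
def viscousDissipation (e : Embeddings U V W Z) (Vis : V →L[ℝ] StrongDual ℝ V) (R : Z → ℝ)
    (ε : ℝ) (v : V) : ℝ :=
  ε / 2 * Vis v v + R (e.VZ v)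

/-- The Fenchel conjugate `R_ε^*` on `V*`. -/
def viscousDissipationConj (e : Embeddings U V W Z) (Vis : V →L[ℝ] StrongDual ℝ V) (R : Z → ℝ)
    (ε : ℝ) (ζ : StrongDual ℝ V) : ℝ :=
  (fenchelConj (fun v => (viscousDissipation e Vis R ε v : EReal)) ζ).toReal

/-- `u` is a dissipative dynamic solution of
`ε² M ü + ε 𝕍 u̇ + ∂R(u̇) + ∂E(t,u) ∋ 0` with `u(0) = u₀`, `u̇(0) = u₁`, and `v` is its velocity
as an element of `L²(0,T; V)`. Further, `w` is the velocity as a weakly continuous `W`-valued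
function, `a` the acceleration in `L²(0,T; U*)`, and `ζ` is `-ε² M ü - ξ` as a `V*`-valued
function. -/
def IsDissipativeDynamicSolution (e : Embeddings U V W Z)
    (M : StrongDual ℝ U ≃L[ℝ] StrongDual ℝ U) (MW : W →L[ℝ] W)
    (Vis : V →L[ℝ] StrongDual ℝ V) (R : Z → ℝ) (T : ℝ) (E : ℝ → U → ℝ≥0∞) (D : Set U)
    (ε : ℝ) (u₀ : U) (u₁ : V) (u : ℝ → U) (v : ℝ → V) : Prop :=
  (∀ t ∈ Icc (0 : ℝ) T, u t ∈ D) ∧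
  MemCw T u ∧
  MemW12 T (fun t => e.UV (u t)) v ∧
  MemLp (fun t => (E t (u t)).toReal) ⊤ (volume.restrict (Icc 0 T)) ∧
  ∃ (w : ℝ → W) (a ξ : ℝ → StrongDual ℝ U) (η : ℝ → StrongDual ℝ Z) (ζ : ℝ → StrongDual ℝ V),
    MemC1w T (fun t => e.UW (u t)) w ∧
    (∀ᵐ t ∂(volume.restrict (Icc 0 T)), e.VW (v t) = w t) ∧
    MemW12 T (fun t => e.WdualU (w t)) a ∧
    u 0 = u₀ ∧ w 0 = e.VW u₁ ∧
    AEStronglyMeasurable ξ (volume.restrict (Icc 0 T)) ∧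
    (∀ᵐ t ∂(volume.restrict (Icc 0 T)),
      η t ∈ dissSubdiff R (e.VZ (v t)) ∧ ξ t ∈ energySubdiff E t (u t) ∧
      ε ^ 2 • M (a t) + ε • e.VdualU (Vis (v t)) + e.ZdualU (η t) + ξ t = 0) ∧
    (∀ᵐ t ∂(volume.restrict (Icc 0 T)), e.VdualU (ζ t) = -(ε ^ 2 • M (a t)) - ξ t) ∧
    IntervalIntegrable
      (fun r => viscousDissipation e Vis R ε (v r) + viscousDissipationConj e Vis R ε (ζ r))
      volume 0 T ∧
    IntervalIntegrable (fun r => power E r (u r)) volume 0 T ∧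
    ∃ N ⊆ Ioc (0 : ℝ) T, volume N = 0 ∧ ∀ t ∈ Icc (0 : ℝ) T \ N,
      ε ^ 2 / 2 * ⟪MW (w t), w t⟫ + (E t (u t)).toReal
        + ∫ r in (0 : ℝ)..t,
            (viscousDissipation e Vis R ε (v r) + viscousDissipationConj e Vis R ε (ζ r))
      = ε ^ 2 / 2 * ⟪MW (e.VW u₁), e.VW u₁⟫ + (E 0 u₀).toReal
        + ∫ r in (0 : ℝ)..t, power E r (u r)

/-! ### `R`-variation, one-sided limits and jumps -/

/-- The `R`-variation `V_R(f; a, b)`. Repetitions among the points of a partition contribute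
`R 0 = 0`. -/
def rVariation (R : Z → ℝ) (f : ℝ → Z) (a b : ℝ) : ℝ≥0∞ :=
  ⨆ p : ℕ × {τ : ℕ → ℝ // Monotone τ},
    ⨆ _ : p.2.1 0 = a ∧ p.2.1 p.1 = b,
      ∑ k ∈ Finset.range p.1, ENNReal.ofReal (R (f (p.2.1 (k + 1)) - f (p.2.1 k)))

/-- `fp` and `fm` are the right and left limits of `f : [0,T] → Z`, with the conventions
`f⁺(T) = f(T)` and `f⁻(0) = f(0)`. -/
def HasOneSidedLimits (T : ℝ) (f fp fm : ℝ → Z) : Prop :=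
  (∀ t ∈ Ico (0 : ℝ) T, Tendsto f (𝓝[>] t) (𝓝 (fp t))) ∧ fp T = f T ∧
  (∀ t ∈ Ioc (0 : ℝ) T, Tendsto f (𝓝[<] t) (𝓝 (fm t))) ∧ fm 0 = f 0

/-- The jump set `J_f`. -/
def jumpSet (T : ℝ) (f : ℝ → Z) : Set ℝ :=
  {t | t ∈ Icc 0 T ∧ ¬ ContinuousWithinAt f (Icc 0 T) t}

/-- The purely jump part `f_J` of a function of bounded variation on `[0,T]`. -/
def jumpPart (f fp fm : ℝ → Z) (t : ℝ) : Z :=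
  (∑' r : Ico (0 : ℝ) t, (fp r - fm r)) + (f t - fm t)

/-- The essential `R`-variation
`V_R(f_co; s, t) + ∑_{r ∈ J^e ∩ [s,t]} R(f⁺(r) - f⁻(r))`, where `f_co = f - f_J`. -/
def essVariation (R : Z → ℝ) (f fp fm : ℝ → Z) (s t : ℝ) : ℝ≥0∞ :=
  rVariation R (fun r => f r - jumpPart f fp fm r) s t
    + ∑' r : {r : ℝ // r ∈ Icc s t ∧ fp r ≠ fm r}, ENNReal.ofReal (R (fp r - fm r))

/-! ### Solutions of the rate-independent system -/

/-- Essential energetic solutions; `up`, `um` are the right and left limits of `u`. -/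
def IsEssentialEnergeticSolution (e : Embeddings U V W Z) (R : Z → ℝ) (T : ℝ)
    (E : ℝ → U → ℝ≥0∞) (D : Set U) (u₀ : U) (u : ℝ → U) : Prop :=
  u 0 = u₀ ∧
  (∀ t ∈ Icc (0 : ℝ) T \ jumpSet T (fun s => e.UZ (u s)), GloballyStable e R E t (u t)) ∧
  IntervalIntegrable (fun r => power E r (u r)) volume 0 T ∧
  ∃ up um : ℝ → U,
    HasOneSidedLimits T (fun s => e.UZ (u s)) (fun s => e.UZ (up s)) (fun s => e.UZ (um s)) ∧
    (∀ t ∈ Icc (0 : ℝ) T, up t ∈ D ∧ um t ∈ D) ∧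
    ∀ s t : ℝ, 0 ≤ s → s ≤ t → t ≤ T →
      essVariation R (fun r => e.UZ (u r)) (fun r => e.UZ (up r)) (fun r => e.UZ (um r)) s t ≠ ⊤ ∧
      (E t (up t)).toReal
        + (essVariation R (fun r => e.UZ (u r)) (fun r => e.UZ (up r))
            (fun r => e.UZ (um r)) s t).toReal
      = (E s (um s)).toReal + ∫ r in s..t, power E r (u r)

/-- Energetic solutions. -/
def IsEnergeticSolution (e : Embeddings U V W Z) (R : Z → ℝ) (T : ℝ)
    (E : ℝ → U → ℝ≥0∞) (u₀ : U) (u : ℝ → U) : Prop :=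
  u 0 = u₀ ∧
  IntervalIntegrable (fun r => power E r (u r)) volume 0 T ∧
  ∀ t ∈ Icc (0 : ℝ) T,
    GloballyStable e R E t (u t) ∧
    rVariation R (fun r => e.UZ (u r)) 0 t ≠ ⊤ ∧
    (E t (u t)).toReal + (rVariation R (fun r => e.UZ (u r)) 0 t).toReal
      = (E 0 u₀).toReal + ∫ r in (0 : ℝ)..t, power E r (u r)

/-- Classical solutions, for `U ↪ X ↪ Z` by `i` and `j`: `u` is differentiable in `X` almost
everywhere, `∂^Z R(u̇(t)) + ∂^U E(t, u(t)) ∋ 0` in `U*` for a.e. `t`, and `u(0) = u₀`. -/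
def IsClassicalSolution {X : Type*} [NormedAddCommGroup X] [NormedSpace ℝ X]
    (e : Embeddings U V W Z) (R : Z → ℝ) (T : ℝ) (E : ℝ → U → ℝ≥0∞)
    (i : U →L[ℝ] X) (j : X →L[ℝ] Z) (u₀ : U) (u : ℝ → U) : Prop :=
  (∀ᵐ t ∂(volume.restrict (Icc 0 T)), ∃ x : X, HasDerivAt (fun s => i (u s)) x t ∧
    ∃ η ∈ dissSubdiff R (j x), ∃ ξ ∈ energySubdiff E t (u t), e.ZdualU η + ξ = 0) ∧
  u 0 = u₀

end Setting

end

end RateIndependent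

open RateIndependent

namespace RateIndependent

/-! ### Selection principles -/

lemma exists_subseq_tendsto_of_countable {ι Y : Type*} [Countable ι] [MetricSpace Y] {K : Set Y}
    (hK : IsCompact K) (z : ℕ → ι → Y) (hz : ∀ n i, z n i ∈ K) :
    ∃ φ : ℕ → ℕ, StrictMono φ ∧ ∃ l : ι → Y, ∀ i,
      Tendsto (fun n => z (φ n) i) atTop (𝓝 (l i)) := by
  obtain ⟨l, -, φ, hφ, h⟩ := (isCompact_univ_pi (fun _ : ι => hK)).tendsto_subseq
    (x := z) (fun n i _ => hz n i)
  exact ⟨φ, hφ, l, fun i => (tendsto_pi_nhds.1 h i)⟩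

lemma countable_not_rat_continuous (v : ℚ → ℝ) (hv : Monotone v) (C : ℝ) (hC : ∀ q, v q ∈ Icc 0 C) :
    {t : ℝ | ¬ ∀ δ > 0, ∃ q q' : ℚ, (q : ℝ) < t ∧ t < q' ∧ v q' - v q < δ}.Countable := by
  set w : ℝ → ℝ := fun t => ⨆ q : {q : ℚ // (q : ℝ) < t}, v q with hw
  have hbdd : ∀ t, BddAbove (range fun q : {q : ℚ // (q : ℝ) < t} => v q) := by
    rintro t
    exact ⟨C, by rintro _ ⟨q, rfl⟩; exact (hC q).2⟩
  have hne : ∀ t : ℝ, Nonempty {q : ℚ // (q : ℝ) < t} := fun t =>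
    let ⟨q, hq⟩ := exists_rat_lt t; ⟨⟨q, hq⟩⟩
  have hmono : Monotone w := by
    intro s t hst
    refine ciSup_le fun q => ?_
    exact le_ciSup (hbdd t) ⟨q.1, q.2.trans_le hst⟩
  refine hmono.countable_not_continuousAt.mono fun t ht => ?_
  simp only [mem_ofPred_eq] at ht ⊢
  refine fun hcont => ht fun δ hδ => ?_
  obtain ⟨κ, hκ, h⟩ := Metric.continuousAt_iff.1 hcont (δ / 2) (by positivity)
  obtain ⟨q, hq1, hq2⟩ := exists_rat_btwn (show t - κ / 2 < t by linarith)
  obtain ⟨q', hq1', hq2'⟩ := exists_rat_btwn (show t < t + κ / 2 by linarith)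
  refine ⟨q, q', hq2, hq1', ?_⟩
  have h1 : w (t - κ / 2) ≤ v q := by
    refine ciSup_le fun p => hv ?_
    have := p.2.trans hq1
    exact_mod_cast this.le
  have h2 : v q' ≤ w (t + κ / 2) := le_ciSup (hbdd (t + κ / 2)) ⟨q', hq2'⟩
  have h3 := h (x := t - κ / 2) (by rw [Real.dist_eq]; rw [abs_lt]; constructor <;> linarith)
  have h4 := h (x := t + κ / 2) (by rw [Real.dist_eq]; rw [abs_lt]; constructor <;> linarith)
  rw [Real.dist_eq, abs_lt] at h3 h4
  linarith [h3.1, h4.2]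

/-- Helly's selection principle in a compact metric space. -/
theorem helly_selection {Y : Type*} [MetricSpace Y] {K : Set Y} (hK : IsCompact K)
    (z : ℕ → ℝ → Y) (hz : ∀ n t, z n t ∈ K) (V : ℕ → ℝ → ℝ) (hVm : ∀ n, Monotone (V n)) (C : ℝ)
    (hV : ∀ n t, V n t ∈ Icc 0 C)
    (hzV : ∀ n s t, s ≤ t → dist (z n s) (z n t) ≤ V n t - V n s) :
    ∃ φ : ℕ → ℕ, StrictMono φ ∧ ∃ l : ℝ → Y, ∀ t,
      Tendsto (fun n => z (φ n) t) atTop (𝓝 (l t)) := by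
  obtain ⟨φ, hφ, v, hv⟩ := exists_subseq_tendsto_of_countable (ι := ℚ) (isCompact_Icc (a := 0) (b := C))
    (fun n q => V n q) (fun n q => hV n q)
  have hvm : Monotone v := fun q q' h => le_of_tendsto_of_tendsto' (hv q) (hv q')
    fun n => hVm _ (by exact_mod_cast h)
  have hvC : ∀ q, v q ∈ Icc 0 C := fun q => isClosed_Icc.mem_of_tendsto (hv q)
    (Eventually.of_forall fun n => hV _ _)
  set J := {t : ℝ | ¬ ∀ δ > 0, ∃ q q' : ℚ, (q : ℝ) < t ∧ t < q' ∧ v q' - v q < δ} with hJ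
  have hJc : (J ∪ range ((↑) : ℚ → ℝ)).Countable :=
    (countable_not_rat_continuous v hvm C hvC).union (countable_range _)
  have := hJc.to_subtype
  obtain ⟨ψ, hψ, l, hl⟩ := exists_subseq_tendsto_of_countable
    (ι := (J ∪ range ((↑) : ℚ → ℝ) : Set ℝ)) hK (fun n t => z (φ n) t) (fun n t => hz _ _)
  refine ⟨φ ∘ ψ, hφ.comp hψ, ?_⟩
  suffices ∀ t, ∃ y, Tendsto (fun n => z (φ (ψ n)) t) atTop (𝓝 y) by
    choose y hy using this
    exact ⟨y, hy⟩
  intro t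
  by_cases ht : t ∈ J
  · exact ⟨_, hl ⟨t, Or.inl ht⟩⟩
  have hcomplete := hK.isComplete
  have hcau : CauchySeq (fun n => z (φ (ψ n)) t) := by
    rw [Metric.cauchySeq_iff']
    intro δ hδ
    simp only [hJ, mem_ofPred_eq, not_not] at ht
    obtain ⟨q, q', hq, hq', hqq⟩ := ht (δ / 6) (by positivity)
    have hz_cau := (hl ⟨q, Or.inr ⟨q, rfl⟩⟩).cauchySeq
    rw [Metric.cauchySeq_iff'] at hz_cau
    obtain ⟨N1, hN1⟩ := hz_cau (δ / 3) (by positivity)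
    have h1 : Tendsto (fun n => V (φ (ψ n)) q' - V (φ (ψ n)) q) atTop (𝓝 (v q' - v q)) :=
      ((hv q').sub (hv q)).comp hψ.tendsto_atTop
    obtain ⟨N2, hN2⟩ := eventually_atTop.1 (h1.eventually (gt_mem_nhds hqq))
    have key : ∀ n ≥ max N1 N2, dist (z (φ (ψ n)) t) (z (φ (ψ n)) q) < δ / 6 := by
      intro n hn
      rw [dist_comm]
      have h2 := hzV (φ (ψ n)) q t hq.le
      have h3 := hVm (φ (ψ n)) hq'.le
      have h4 := hN2 n ((le_max_right _ _).trans hn)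
      linarith
    have hmid : ∀ n ≥ max N1 N2, dist (z (φ (ψ n)) q) (z (φ (ψ N1)) q) < δ / 3 :=
      fun n hn => hN1 n ((le_max_left _ _).trans hn)
    refine ⟨max N1 N2, fun n hn => ?_⟩
    have e1 := key n hn
    have e2 := key _ le_rfl
    have e3 := hmid n hn
    have e4 := hmid _ le_rfl
    have t1 := dist_triangle (z (φ (ψ n)) t) (z (φ (ψ n)) q) (z (φ (ψ (max N1 N2))) t)
    have t2 := dist_triangle (z (φ (ψ n)) q) (z (φ (ψ N1)) q) (z (φ (ψ (max N1 N2))) t)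
    have t3 := dist_triangle_left (z (φ (ψ N1)) q) (z (φ (ψ (max N1 N2))) t)
      (z (φ (ψ (max N1 N2))) q)
    rw [dist_comm (z (φ (ψ (max N1 N2))) q) (z (φ (ψ (max N1 N2))) t)] at t3
    linarith
  obtain ⟨y, -, hy⟩ := cauchySeq_tendsto_of_isComplete hcomplete (fun n => hz (φ (ψ n)) t) hcau
  exact ⟨y, hy⟩

/-! ### Weak convergence -/

section Weak

variable {X : Type*} [NormedAddCommGroup X] [NormedSpace ℝ X]

lemma exists_weak_limit_ultrafilter (hX : IsReflexive X) {α : Type*} (F : Ultrafilter α) (x : α → X)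
    (C : ℝ) (hx : ∀ᶠ a in (F : Filter α), ‖x a‖ ≤ C) :
    ∃ y : X, ∀ L : StrongDual ℝ X, Tendsto (fun a => L (x a)) F (𝓝 (L y)) := by
  set g : α → WeakDual ℝ (StrongDual ℝ X) := fun a =>
    StrongDual.toWeakDual (NormedSpace.inclusionInDoubleDual ℝ X (x a)) with hg
  have hcomp := WeakDual.isCompact_closedBall (𝕜 := ℝ) (0 : StrongDual ℝ (StrongDual ℝ X)) C
  obtain ⟨Y, -, hY⟩ := hcomp.ultrafilter_le_nhds' (F.map g) (by
    rw [Ultrafilter.mem_map]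
    filter_upwards [hx] with a ha
    simp only [mem_preimage, Metric.mem_closedBall, dist_zero_right, hg]
    exact (NormedSpace.double_dual_bound ℝ X (x a)).trans ha)
  obtain ⟨y, hy⟩ := hX (WeakDual.toStrongDual Y)
  refine ⟨y, fun L => ?_⟩
  have h1 : Tendsto g F (𝓝 Y) := hY
  have h2 := ((WeakDual.eval_continuous L).tendsto Y).comp h1
  have h3 : L y = Y L := by
    have := congrArg (fun f => f L) hy
    simpa using this
  rw [h3]
  exact h2

/-- Bounded nets in a reflexive space whose images under an injective operator converge are weakly
convergent. -/
lemma exists_weak_limit_of_tendsto (hX : IsReflexive X) {Y : Type*} [NormedAddCommGroup Y]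
    [NormedSpace ℝ Y] (S : X →L[ℝ] Y) (hS : Function.Injective S) {α : Type*} {l : Filter α} [l.NeBot]
    {x : α → X} {C : ℝ} (hx : ∀ᶠ a in l, ‖x a‖ ≤ C) {y : Y}
    (hy : Tendsto (fun a => S (x a)) l (𝓝 y)) :
    ∃ x₀ : X, S x₀ = y ∧ ∀ L : StrongDual ℝ X, Tendsto (fun a => L (x a)) l (𝓝 (L x₀)) := by
  have key : ∀ F : Ultrafilter α, ↑F ≤ l → ∃ x₀ : X, S x₀ = y ∧
      ∀ L : StrongDual ℝ X, Tendsto (fun a => L (x a)) F (𝓝 (L x₀)) := by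
    intro F hF
    obtain ⟨x₀, h⟩ := exists_weak_limit_ultrafilter hX F x C (hF hx)
    refine ⟨x₀, ?_, h⟩
    refine (SeparatingDual.eq_iff_forall_dual_eq (R := ℝ)).2 fun L => ?_
    exact tendsto_nhds_unique (h (L ∘L S)) (((L.continuous.tendsto y).comp hy).mono_left hF)
  obtain ⟨x₀, h0, -⟩ := key (Ultrafilter.of l) (Ultrafilter.of_le l)
  refine ⟨x₀, h0, fun L => tendsto_iff_ultrafilter _ _ _ |>.2 fun F hF => ?_⟩
  obtain ⟨x₁, h1, h2⟩ := key F hF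
  rw [hS (h0.trans h1.symm)]
  exact h2 L

lemma weak_tendsto_of_tendsto (hX : IsReflexive X) {Y : Type*} [NormedAddCommGroup Y]
    [NormedSpace ℝ Y] (S : X →L[ℝ] Y) (hS : Function.Injective S) {α : Type*} {l : Filter α}
    {x : α → X} {C : ℝ} (hx : ∀ᶠ a in l, ‖x a‖ ≤ C) {x₀ : X}
    (hy : Tendsto (fun a => S (x a)) l (𝓝 (S x₀))) (L : StrongDual ℝ X) :
    Tendsto (fun a => L (x a)) l (𝓝 (L x₀)) := by
  rcases l.eq_or_neBot with rfl | h
  · exact tendsto_bot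
  obtain ⟨x₁, h1, h2⟩ := exists_weak_limit_of_tendsto hX S hS hx hy
  rw [← hS h1]
  exact h2 L

/-- Compact operators map bounded weakly convergent nets to convergent ones. -/
lemma _root_.IsCompactOperator.tendsto_of_weak {Y : Type*} [NormedAddCommGroup Y] [NormedSpace ℝ Y]
    {S : X →L[ℝ] Y} (hS : IsCompactOperator S) {α : Type*} {l : Filter α} {x : α → X} {C : ℝ}
    (hx : ∀ᶠ a in l, ‖x a‖ ≤ C) {x₀ : X}
    (hw : ∀ L : StrongDual ℝ X, Tendsto (fun a => L (x a)) l (𝓝 (L x₀))) :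
    Tendsto (fun a => S (x a)) l (𝓝 (S x₀)) := by
  have hK := hS.isCompact_closure_image_closedBall (f := (S : X →ₗ[ℝ] Y)) C
  refine tendsto_iff_ultrafilter _ _ _ |>.2 fun F hF => ?_
  obtain ⟨y, -, hy⟩ := hK.ultrafilter_le_nhds' (F.map fun a => S (x a)) (by
    rw [Ultrafilter.mem_map]
    filter_upwards [hF hx] with a ha
    exact subset_closure ⟨x a, by simpa using ha, rfl⟩)
  have hy' : Tendsto (fun a => S (x a)) F (𝓝 y) := hy
  have : y = S x₀ := by
    refine (SeparatingDual.eq_iff_forall_dual_eq (R := ℝ)).2 fun L => ?_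
    exact tendsto_nhds_unique ((L.continuous.tendsto y).comp hy') ((hw (L ∘L S)).mono_left hF)
  rwa [this] at hy'

lemma norm_le_of_weak_tendsto {α : Type*} {l : Filter α} [l.NeBot] {x : α → X} {x₀ : X} {C : ℝ}
    (hw : ∀ L : StrongDual ℝ X, Tendsto (fun a => L (x a)) l (𝓝 (L x₀)))
    (hx : ∃ᶠ a in l, ‖x a‖ ≤ C) : ‖x₀‖ ≤ C := by
  obtain ⟨a, ha⟩ := hx.exists
  have hC : 0 ≤ C := (norm_nonneg _).trans ha
  refine NormedSpace.norm_le_dual_bound ℝ x₀ hC fun L => ?_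
  refine le_of_tendsto_of_frequently (hw L).norm (hx.mono fun a ha => ?_)
  rw [mul_comm]
  exact (L.le_opNorm _).trans (by gcongr)

lemma stronglyMeasurable_of_weaklyContinuous [TopologicalSpace.SeparableSpace X] {α : Type*}
    [TopologicalSpace α] [MeasurableSpace α] [OpensMeasurableSpace α] {f : α → X}
    (hf : ∀ L : StrongDual ℝ X, Continuous fun t => L (f t)) : StronglyMeasurable f := by
  borelize X
  have : SecondCountableTopology X := UniformSpace.secondCountable_of_separable X
  refine Measurable.stronglyMeasurable ?_
  have hcl : ∀ (y : X) (r : ℝ), IsClosed {t | ‖f t - y‖ ≤ r} := by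
    intro y r
    refine isClosed_iff_clusterPt.2 fun t ht => ?_
    have hne : (𝓝 t ⊓ 𝓟 {t | ‖f t - y‖ ≤ r}).NeBot := ht
    refine @norm_le_of_weak_tendsto X _ _ _ _ hne (fun s => f s - y) (f t - y) r (fun L => ?_) ?_
    · simp only [map_sub]
      exact (((hf L).tendsto t).mono_left inf_le_left).sub tendsto_const_nhds
    · exact @Eventually.frequently _ _ hne _ (eventually_inf_principal.2 (Eventually.of_forall fun s hs => hs))
  have hball : ∀ (y : X) (r : ℝ), MeasurableSet (f ⁻¹' Metric.ball y r) := by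
    intro y r
    have : f ⁻¹' Metric.ball y r = ⋃ q : {q : ℚ // (q : ℝ) < r}, {t | ‖f t - y‖ ≤ (q : ℚ)} := by
      ext t
      simp only [mem_preimage, Metric.mem_ball, dist_eq_norm, mem_iUnion, mem_ofPred_eq]
      constructor
      · intro h
        obtain ⟨q, h1, h2⟩ := exists_rat_btwn h
        exact ⟨⟨q, h2⟩, h1.le⟩
      · rintro ⟨q, hq⟩
        exact hq.trans_lt q.2
    rw [this]
    exact MeasurableSet.iUnion fun q => (hcl _ _).measurableSet
  refine measurable_of_isOpen fun O hO => ?_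
  have hO' : O = ⋃ p : {p : ℕ × ℚ // Metric.ball (TopologicalSpace.denseSeq X p.1) p.2 ⊆ O},
      Metric.ball (TopologicalSpace.denseSeq X p.1.1) p.1.2 := by
    refine Subset.antisymm (fun x hx => ?_) (iUnion_subset fun p => p.2)
    obtain ⟨δ, hδ, hb⟩ := Metric.isOpen_iff.1 hO x hx
    obtain ⟨q, hq1, hq2⟩ := exists_rat_btwn (show (0 : ℝ) < δ / 2 by positivity)
    obtain ⟨n, hn⟩ := (TopologicalSpace.denseRange_denseSeq X).exists_dist_lt x hq1
    refine mem_iUnion.2 ⟨⟨(n, q), fun y hy => hb ?_⟩, hn⟩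
    have := dist_triangle_right y x (TopologicalSpace.denseSeq X n)
    simp only [Metric.mem_ball] at hy ⊢
    linarith
  rw [hO', preimage_iUnion]
  exact MeasurableSet.iUnion fun p => hball _ _

end Weak

/-! ### Absolutely continuous functions -/

lemma ae_restrict_uIoc {T s t : ℝ} {P : ℝ → Prop} (h : ∀ᵐ r ∂(volume.restrict (Icc 0 T)), P r)
    (hs : s ∈ Icc (0 : ℝ) T) (ht : t ∈ Icc (0 : ℝ) T) : ∀ᵐ r ∂(volume.restrict (uIoc s t)), P r :=
  ae_mono (Measure.restrict_mono_set _ (uIoc_subset_uIcc.trans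
    ((convex_Icc (0 : ℝ) T).ordConnected.uIcc_subset hs ht))) h

lemma ae_imp_of_ae_Icc {T s t : ℝ} {P : ℝ → Prop} (h : ∀ᵐ r ∂(volume.restrict (Icc 0 T)), P r)
    (hs : s ∈ Icc (0 : ℝ) T) (ht : t ∈ Icc (0 : ℝ) T) : ∀ᵐ r, r ∈ uIoc s t → P r :=
  (ae_restrict_iff' measurableSet_uIoc).1 (ae_restrict_uIoc h hs ht)

lemma ae_Icc_iff_Ioo {T : ℝ} {P : ℝ → Prop} :
    (∀ᵐ r ∂(volume.restrict (Icc 0 T)), P r) ↔ ∀ᵐ r, r ∈ Ioo 0 T → P r := by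
  rw [← ae_restrict_iff' measurableSet_Ioo, Measure.restrict_congr_set Ioo_ae_eq_Icc]

lemma _root_.IntervalIntegrable.sub_Icc {X : Type*} [NormedAddCommGroup X] {T s t : ℝ} {f : ℝ → X}
    (h : IntervalIntegrable f volume 0 T) (hs : s ∈ Icc (0 : ℝ) T) (ht : t ∈ Icc (0 : ℝ) T) :
    IntervalIntegrable f volume s t :=
  h.mono_set (by rw [uIcc_of_le (hs.1.trans hs.2)]
                 exact (convex_Icc (0 : ℝ) T).ordConnected.uIcc_subset hs ht)

lemma integrableOn_Icc_iff {X : Type*} [NormedAddCommGroup X] {T : ℝ} (hT : 0 ≤ T) {f : ℝ → X} :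
    IntervalIntegrable f volume 0 T ↔ IntegrableOn f (Icc 0 T) volume := by
  rw [intervalIntegrable_iff_integrableOn_Icc_of_le hT]

lemma _root_.AbsolutelyContinuousOnInterval.of_dist_le {Y Y' : Type*} [PseudoMetricSpace Y]
    [PseudoMetricSpace Y'] {f : ℝ → Y} {g : ℝ → Y'} {a b : ℝ}
    (hg : AbsolutelyContinuousOnInterval g a b)
    (h : ∀ x ∈ uIcc a b, ∀ y ∈ uIcc a b, dist (f x) (f y) ≤ dist (g x) (g y)) :
    AbsolutelyContinuousOnInterval f a b := by
  rw [absolutelyContinuousOnInterval_iff] at hg ⊢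
  intro δ hδ
  obtain ⟨κ, hκ, H⟩ := hg δ hδ
  refine ⟨κ, hκ, fun I hI hI' => (Finset.sum_le_sum fun i hi => ?_).trans_lt (H I hI hI')⟩
  exact h _ (hI.1 i hi).1 _ (hI.1 i hi).2

section AC

variable {X : Type*} [NormedAddCommGroup X] {T : ℝ}

lemma intervalIntegral_sub_Icc {X : Type*} [NormedAddCommGroup X] [NormedSpace ℝ X]
    {T s t : ℝ} {φ : ℝ → X} (hφ : IntervalIntegrable φ volume 0 T) (hs : s ∈ Icc (0 : ℝ) T)
    (ht : t ∈ Icc (0 : ℝ) T) :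
    (∫ r in (0 : ℝ)..t, φ r) - ∫ r in (0 : ℝ)..s, φ r = ∫ r in s..t, φ r := by
  have h0 : (0 : ℝ) ∈ Icc (0 : ℝ) T := ⟨le_rfl, hs.1.trans hs.2⟩
  exact intervalIntegral.integral_interval_sub_left (hφ.sub_Icc h0 ht) (hφ.sub_Icc h0 hs)

lemma MemAC.absolutelyContinuousOnInterval {f : ℝ → X} (hf : MemAC T f) {s t : ℝ}
    (hs : s ∈ Icc (0 : ℝ) T) (ht : t ∈ Icc (0 : ℝ) T) : AbsolutelyContinuousOnInterval f s t := by
  obtain ⟨φ, hφ, -, h⟩ := hf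
  have hsub : uIcc s t ⊆ Icc 0 T := (convex_Icc (0 : ℝ) T).ordConnected.uIcc_subset hs ht
  have h0 : 0 ≤ T := hs.1.trans hs.2
  have h1 := hφ.absolutelyContinuousOnInterval_intervalIntegral (c := 0) left_mem_uIcc
  refine (h1.mono (by rwa [uIcc_of_le h0])).of_dist_le fun x hx y hy => ?_
  rw [Real.dist_eq, intervalIntegral_sub_Icc hφ (hsub hy) (hsub hx), dist_eq_norm]
  exact h y (hsub hy) x (hsub hx)

lemma MemAC.continuousOn {f : ℝ → X} (hT : 0 ≤ T) (hf : MemAC T f) : ContinuousOn f (Icc 0 T) := by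
  have := (hf.absolutelyContinuousOnInterval (left_mem_Icc.2 hT) (right_mem_Icc.2 hT)).continuousOn
  rwa [uIcc_of_le hT] at this

lemma MemAC.intervalIntegrable_deriv {f : ℝ → ℝ} (hf : MemAC T f) {s t : ℝ}
    (hs : s ∈ Icc (0 : ℝ) T) (ht : t ∈ Icc (0 : ℝ) T) : IntervalIntegrable (deriv f) volume s t :=
  (hf.absolutelyContinuousOnInterval hs ht).intervalIntegrable_deriv

lemma MemAC.integral_deriv {f : ℝ → ℝ} (hf : MemAC T f) {s t : ℝ}
    (hs : s ∈ Icc (0 : ℝ) T) (ht : t ∈ Icc (0 : ℝ) T) : ∫ r in s..t, deriv f r = f t - f s :=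
  (hf.absolutelyContinuousOnInterval hs ht).integral_deriv_eq_sub

lemma MemAC.ae_differentiableAt {f : ℝ → ℝ} (hT : 0 ≤ T) (hf : MemAC T f) :
    ∀ᵐ t ∂(volume.restrict (Icc 0 T)), DifferentiableAt ℝ f t := by
  rw [ae_restrict_iff' measurableSet_Icc]
  have := (hf.absolutelyContinuousOnInterval (left_mem_Icc.2 hT)
    (right_mem_Icc.2 hT)).ae_differentiableAt
  rwa [uIcc_of_le hT] at this

lemma memAC_of_intervalIntegral [NormedSpace ℝ X] {φ : ℝ → X} (hφ : IntervalIntegrable φ volume 0 T) :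
    MemAC T fun t => ∫ r in (0 : ℝ)..t, φ r := by
  refine ⟨fun r => ‖φ r‖, hφ.norm, fun t _ => norm_nonneg _, fun s hs t ht => ?_⟩
  rw [intervalIntegral_sub_Icc hφ hs ht]
  exact intervalIntegral.norm_integral_le_abs_integral_norm

/-- Gronwall's inequality in logarithmic form. -/
lemma abs_log_sub_log_le {f b : ℝ → ℝ} (hT : 0 ≤ T) (hf : MemAC T f)
    (h1 : ∀ t ∈ Icc (0 : ℝ) T, 1 ≤ f t) (hb : IntervalIntegrable b volume 0 T)
    (hfb : ∀ᵐ t ∂(volume.restrict (Icc 0 T)), |deriv f t| ≤ b t * f t) {s t : ℝ}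
    (hs : s ∈ Icc (0 : ℝ) T) (ht : t ∈ Icc (0 : ℝ) T) :
    |Real.log (f t) - Real.log (f s)| ≤ |∫ r in s..t, b r| := by
  have hlog : MemAC T fun t => Real.log (f t) := by
    obtain ⟨φ, hφ, hφ0, h⟩ := hf
    have key : ∀ x y : ℝ, 1 ≤ x → 1 ≤ y → Real.log x - Real.log y ≤ |x - y| := by
      intro x y hx hy
      rw [← Real.log_div (by positivity) (by positivity)]
      have h2 := Real.log_le_sub_one_of_pos (show 0 < x / y by positivity)
      have h3 : x / y - 1 = (x - y) / y := by field_simp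
      rw [h3] at h2
      refine h2.trans ((le_abs_self _).trans ?_)
      rw [abs_div, abs_of_pos (by positivity : 0 < y)]
      exact div_le_self (abs_nonneg _) hy
    refine ⟨φ, hφ, hφ0, fun s hs t ht => le_trans ?_ (h s hs t ht)⟩
    rw [Real.norm_eq_abs, Real.norm_eq_abs, abs_le]
    have e1 := key _ _ (h1 s hs) (h1 t ht)
    have e2 := key _ _ (h1 t ht) (h1 s hs)
    rw [abs_sub_comm] at e1
    constructor <;> linarith
  rw [← hlog.integral_deriv hs ht, ← Real.norm_eq_abs]
  refine intervalIntegral.norm_integral_le_abs_of_norm_le ?_ (hb.sub_Icc hs ht)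
  refine ae_restrict_uIoc ?_ hs ht
  filter_upwards [hfb, hf.ae_differentiableAt hT, ae_restrict_mem measurableSet_Icc]
    with r hr hd hrm
  have hpos : 0 < f r := by linarith [h1 r hrm]
  rw [(hd.hasDerivAt.log hpos.ne').deriv, Real.norm_eq_abs, abs_div, abs_of_pos hpos,
    div_le_iff₀ hpos]
  exact hr

end AC

/-- Chains in a set of full measure along which a continuous function varies little. -/
lemma exists_chain {T : ℝ} {G : Set ℝ} (hG : ∀ᵐ t ∂(volume.restrict (Icc 0 T)), t ∈ G)
    {g : ℝ → ℝ} (hg : ContinuousOn g (Icc 0 T)) {s t : ℝ} (hs0 : 0 ≤ s) (hst : s ≤ t) (htT : t ≤ T)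
    (hsG : s ∈ G) (htG : t ∈ G) {κ : ℝ} (hκ : 0 < κ) :
    ∃ (m : ℕ) (τ : ℕ → ℝ), Monotone τ ∧ τ 0 = s ∧ τ m = t ∧ (∀ k, τ k ∈ G ∧ τ k ∈ Icc s t) ∧
      ∀ k, |g (τ (k + 1)) - g (τ k)| ≤ κ := by
  rcases hst.eq_or_lt with rfl | hlt
  · exact ⟨0, fun _ => s, monotone_const, rfl, rfl, fun _ => ⟨hsG, le_rfl, le_rfl⟩,
      fun _ => by simpa using hκ.le⟩
  have huc := isCompact_Icc.uniformContinuousOn_of_continuous hg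
  obtain ⟨d, hd, hgd⟩ := Metric.uniformContinuousOn_iff.1 huc κ hκ
  have hdense : ∀ a b : ℝ, 0 ≤ a → a < b → b ≤ T → ∃ c ∈ G, a < c ∧ c < b := by
    intro a b ha hab hb
    by_contra! hno
    have h1 : volume (Ioo a b) = 0 := by
      refine measure_mono_null ?_ ((ae_restrict_iff' measurableSet_Icc).1 hG)
      intro c hc hcG
      exact absurd (hno c (hcG ⟨ha.trans hc.1.le, hc.2.le.trans hb⟩) hc.1) (not_le.2 hc.2)
    rw [Real.volume_Ioo, ENNReal.ofReal_eq_zero] at h1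
    linarith
  obtain ⟨N, hN⟩ := exists_nat_gt (2 * (t - s) / d)
  have hN0 : 0 < N := by
    rcases Nat.eq_zero_or_pos N with rfl | h
    · have : 0 ≤ 2 * (t - s) / d := by have := sub_pos.2 hlt; positivity
      simp only [Nat.cast_zero] at hN; linarith
    · exact h
  set h : ℝ := (t - s) / N with hh
  have hNpos : (0 : ℝ) < N := by exact_mod_cast hN0
  have hhpos : 0 < h := div_pos (sub_pos.2 hlt) hNpos
  have hhd : 2 * h < d := by
    rw [div_lt_iff₀ hd] at hN
    rw [hh, ← mul_div_assoc, div_lt_iff₀ hNpos]; linarith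
  have hNh : N * h = t - s := by rw [hh]; field_simp
  have hex : ∀ k : ℕ, ∃ c ∈ G, k + 1 < N → s + k * h < c ∧ c < s + (k + 1) * h := by
    intro k
    by_cases hk : k + 1 < N
    · have hk' : ((k : ℝ) + 1) * h ≤ N * h := by
        gcongr; exact_mod_cast hk.le
      obtain ⟨c, hc, h1, h2⟩ := hdense (s + k * h) (s + (k + 1) * h) (by positivity) (by linarith)
        (by linarith)
      exact ⟨c, hc, fun _ => ⟨h1, h2⟩⟩
    · exact ⟨s, hsG, fun h => absurd h hk⟩
  choose c hcG hc using hex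
  set τ : ℕ → ℝ := fun k => if k = 0 then s else if k < N then c (k - 1) else t with hτ
  have hloc : ∀ k : ℕ, s + min ((k : ℝ) - 1) (N : ℝ) * h ≤ τ k ∧ τ k ≤ s + min (k : ℝ) N * h ∧ s ≤ τ k := by
    intro k
    rcases Nat.eq_zero_or_pos k with rfl | hk
    · simp only [hτ, if_true, Nat.cast_zero]
      rw [min_eq_left (by linarith), min_eq_left hNpos.le]
      refine ⟨by linarith, by linarith, le_rfl⟩
    by_cases hkN : k < N
    · have hk2 : (k : ℝ) < N := by exact_mod_cast hkN
      obtain ⟨j, rfl⟩ : ∃ j, k = j + 1 := ⟨k - 1, by omega⟩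
      have := hc j hkN
      simp only [hτ, Nat.add_eq_zero_iff, one_ne_zero, and_false, if_false, hkN, if_true,
        Nat.add_sub_cancel]
      push_cast at hk2 ⊢
      rw [min_eq_left (by linarith), min_eq_left (by linarith)]
      refine ⟨by linarith [this.1], this.2.le, ?_⟩
      have : 0 ≤ (j : ℝ) * h := by positivity
      linarith [(hc j hkN).1]
    · have hk2 : (N : ℝ) ≤ k := by exact_mod_cast not_lt.1 hkN
      simp only [hτ, hk.ne', if_false, hkN]
      rw [min_eq_right hk2, hNh]
      refine ⟨?_, by linarith, hst⟩
      have : min ((k : ℝ) - 1) N * h ≤ N * h := by gcongr; exact min_le_right _ _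
      linarith
  have hle : ∀ k, τ k ≤ t := by
    intro k
    have : min (k : ℝ) N * h ≤ N * h := by gcongr; exact min_le_right _ _
    linarith [(hloc k).2.1]
  have hmono : Monotone τ := by
    refine monotone_nat_of_le_succ fun k => ?_
    have h1 := (hloc k).2.1
    have h2 := (hloc (k + 1)).1
    push_cast at h2
    rw [add_sub_cancel_right] at h2
    exact h1.trans h2
  refine ⟨N, τ, hmono, by simp [hτ], by simp [hτ, hN0.ne'], fun k => ⟨?_, (hloc k).2.2, hle k⟩,
    fun k => ?_⟩
  · simp only [hτ]
    split_ifs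
    exacts [hsG, hcG _, htG]
  · have h1 := (hloc k).1
    have h2 := (hloc (k + 1)).2.1
    have h3 : min ((k + 1 : ℕ) : ℝ) N * h ≤ (min ((k : ℝ) - 1) N + 2) * h := by
      gcongr
      push_cast
      rw [← min_add_add_right]
      exact min_le_min (by linarith) (by linarith)
    have h4 := hmono (Nat.le_succ k)
    have h5 : dist (τ (k + 1)) (τ k) < d := by
      rw [Real.dist_eq, abs_of_nonneg (sub_nonneg.2 h4)]
      linarith
    have := hgd (τ (k + 1)) ⟨hs0.trans (hloc _).2.2, (hle _).trans htT⟩ (τ k)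
      ⟨hs0.trans (hloc _).2.2, (hle _).trans htT⟩ h5
    rw [Real.dist_eq] at this
    exact this.le

/-! ### Dissipation potentials -/

section Dissipation

variable {Z : Type*} [NormedAddCommGroup Z] [NormedSpace ℝ Z] {R : Z → ℝ}

namespace IsDissipationPotential

lemma nonneg (hR : IsDissipationPotential R) (z : Z) : 0 ≤ R z := by
  obtain ⟨ρ₁, ρ₂, h1, -, h⟩ := hR.bounds
  exact le_trans (by positivity) (h z).1

lemma zero (hR : IsDissipationPotential R) : R 0 = 0 := by
  obtain ⟨ρ₁, ρ₂, h1, -, h⟩ := hR.bounds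
  have := h 0
  simp only [norm_zero, mul_zero] at this
  exact le_antisymm this.2 this.1

lemma smul (hR : IsDissipationPotential R) {a : ℝ} (ha : 0 ≤ a) (z : Z) : R (a • z) = a * R z := by
  rcases ha.eq_or_lt with rfl | ha
  · simp [hR.zero]
  · exact hR.homogeneous a ha z

lemma add_le (hR : IsDissipationPotential R) (x y : Z) : R (x + y) ≤ R x + R y := by
  have h := hR.convex.2 (mem_univ ((2 : ℝ) • x)) (mem_univ ((2 : ℝ) • y))
    (by norm_num : (0 : ℝ) ≤ 1 / 2) (by norm_num : (0 : ℝ) ≤ 1 / 2) (by norm_num)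
  rw [smul_smul, smul_smul, hR.smul zero_le_two, hR.smul zero_le_two] at h
  norm_num at h
  linarith

lemma exists_lower (hR : IsDissipationPotential R) : ∃ ρ > 0, ∀ z, ρ * ‖z‖ ≤ R z := by
  obtain ⟨ρ₁, ρ₂, h1, -, h⟩ := hR.bounds
  exact ⟨ρ₁, h1, fun z => (h z).1⟩

lemma exists_upper (hR : IsDissipationPotential R) : ∃ ρ > 0, ∀ z, R z ≤ ρ * ‖z‖ := by
  obtain ⟨ρ₁, ρ₂, h1, h2, h⟩ := hR.bounds
  exact ⟨ρ₂, h1.trans_le h2, fun z => (h z).2⟩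

lemma continuous (hR : IsDissipationPotential R) : Continuous R := by
  obtain ⟨ρ, hρ, h⟩ := hR.exists_upper
  refine LipschitzWith.continuous (K := ρ.toNNReal) (LipschitzWith.of_le_add_mul _ fun x y => ?_)
  have h1 := hR.add_le y (x - y)
  rw [add_sub_cancel] at h1
  rw [Real.coe_toNNReal _ hρ.le, dist_eq_norm]
  linarith [h (x - y)]

lemma le_of_mem_dissSubdiff (hR : IsDissipationPotential R) {z : Z} {η : StrongDual ℝ Z}
    (hη : η ∈ dissSubdiff R z) (y : Z) : η y ≤ R y := by
  have key : ∀ δ > 0, η y ≤ R y + δ * ‖y‖ := by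
    intro δ hδ
    have h1 := hη.2 δ hδ
    have h2 : Tendsto (fun a : ℝ => z + a • y) (𝓝[>] 0) (𝓝 z) := by
      have : Tendsto (fun a : ℝ => z + a • y) (𝓝 0) (𝓝 (z + (0 : ℝ) • y)) :=
        Continuous.tendsto (by fun_prop) 0
      rw [zero_smul, add_zero] at this
      exact this.mono_left nhdsWithin_le_nhds
    obtain ⟨a, ha, ha0⟩ := ((h2.eventually h1).and self_mem_nhdsWithin).exists
    have ha0 : 0 < a := ha0
    rw [add_sub_cancel_left, map_smul, norm_smul, Real.norm_of_nonneg ha0.le, smul_eq_mul] at ha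
    have ha' : (R z : EReal) + ((a * η y - δ * (a * ‖y‖) : ℝ) : EReal) ≤ (R (z + a • y) : EReal) := ha
    have h3 : R z + (a * η y - δ * (a * ‖y‖)) ≤ R (z + a • y) := by exact_mod_cast ha'
    have h4 := hR.add_le z (a • y)
    rw [hR.smul ha0.le] at h4
    have h5 : a * η y ≤ a * (R y + δ * ‖y‖) := by linarith
    exact le_of_mul_le_mul_left h5 ha0
  refine le_of_forall_pos_le_add fun κ hκ => (key (κ / (‖y‖ + 1)) (by positivity)).trans ?_
  have : κ / (‖y‖ + 1) * ‖y‖ ≤ κ := by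
    rw [div_mul_eq_mul_div, div_le_iff₀ (by positivity)]
    nlinarith [norm_nonneg y]
  linarith

lemma mem_dissSubdiff {z : Z} {η : StrongDual ℝ Z} (h : ∀ y, η y ≤ R y) (hz : R z ≤ η z) :
    η ∈ dissSubdiff R z := by
  refine ⟨EReal.coe_ne_top _, fun δ hδ => Eventually.of_forall fun y => ?_⟩
  have h1 : R z + (η (y - z) - δ * ‖y - z‖) ≤ R y := by
    rw [map_sub]
    have : 0 ≤ δ * ‖y - z‖ := by positivity
    linarith [h y]
  show (R z : EReal) + ((η (y - z) - δ * ‖y - z‖ : ℝ) : EReal) ≤ (R y : EReal)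
  exact_mod_cast h1

lemma map_integral_le [CompleteSpace Z] (hR : IsDissipationPotential R) {f : ℝ → Z} {s t : ℝ} (hst : s ≤ t)
    (hf : IntervalIntegrable f volume s t) (hRf : IntervalIntegrable (fun r => R (f r)) volume s t) :
    R (∫ r in s..t, f r) ≤ ∫ r in s..t, R (f r) := by
  rcases hst.eq_or_lt with rfl | hlt
  · simp [hR.zero]
  have hpos : 0 < t - s := sub_pos.2 hlt
  have h := hR.convex.map_set_average_le (t := Ioc s t) (μ := volume) (f := f)
    hR.continuous.continuousOn isClosed_univ
    (by rw [Real.volume_Ioc]; simpa using hlt) (by simp) (by simp)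
    ((intervalIntegrable_iff_integrableOn_Ioc_of_le hst).1 hf)
    ((intervalIntegrable_iff_integrableOn_Ioc_of_le hst).1 hRf)
  rw [setAverage_eq, setAverage_eq, measureReal_def, Real.volume_Ioc, ENNReal.toReal_ofReal hpos.le,
    ← intervalIntegral.integral_of_le hst, ← intervalIntegral.integral_of_le hst,
    hR.smul (by positivity), smul_eq_mul] at h
  exact le_of_mul_le_mul_left h (by positivity)

end IsDissipationPotential

end Dissipation

/-! ### Energies -/

section Energy

variable {U V W Z X : Type*}
  [NormedAddCommGroup U] [NormedSpace ℝ U] [NormedAddCommGroup V] [InnerProductSpace ℝ V]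
  [NormedAddCommGroup W] [InnerProductSpace ℝ W] [NormedAddCommGroup Z] [NormedSpace ℝ Z]
  [NormedAddCommGroup X] [NormedSpace ℝ X]

/-- The standing assumptions on the rate-independent system. -/
structure IsRateIndependentSystem (e : Embeddings U V W Z) (R : Z → ℝ) (T : ℝ)
    (E : ℝ → U → ℝ≥0∞) (D : Set U) (i : U →L[ℝ] X) : Prop where
  pos : 0 < T
  reflexive : IsReflexive U
  diss : IsDissipationPotential R
  domain : HasDomain T E D
  lsc : WeaklyLSC T E
  control : PowerControl T E D
  coercive : Coercive E
  continuity : PowerContinuity e T E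
  injective : Function.Injective i
  convex : UniformlyConvexEnergy T E i

lemma Embeddings.injective_UW (e : Embeddings U V W Z) : Function.Injective e.UW :=
  e.injective_VW.comp e.injective_UV

lemma Embeddings.injective_UZ (e : Embeddings U V W Z) : Function.Injective e.UZ :=
  e.injective_WZ.comp e.injective_UW

lemma IsModulus.nonneg {ω : ℝ → ℝ} (hω : IsModulus ω) {x : ℝ} (hx : 0 ≤ x) : 0 ≤ ω x := by
  have := hω.1 (mem_Ici.2 le_rfl) (mem_Ici.2 hx) hx
  rwa [hω.2.1] at this

namespace IsRateIndependentSystem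

variable {e : Embeddings U V W Z} {R : Z → ℝ} {T : ℝ} {E : ℝ → U → ℝ≥0∞} {D : Set U} {i : U →L[ℝ] X}

lemma zero_mem (H : IsRateIndependentSystem e R T E D i) : (0 : ℝ) ∈ Icc (0 : ℝ) T :=
  ⟨le_rfl, H.pos.le⟩

lemma ne_top (H : IsRateIndependentSystem e R T E D i) {t : ℝ} (ht : t ∈ Icc (0 : ℝ) T) {x : U}
    (hx : x ∈ D) : E t x ≠ ⊤ := (H.domain.2 t ht x).2 hx

lemma mem_of_le (H : IsRateIndependentSystem e R T E D i) {t : ℝ} (ht : t ∈ Icc (0 : ℝ) T) {x : U}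
    {K : ℝ} (hx : E t x ≤ ENNReal.ofReal K) : x ∈ D :=
  (H.domain.2 t ht x).1 (hx.trans_lt ENNReal.ofReal_lt_top).ne

lemma toReal_le (H : IsRateIndependentSystem e R T E D i) {t : ℝ} (ht : t ∈ Icc (0 : ℝ) T) {x : U}
    (hx : x ∈ D) {c : ℝ} : (hc : 0 ≤ c) → (E t x ≤ ENNReal.ofReal c ↔ (E t x).toReal ≤ c) :=
  fun hc => (ENNReal.le_ofReal_iff_toReal_le (H.ne_top ht hx) hc)

lemma intervalIntegrable_power (H : IsRateIndependentSystem e R T E D i) {x : U} (hx : x ∈ D)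
    {s t : ℝ} (hs : s ∈ Icc (0 : ℝ) T) (ht : t ∈ Icc (0 : ℝ) T) :
    IntervalIntegrable (fun r => power E r x) volume s t :=
  (H.control.1 x hx).intervalIntegrable_deriv hs ht

lemma integral_power (H : IsRateIndependentSystem e R T E D i) {x : U} (hx : x ∈ D)
    {s t : ℝ} (hs : s ∈ Icc (0 : ℝ) T) (ht : t ∈ Icc (0 : ℝ) T) :
    ∫ r in s..t, power E r x = (E t x).toReal - (E s x).toReal :=
  (H.control.1 x hx).integral_deriv hs ht

lemma exists_control (H : IsRateIndependentSystem e R T E D i) :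
    ∃ b : ℝ → ℝ, IntervalIntegrable b volume 0 T ∧ (∀ t, 0 ≤ b t) ∧
      (∀ᵐ t ∂(volume.restrict (Icc 0 T)), ∀ x ∈ D, |power E t x| ≤ b t * ((E t x).toReal + 1)) ∧
      ∀ x ∈ D, ∀ s ∈ Icc (0 : ℝ) T, ∀ t ∈ Icc (0 : ℝ) T,
        (E t x).toReal + 1 ≤ Real.exp |∫ r in s..t, b r| * ((E s x).toReal + 1) := by
  obtain ⟨b, hb, h⟩ := H.control.2
  have h1 : ∀ᵐ t ∂(volume.restrict (Icc 0 T)), ∀ x ∈ D,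
      |power E t x| ≤ |b t| * ((E t x).toReal + 1) := by
    filter_upwards [h] with t ht x hx
    refine ((ht.2 x hx).2).trans ?_
    gcongr
    exact le_abs_self _
  refine ⟨fun t => |b t|, hb.abs, fun t => abs_nonneg _, h1, fun x hx s hs t ht => ?_⟩
  have hAC : MemAC T fun t => (E t x).toReal + 1 := by
    obtain ⟨φ, hφ, hφ0, hf⟩ := H.control.1 x hx
    exact ⟨φ, hφ, hφ0, fun s hs t ht => by rw [add_sub_add_right_eq_sub]; exact hf s hs t ht⟩
  have h2 := abs_log_sub_log_le H.pos.le hAC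
    (fun t _ => by have : 0 ≤ (E t x).toReal := ENNReal.toReal_nonneg
                   linarith) hb.abs (by
      filter_upwards [h1] with t ht
      have := ht x hx
      rwa [deriv_add_const]) hs ht
  have p1 : 0 < (E s x).toReal + 1 := by positivity
  have p2 : 0 < (E t x).toReal + 1 := by positivity
  have h3 := (le_abs_self _).trans h2
  rw [← Real.log_div p2.ne' p1.ne', Real.log_le_iff_le_exp (by positivity), div_le_iff₀ p1] at h3
  exact h3

lemma convex_real (H : IsRateIndependentSystem e R T E D i) : ∃ μ > 0, ∀ t ∈ Icc (0 : ℝ) T,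
    ∀ θ ∈ Ioo (0 : ℝ) 1, ∀ x ∈ D, ∀ y ∈ D, θ • x + (1 - θ) • y ∈ D ∧
      (E t (θ • x + (1 - θ) • y)).toReal + μ / 2 * θ * (1 - θ) * ‖i (x - y)‖ ^ 2
        ≤ θ * (E t x).toReal + (1 - θ) * (E t y).toReal := by
  obtain ⟨μ, hμ, h⟩ := H.convex
  refine ⟨μ, hμ, fun t ht θ hθ x hx y hy => ?_⟩
  have h1 := h t ht θ hθ x y
  have hθ' : 0 < 1 - θ := by linarith [hθ.2]
  have hfin : ENNReal.ofReal θ * E t x + ENNReal.ofReal (1 - θ) * E t y ≠ ⊤ :=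
    ENNReal.add_ne_top.2 ⟨ENNReal.mul_ne_top ENNReal.ofReal_ne_top (H.ne_top ht hx),
      ENNReal.mul_ne_top ENNReal.ofReal_ne_top (H.ne_top ht hy)⟩
  have hm : θ • x + (1 - θ) • y ∈ D :=
    (H.domain.2 t ht _).1 ((le_self_add.trans h1).trans_lt hfin.lt_top).ne
  refine ⟨hm, ?_⟩
  have h2 := ENNReal.toReal_mono hfin h1
  have hpos : 0 ≤ μ / 2 * θ * (1 - θ) * ‖i (x - y)‖ ^ 2 := by have := hθ.1; positivity
  rw [ENNReal.toReal_add (H.ne_top ht hm) ENNReal.ofReal_ne_top, ENNReal.toReal_ofReal hpos,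
    ENNReal.toReal_add (ENNReal.mul_ne_top ENNReal.ofReal_ne_top (H.ne_top ht hx))
      (ENNReal.mul_ne_top ENNReal.ofReal_ne_top (H.ne_top ht hy)),
    ENNReal.toReal_mul, ENNReal.toReal_mul, ENNReal.toReal_ofReal hθ.1.le,
    ENNReal.toReal_ofReal hθ'.le] at h2
  exact h2

lemma stable_iff (H : IsRateIndependentSystem e R T E D i) {t : ℝ} (ht : t ∈ Icc (0 : ℝ) T) {u : U}
    (hu : u ∈ D) : GloballyStable e R E t u ↔
      ∀ x ∈ D, (E t u).toReal ≤ (E t x).toReal + R (e.UZ (x - u)) := by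
  constructor
  · intro h x hx
    have h1 := ENNReal.toReal_mono (ENNReal.add_ne_top.2 ⟨H.ne_top ht hx, ENNReal.ofReal_ne_top⟩)
      (h x)
    rwa [ENNReal.toReal_add (H.ne_top ht hx) ENNReal.ofReal_ne_top,
      ENNReal.toReal_ofReal (H.diss.nonneg _)] at h1
  · intro h x
    by_cases hx : x ∈ D
    · rw [← ENNReal.ofReal_toReal (H.ne_top ht hu), ← ENNReal.ofReal_toReal (H.ne_top ht hx),
        ← ENNReal.ofReal_add ENNReal.toReal_nonneg (H.diss.nonneg _)]
      exact ENNReal.ofReal_le_ofReal (h x hx)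
    · have : E t x = ⊤ := by
        by_contra hne
        exact hx ((H.domain.2 t ht x).1 hne)
      rw [this, top_add]
      exact le_top

lemma GloballyStable.mem (H : IsRateIndependentSystem e R T E D i) {t : ℝ} (ht : t ∈ Icc (0 : ℝ) T)
    {u : U} (hu : GloballyStable e R E t u) : u ∈ D := by
  obtain ⟨x, hx⟩ := H.domain.1
  refine (H.domain.2 t ht u).1 (ne_top_of_le_ne_top ?_ (hu x))
  exact ENNReal.add_ne_top.2 ⟨H.ne_top ht hx, ENNReal.ofReal_ne_top⟩

/-- Stability improves by the modulus of uniform convexity. -/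
lemma exists_stable_quadratic (H : IsRateIndependentSystem e R T E D i) : ∃ μ > 0,
    ∀ t ∈ Icc (0 : ℝ) T, ∀ u ∈ D, GloballyStable e R E t u → ∀ x ∈ D,
      (E t u).toReal + μ / 2 * ‖i (x - u)‖ ^ 2 ≤ (E t x).toReal + R (e.UZ (x - u)) := by
  obtain ⟨μ, hμ, h⟩ := H.convex_real
  refine ⟨μ, hμ, fun t ht u hu hst x hx => ?_⟩
  rw [H.stable_iff ht hu] at hst
  have key : ∀ θ ∈ Ioo (0 : ℝ) 1, (E t u).toReal + μ / 2 * (1 - θ) * ‖i (x - u)‖ ^ 2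
      ≤ (E t x).toReal + R (e.UZ (x - u)) := by
    intro θ hθ
    obtain ⟨h1, h2⟩ := h t ht θ hθ x hx u hu
    have h3 := hst _ h1
    have h4 : θ • x + (1 - θ) • u - u = θ • (x - u) := by module
    rw [h4, map_smul, H.diss.smul hθ.1.le] at h3
    have h5 : θ * ((E t u).toReal + μ / 2 * (1 - θ) * ‖i (x - u)‖ ^ 2)
      ≤ θ * ((E t x).toReal + R (e.UZ (x - u))) := by linarith
    exact le_of_mul_le_mul_left h5 hθ.1
  have hlim : Tendsto (fun θ : ℝ => (E t u).toReal + μ / 2 * (1 - θ) * ‖i (x - u)‖ ^ 2) (𝓝[>] 0)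
      (𝓝 ((E t u).toReal + μ / 2 * (1 - 0) * ‖i (x - u)‖ ^ 2)) :=
    (Continuous.tendsto (by fun_prop) 0).mono_left nhdsWithin_le_nhds
  rw [sub_zero, mul_one] at hlim
  refine le_of_tendsto hlim ?_
  filter_upwards [Ioo_mem_nhdsGT (zero_lt_one' ℝ)] with θ hθ using key θ hθ

lemma le_of_weak (H : IsRateIndependentSystem e R T E D i) {t : ℝ} (ht : t ∈ Icc (0 : ℝ) T)
    {α : Type*} {l : Filter α} {x : α → U} {x₀ : U}
    (hw : ∀ L : StrongDual ℝ U, Tendsto (fun a => L (x a)) l (𝓝 (L x₀))) {c : ℝ≥0∞}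
    (hc : ∃ᶠ a in l, E t (x a) ≤ c) : E t x₀ ≤ c := by
  by_contra! hlt
  have h1 : Tendsto (fun a => toWeakSpace ℝ U (x a)) l (𝓝 (toWeakSpace ℝ U x₀)) := by
    refine (WeakBilin.tendsto_iff_forall_eval_tendsto (topDualPairing ℝ U).flip ?_).2 fun L => hw L
    intro a b hab
    exact (SeparatingDual.eq_iff_forall_dual_eq (R := ℝ)).2 fun L => congrArg (fun f => f L) hab
  have h2 := h1.eventually (H.lsc t ht (toWeakSpace ℝ U x₀) c hlt)
  obtain ⟨a, h3, h4⟩ := (hc.and_eventually h2).exists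
  exact absurd h3 (not_le.2 h4)

lemma toReal_le_of_weak (H : IsRateIndependentSystem e R T E D i) {t : ℝ} (ht : t ∈ Icc (0 : ℝ) T)
    {α : Type*} {l : Filter α} [l.NeBot] {x : α → U} {x₀ : U} (hx : ∀ᶠ a in l, x a ∈ D)
    (hw : ∀ L : StrongDual ℝ U, Tendsto (fun a => L (x a)) l (𝓝 (L x₀))) {c : α → ℝ} {c₀ : ℝ}
    (hc : ∀ᶠ a in l, (E t (x a)).toReal ≤ c a) (hc0 : Tendsto c l (𝓝 c₀)) :
    x₀ ∈ D ∧ (E t x₀).toReal ≤ c₀ := by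
  have key : ∀ δ > 0, E t x₀ ≤ ENNReal.ofReal (c₀ + δ) := by
    intro δ hδ
    refine H.le_of_weak ht hw (Eventually.frequently ?_)
    filter_upwards [hc, hc0.eventually (gt_mem_nhds (show c₀ < c₀ + δ by linarith)), hx]
      with a h1 h2 h3
    rw [← ENNReal.ofReal_toReal (H.ne_top ht h3)]
    exact ENNReal.ofReal_le_ofReal (h1.trans h2.le)
  have hD := H.mem_of_le ht (key 1 one_pos)
  have hnn : 0 ≤ c₀ := by
    refine ge_of_tendsto hc0 ?_
    filter_upwards [hc] with a ha using ENNReal.toReal_nonneg.trans ha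
  exact ⟨hD, le_of_forall_pos_le_add fun δ hδ => (H.toReal_le ht hD (by linarith)).1 (key δ hδ)⟩

lemma exists_norm_le (H : IsRateIndependentSystem e R T E D i) (K : ℝ) :
    ∃ C > 0, ∀ x, E 0 x ≤ ENNReal.ofReal K → ‖x‖ ≤ C := by
  obtain ⟨C, hC0, hC⟩ := (H.coercive K).exists_pos_norm_le
  exact ⟨C, hC0, fun x hx => hC x hx⟩

/-- The power is continuous on sublevels, with an Ehrling-type control of its modulus. -/
lemma exists_modulus (H : IsRateIndependentSystem e R T E D i) {K : ℝ} (hK : 0 < K) :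
    ∃ γ ω : ℝ → ℝ, IntervalIntegrable γ volume 0 T ∧ (∀ t, 0 ≤ γ t) ∧
      (∀ x, 0 ≤ x → 0 ≤ ω x) ∧
      (∀ᵐ t ∂(volume.restrict (Icc 0 T)), ∀ x y : U,
        E 0 x ≤ ENNReal.ofReal K → E 0 y ≤ ENNReal.ofReal K →
          |power E t x - power E t y| ≤ γ t * ω ‖e.UW (x - y)‖) ∧
      ∀ δ > 0, ∃ C ≥ 0, ∀ x y : U, E 0 x ≤ ENNReal.ofReal K → E 0 y ≤ ENNReal.ofReal K →
        ω ‖e.UW (x - y)‖ ≤ δ + C * ‖e.UZ (x - y)‖ := by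
  obtain ⟨γ, ω, hγ, hω, h⟩ := H.continuity K hK
  refine ⟨fun t => |γ t|, ω, hγ.abs, fun t => abs_nonneg _, fun x hx => hω.nonneg hx, ?_, ?_⟩
  · filter_upwards [h] with t ht x y hx hy
    refine (ht x y hx hy).trans ?_
    gcongr
    · exact hω.nonneg (norm_nonneg _)
    · exact le_abs_self _
  intro δ hδ
  obtain ⟨r, hr0, hr⟩ := H.exists_norm_le K
  obtain ⟨κ, hκ, hωκ⟩ := Metric.continuousWithinAt_iff.1 hω.2.2 δ hδ
  have hcomp := (e.compact_UW).isCompact_closure_image_closedBall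
    (f := ((e.VW ∘L e.UV : U →L[ℝ] W) : U →ₗ[ℝ] W)) (2 * r)
  set S := closure ((e.VW ∘L e.UV : U →L[ℝ] W) '' Metric.closedBall 0 (2 * r)) with hS
  have hcomp2 : IsCompact (S ∩ {w | κ ≤ ‖w‖}) :=
    hcomp.inter_right (isClosed_le continuous_const continuous_norm)
  obtain ⟨c, hc0, hc⟩ : ∃ c > 0, ∀ w ∈ S ∩ {w | κ ≤ ‖w‖}, c ≤ ‖e.WZ w‖ := by
    rcases (S ∩ {w | κ ≤ ‖w‖}).eq_empty_or_nonempty with hem | hne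
    · exact ⟨1, one_pos, fun w hw => absurd hw (hem ▸ notMem_empty w)⟩
    obtain ⟨w₀, hw₀, hmin⟩ := hcomp2.exists_isMinOn hne (f := fun w => ‖e.WZ w‖)
      (by fun_prop)
    refine ⟨‖e.WZ w₀‖, norm_pos_iff.2 fun h0 => ?_, fun w hw => hmin hw⟩
    have : w₀ = 0 := e.injective_WZ (by rw [h0, map_zero])
    have h1 : κ ≤ ‖w₀‖ := hw₀.2
    rw [this, norm_zero] at h1
    linarith
  set Ω := ω (‖e.UW‖ * (2 * r)) with hΩ
  have hΩ0 : 0 ≤ Ω := hω.nonneg (by positivity)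
  refine ⟨Ω / c, by positivity, fun x y hx hy => ?_⟩
  have hxy : ‖x - y‖ ≤ 2 * r := (norm_sub_le _ _).trans (by linarith [hr x hx, hr y hy])
  by_cases hlt : ‖e.UW (x - y)‖ < κ
  · have h1 := hωκ (x := ‖e.UW (x - y)‖) (mem_Ici.2 (norm_nonneg _)) (by simpa using hlt)
    rw [hω.2.1, Real.dist_eq, sub_zero] at h1
    have : 0 ≤ Ω / c * ‖e.UZ (x - y)‖ := by positivity
    linarith [le_abs_self (ω ‖e.UW (x - y)‖)]
  · push Not at hlt
    have h1 : c ≤ ‖e.UZ (x - y)‖ :=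
      hc _ ⟨subset_closure ⟨x - y, by simpa using hxy, rfl⟩, hlt⟩
    have h2 : ω ‖e.UW (x - y)‖ ≤ Ω :=
      hω.1 (mem_Ici.2 (norm_nonneg _)) (mem_Ici.2 (by positivity))
        ((e.UW.le_opNorm _).trans (by gcongr))
    have h3 : Ω ≤ Ω / c * ‖e.UZ (x - y)‖ := by
      rw [div_mul_eq_mul_div, le_div_iff₀ hc0]
      gcongr
    linarith

lemma ae_power_tendsto (H : IsRateIndependentSystem e R T E D i) {K : ℝ} (hK : 0 < K) :
    ∀ᵐ t ∂(volume.restrict (Icc 0 T)), ∀ (x : ℕ → U) (x₀ : U),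
      (∀ n, E 0 (x n) ≤ ENNReal.ofReal K) → E 0 x₀ ≤ ENNReal.ofReal K →
      Tendsto (fun n => e.UZ (x n)) atTop (𝓝 (e.UZ x₀)) →
      Tendsto (fun n => power E t (x n)) atTop (𝓝 (power E t x₀)) := by
  obtain ⟨γ, ω, hγ, hγ0, hω0, h, hδ⟩ := H.exists_modulus hK
  filter_upwards [h] with t ht x x₀ hx hx0 hlim
  rw [Metric.tendsto_atTop]
  intro κ hκ
  obtain ⟨C, hC0, hC⟩ := hδ (κ / (2 * (γ t + 1))) (by have := hγ0 t; positivity)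
  have h1 : Tendsto (fun n => C * ‖e.UZ (x n - x₀)‖) atTop (𝓝 (C * 0)) := by
    refine Tendsto.const_mul _ ?_
    simp only [map_sub]
    exact tendsto_iff_norm_sub_tendsto_zero.1 hlim
  rw [mul_zero] at h1
  obtain ⟨N, hN⟩ := eventually_atTop.1 (h1.eventually (gt_mem_nhds
    (show 0 < κ / (2 * (γ t + 1)) by have := hγ0 t; positivity)))
  refine ⟨N, fun n hn => ?_⟩
  rw [Real.dist_eq]
  refine (ht _ _ (hx n) hx0).trans_lt ?_
  have h2 := hC _ _ (hx n) hx0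
  have h3 := hN n hn
  have h4 : ω ‖e.UW (x n - x₀)‖ ≤ κ / (γ t + 1) := by
    have : κ / (γ t + 1) = κ / (2 * (γ t + 1)) + κ / (2 * (γ t + 1)) := by
      have := hγ0 t; field_simp; ring
    linarith
  calc γ t * ω ‖e.UW (x n - x₀)‖ ≤ γ t * (κ / (γ t + 1)) := by gcongr; exact hγ0 t
    _ < (γ t + 1) * (κ / (γ t + 1)) := by
        gcongr
        · have := hγ0 t; positivity
        · linarith
    _ = κ := by have := hγ0 t; field_simp

end IsRateIndependentSystem

end Energy

section LimitCurve

variable {U V W Z X : Type*}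
  [NormedAddCommGroup U] [NormedSpace ℝ U] [NormedAddCommGroup V] [InnerProductSpace ℝ V]
  [NormedAddCommGroup W] [InnerProductSpace ℝ W] [NormedAddCommGroup Z] [NormedSpace ℝ Z]
  [NormedAddCommGroup X] [NormedSpace ℝ X]
  {e : Embeddings U V W Z} {R : Z → ℝ} {T : ℝ} {E : ℝ → U → ℝ≥0∞} {D : Set U} {i : U →L[ℝ] X}

/-- Curves satisfying an upper energy estimate with dissipation `v` and stability almost
everywhere. -/
structure IsLimitCurve (e : Embeddings U V W Z) (R : Z → ℝ) (T : ℝ) (E : ℝ → U → ℝ≥0∞)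
    (K : ℝ) (v : ℝ → ℝ) (u : ℝ → U) : Prop where
  pos : 0 < K
  sublevel : ∀ t ∈ Icc (0 : ℝ) T, E 0 (u t) ≤ ENNReal.ofReal K
  diss_le : ∀ s t, 0 ≤ s → s ≤ t → t ≤ T → R (e.UZ (u t - u s)) ≤ v t - v s
  v_zero : v 0 = 0
  stable_zero : GloballyStable e R E 0 (u 0)
  integrable : IntervalIntegrable (fun r => power E r (u r)) volume 0 T
  energy_le : ∀ t ∈ Icc (0 : ℝ) T, (E t (u t)).toReal + v t
    ≤ (E 0 (u 0)).toReal + ∫ r in (0 : ℝ)..t, power E r (u r)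
  stable : ∀ᵐ t ∂(volume.restrict (Icc 0 T)), GloballyStable e R E t (u t)

omit [NormedSpace ℝ Z] in
lemma sum_diss_le {f : ℝ → Z} {v : ℝ → ℝ} {s t : ℝ}
    (h : ∀ a b, s ≤ a → a ≤ b → b ≤ t → R (f b - f a) ≤ v b - v a) {m : ℕ} {τ : ℕ → ℝ}
    (hτ : Monotone τ) (h0 : τ 0 = s) (hm : τ m = t) :
    ∑ k ∈ Finset.range m, R (f (τ (k + 1)) - f (τ k)) ≤ v t - v s := by
  rw [← h0, ← hm, ← Finset.sum_range_sub (fun k => v (τ k))]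
  refine Finset.sum_le_sum fun k hk => h _ _ ?_ (hτ (Nat.le_succ k)) ?_
  · rw [← h0]; exact hτ (Nat.zero_le k)
  · rw [← hm]; exact hτ (Finset.mem_range.1 hk)

namespace IsRateIndependentSystem

/-- The stable set is weakly closed. -/
lemma stable_of_weak (H : IsRateIndependentSystem e R T E D i) {α : Type*} {l : Filter α} [l.NeBot]
    {t : α → ℝ} {t₀ : ℝ} {x : α → U} {x₀ : U} {K : ℝ} (ht : ∀ a, t a ∈ Icc (0 : ℝ) T)
    (ht₀ : t₀ ∈ Icc (0 : ℝ) T) (hlim : Tendsto t l (𝓝 t₀))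
    (hx : ∀ a, E 0 (x a) ≤ ENNReal.ofReal K)
    (hw : ∀ L : StrongDual ℝ U, Tendsto (fun a => L (x a)) l (𝓝 (L x₀)))
    (hst : ∀ a, GloballyStable e R E (t a) (x a)) : GloballyStable e R E t₀ x₀ := by
  obtain ⟨b, hb, hb0, -, hbE⟩ := H.exists_control
  obtain ⟨C, hC0, hC⟩ := H.exists_norm_le K
  have hxD : ∀ a, x a ∈ D := fun a => H.mem_of_le H.zero_mem (hx a)
  have hW : Tendsto (fun a => e.UW (x a)) l (𝓝 (e.UW x₀)) :=
    IsCompactOperator.tendsto_of_weak (S := e.UW) e.compact_UW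
      (Eventually.of_forall fun a => hC _ (hx a)) hw
  have hZ : Tendsto (fun a => e.UZ (x a)) l (𝓝 (e.UZ x₀)) := (e.WZ.continuous.tendsto _).comp hW
  have hcont : ContinuousOn (fun s => ∫ r in s..t₀, b r) (Icc 0 T) := by
    have := (memAC_of_intervalIntegral hb).continuousOn H.pos.le
    refine ((continuousOn_const (c := ∫ r in (0 : ℝ)..t₀, b r)).sub this).congr fun s hs => ?_
    exact (intervalIntegral_sub_Icc hb hs ht₀).symm
  have hB : Tendsto (fun a => Real.exp |∫ r in t a..t₀, b r|) l (𝓝 1) := by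
    have h1 : Tendsto (fun a => ∫ r in t a..t₀, b r) l (𝓝 (∫ r in t₀..t₀, b r)) :=
      (hcont t₀ ht₀).tendsto.comp (tendsto_nhdsWithin_iff.2 ⟨hlim, Eventually.of_forall ht⟩)
    rw [intervalIntegral.integral_same] at h1
    have h2 := (Real.continuous_exp.tendsto _).comp h1.abs
    simpa [Function.comp_def] using h2
  have key : ∀ y ∈ D, x₀ ∈ D ∧ (E t₀ x₀).toReal ≤ (E t₀ y).toReal + R (e.UZ (y - x₀)) := by
    intro y hy
    have h1 : ∀ a, (E t₀ (x a)).toReal ≤ Real.exp |∫ r in t a..t₀, b r| *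
        ((E (t a) y).toReal + R (e.UZ y - e.UZ (x a)) + 1) - 1 := by
      intro a
      have h2 := hbE _ (hxD a) _ (ht a) _ ht₀
      have h3 := (H.stable_iff (ht a) (hxD a)).1 (hst a) y hy
      rw [map_sub] at h3
      have : Real.exp |∫ r in t a..t₀, b r| * ((E (t a) (x a)).toReal + 1) ≤
          Real.exp |∫ r in t a..t₀, b r| * ((E (t a) y).toReal + R (e.UZ y - e.UZ (x a)) + 1) := by
        gcongr
      linarith
    have h4 : Tendsto (fun a => (E (t a) y).toReal) l (𝓝 (E t₀ y).toReal) :=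
      (((H.control.1 y hy).continuousOn H.pos.le) t₀ ht₀).tendsto.comp
        (tendsto_nhdsWithin_iff.2 ⟨hlim, Eventually.of_forall ht⟩)
    have h5 : Tendsto (fun a => R (e.UZ y - e.UZ (x a))) l (𝓝 (R (e.UZ y - e.UZ x₀))) :=
      (H.diss.continuous.tendsto _).comp (tendsto_const_nhds.sub hZ)
    have h6 := (hB.mul ((h4.add h5).add_const 1)).sub_const 1
    have h7 := H.toReal_le_of_weak ht₀ (Eventually.of_forall hxD) hw (Eventually.of_forall h1) h6
    rw [map_sub]
    refine ⟨h7.1, h7.2.trans (by linarith)⟩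
  obtain ⟨y, hy⟩ := H.domain.1
  exact (H.stable_iff ht₀ (key y hy).1).2 fun z hz => (key z hz).2

end IsRateIndependentSystem

namespace IsLimitCurve

variable {K : ℝ} {v : ℝ → ℝ} {u : ℝ → U}

lemma mem (H : IsRateIndependentSystem e R T E D i) (h : IsLimitCurve e R T E K v u) {t : ℝ}
    (ht : t ∈ Icc (0 : ℝ) T) : u t ∈ D := H.mem_of_le H.zero_mem (h.sublevel t ht)

lemma v_mono (H : IsRateIndependentSystem e R T E D i) (h : IsLimitCurve e R T E K v u) {s t : ℝ}
    (hs : 0 ≤ s) (hst : s ≤ t) (ht : t ≤ T) : v s ≤ v t := by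
  linarith [h.diss_le s t hs hst ht, H.diss.nonneg (e.UZ (u t - u s))]

lemma exists_dist_le (H : IsRateIndependentSystem e R T E D i) (h : IsLimitCurve e R T E K v u) :
    ∃ ρ > 0, ∀ a s t, 0 ≤ a → a ≤ s → s ≤ t → t ≤ T → ‖e.UZ (u s - u t)‖ ≤ (v t - v a) / ρ := by
  obtain ⟨ρ, hρ, hR⟩ := H.diss.exists_lower
  refine ⟨ρ, hρ, fun a s t ha has hst ht => ?_⟩
  rw [le_div_iff₀ hρ, mul_comm, ← neg_sub, map_neg, norm_neg]
  linarith [hR (e.UZ (u t - u s)), h.diss_le s t (ha.trans has) hst ht,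
    h.v_mono H ha has (hst.trans ht)]

lemma integrable_diff (H : IsRateIndependentSystem e R T E D i) (h : IsLimitCurve e R T E K v u)
    {s t c : ℝ} (hs : s ∈ Icc (0 : ℝ) T) (ht : t ∈ Icc (0 : ℝ) T) (hc : c ∈ Icc (0 : ℝ) T) :
    IntervalIntegrable (fun r => power E r (u r) - power E r (u c)) volume s t :=
  (h.integrable.sub_Icc hs ht).sub (H.intervalIntegrable_power (h.mem H hc) hs ht)

/-- Lower energy estimate along suitable partitions. -/
lemma exists_partition (H : IsRateIndependentSystem e R T E D i) (h : IsLimitCurve e R T E K v u)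
    {s t : ℝ} (hs0 : 0 ≤ s) (hst : s ≤ t) (htT : t ≤ T) (hs : GloballyStable e R E s (u s))
    (ht : GloballyStable e R E t (u t)) {κ : ℝ} (hκ : 0 < κ) :
    ∃ (m : ℕ) (τ : ℕ → ℝ), Monotone τ ∧ τ 0 = s ∧ τ m = t ∧
      (E s (u s)).toReal + ∫ r in s..t, power E r (u r) ≤ (E t (u t)).toReal
        + ∑ k ∈ Finset.range m, R (e.UZ (u (τ (k + 1))) - e.UZ (u (τ k))) + κ := by
  obtain ⟨γ, ω, hγ, hγ0, hω0, hpow, hmod⟩ := H.exists_modulus h.pos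
  obtain ⟨ρ, hρ, hdist⟩ := h.exists_dist_le H
  set g : ℝ → ℝ := fun t => ∫ r in (0 : ℝ)..t, γ r with hg
  have hgAC := (memAC_of_intervalIntegral hγ).continuousOn H.pos.le
  have hgsub : ∀ a b, 0 ≤ a → a ≤ b → b ≤ T → g b - g a = ∫ r in a..b, γ r := fun a b ha hab hb =>
    intervalIntegral_sub_Icc hγ ⟨ha, hab.trans hb⟩ ⟨ha.trans hab, hb⟩
  have hgmono : ∀ a b, 0 ≤ a → a ≤ b → b ≤ T → 0 ≤ g b - g a := fun a b ha hab hb => by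
    rw [hgsub a b ha hab hb]
    exact intervalIntegral.integral_nonneg hab fun r _ => hγ0 r
  have hgst := hgmono s t hs0 hst htT
  have hvst := h.v_mono H hs0 hst htT
  obtain ⟨C, hC0, hC⟩ := hmod (κ / 2 / (g t - g s + 1)) (by positivity)
  set δ := κ / 2 / (g t - g s + 1) with hδ
  set κ' := κ / 2 / (C / ρ * (v t - v s) + 1) with hκ'
  have hCv : 0 ≤ C / ρ * (v t - v s) := mul_nonneg (by positivity) (sub_nonneg.2 hvst)
  have hκ'0 : 0 < κ' := by positivity
  have hδ0 : 0 < δ := by positivity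
  obtain ⟨m, τ, hτm, hτ0, hτt, hτ, hτg⟩ := exists_chain (G := {t | GloballyStable e R E t (u t)})
    h.stable hgAC hs0 hst htT hs ht hκ'0
  refine ⟨m, τ, hτm, hτ0, hτt, ?_⟩
  have hτI : ∀ k, τ k ∈ Icc (0 : ℝ) T := fun k =>
    ⟨hs0.trans (hτ k).2.1, (hτ k).2.2.trans htT⟩
  have step : ∀ k, (E (τ k) (u (τ k))).toReal + ∫ r in τ k..τ (k + 1), power E r (u r) ≤
      (E (τ (k + 1)) (u (τ (k + 1)))).toReal + R (e.UZ (u (τ (k + 1))) - e.UZ (u (τ k)))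
        + δ * (g (τ (k + 1)) - g (τ k)) + C / ρ * κ' * (v (τ (k + 1)) - v (τ k)) := by
    intro k
    set a := τ k with ha
    set b := τ (k + 1) with hb
    have hab : a ≤ b := hτm (Nat.le_succ k)
    have haI : a ∈ Icc (0 : ℝ) T := hτI k
    have hbI : b ∈ Icc (0 : ℝ) T := hτI (k + 1)
    have h1 := (H.stable_iff haI (h.mem H haI)).1 (hτ k).1 _ (h.mem H hbI)
    rw [map_sub] at h1
    have h2 := H.integral_power (h.mem H hbI) haI hbI
    have h3 : ∫ r in a..b, (power E r (u r) - power E r (u b)) ≤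
        (δ + C * ((v b - v a) / ρ)) * (g b - g a) := by
      rw [hgsub a b haI.1 hab hbI.2, ← intervalIntegral.integral_const_mul]
      refine intervalIntegral.integral_mono_ae_restrict hab (h.integrable_diff H haI hbI hbI)
        ((hγ.sub_Icc haI hbI).const_mul _) ?_
      have hsub : Icc a b ⊆ Icc 0 T := Icc_subset_Icc haI.1 hbI.2
      filter_upwards [ae_mono (Measure.restrict_mono_set _ hsub) hpow,
        ae_restrict_mem measurableSet_Icc] with r hr hrm
      refine (le_abs_self _).trans ((hr _ _ (h.sublevel r (hsub hrm)) (h.sublevel b hbI)).trans ?_)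
      rw [mul_comm]
      refine mul_le_mul_of_nonneg_right ?_ (hγ0 r)
      refine (hC _ _ (h.sublevel r (hsub hrm)) (h.sublevel b hbI)).trans ?_
      gcongr
      exact hdist a r b haI.1 hrm.1 hrm.2 hbI.2
    rw [intervalIntegral.integral_sub (h.integrable.sub_Icc haI hbI)
      (H.intervalIntegrable_power (h.mem H hbI) haI hbI)] at h3
    have h4 : C * ((v b - v a) / ρ) * (g b - g a) ≤ C / ρ * κ' * (v b - v a) := by
      have h5 := h.v_mono H haI.1 hab hbI.2
      have h6 : g b - g a ≤ κ' := (le_abs_self _).trans (hτg k)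
      calc C * ((v b - v a) / ρ) * (g b - g a) = C / ρ * (v b - v a) * (g b - g a) := by ring
        _ ≤ C / ρ * (v b - v a) * κ' := by
            refine mul_le_mul_of_nonneg_left h6 (mul_nonneg (by positivity) (sub_nonneg.2 h5))
        _ = _ := by ring
    linarith
  have ind : ∀ n, (E s (u s)).toReal + ∫ r in s..τ n, power E r (u r) ≤
      (E (τ n) (u (τ n))).toReal
        + ∑ k ∈ Finset.range n, R (e.UZ (u (τ (k + 1))) - e.UZ (u (τ k)))
        + δ * (g (τ n) - g s) + C / ρ * κ' * (v (τ n) - v s) := by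
    intro n
    induction n with
    | zero => simp [hτ0]
    | succ n ih =>
      have hsI : s ∈ Icc (0 : ℝ) T := ⟨hs0, hst.trans htT⟩
      rw [← intervalIntegral.integral_add_adjacent_intervals
        (h.integrable.sub_Icc hsI (hτI n)) (h.integrable.sub_Icc (hτI n) (hτI (n + 1))),
        Finset.sum_range_succ]
      linarith [step n]
  have hfin := ind m
  rw [hτt] at hfin
  have e1 : δ * (g t - g s) ≤ κ / 2 := by
    rw [hδ, div_mul_eq_mul_div, div_le_iff₀ (by positivity)]
    nlinarith
  have e2 : C / ρ * κ' * (v t - v s) ≤ κ / 2 := by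
    have : C / ρ * κ' * (v t - v s) = κ / 2 * (C / ρ * (v t - v s)) / (C / ρ * (v t - v s) + 1) := by
      rw [hκ']; ring
    rw [this, div_le_iff₀ (by positivity)]
    nlinarith
  linarith

lemma energy_ge (H : IsRateIndependentSystem e R T E D i) (h : IsLimitCurve e R T E K v u)
    {s t : ℝ} (hs0 : 0 ≤ s) (hst : s ≤ t) (htT : t ≤ T) (hs : GloballyStable e R E s (u s))
    (ht : GloballyStable e R E t (u t)) :
    (E s (u s)).toReal + ∫ r in s..t, power E r (u r) ≤ (E t (u t)).toReal + (v t - v s) := by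
  refine le_of_forall_pos_le_add fun κ hκ => ?_
  obtain ⟨m, τ, hτ, h0, hm, hle⟩ := h.exists_partition H hs0 hst htT hs ht hκ
  have := sum_diss_le (R := R) (f := fun r => e.UZ (u r)) (v := v) (s := s) (t := t)
    (fun a b ha hab hb => by
      have := h.diss_le a b (hs0.trans ha) hab (hb.trans htT)
      rwa [map_sub] at this) hτ h0 hm
  linarith

lemma energy_le_of_stable (H : IsRateIndependentSystem e R T E D i) (h : IsLimitCurve e R T E K v u)
    {s t : ℝ} (hs0 : 0 ≤ s) (hst : s ≤ t) (htT : t ≤ T) (hs : GloballyStable e R E s (u s)) :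
    (E t (u t)).toReal + (v t - v s) ≤ (E s (u s)).toReal + ∫ r in s..t, power E r (u r) := by
  have h1 := h.energy_ge H le_rfl hs0 (hst.trans htT) h.stable_zero hs
  have h2 := h.energy_le t ⟨hs0.trans hst, htT⟩
  have h3 := intervalIntegral_sub_Icc h.integrable ⟨hs0, hst.trans htT⟩ ⟨hs0.trans hst, htT⟩
  rw [h.v_zero] at h1
  linarith

lemma exists_quadratic (H : IsRateIndependentSystem e R T E D i) (h : IsLimitCurve e R T E K v u) :
    ∃ μ > 0, ∀ s t, 0 ≤ s → s ≤ t → t ≤ T → GloballyStable e R E s (u s) →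
      μ / 2 * ‖i (u t - u s)‖ ^ 2 ≤ ∫ r in s..t, (power E r (u r) - power E r (u t)) := by
  obtain ⟨μ, hμ, hq⟩ := H.exists_stable_quadratic
  refine ⟨μ, hμ, fun s t hs0 hst htT hs => ?_⟩
  have hsI : s ∈ Icc (0 : ℝ) T := ⟨hs0, hst.trans htT⟩
  have htI : t ∈ Icc (0 : ℝ) T := ⟨hs0.trans hst, htT⟩
  have h1 := hq s hsI _ (h.mem H hsI) hs _ (h.mem H htI)
  have h2 := H.integral_power (h.mem H htI) hsI htI
  have h3 := h.energy_le_of_stable H hs0 hst htT hs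
  rw [intervalIntegral.integral_sub (h.integrable.sub_Icc hsI htI)
    (H.intervalIntegrable_power (h.mem H htI) hsI htI)]
  linarith [h.diss_le s t hs0 hst htT]

lemma exists_holder (H : IsRateIndependentSystem e R T E D i) (h : IsLimitCurve e R T E K v u) :
    ∃ g : ℝ → ℝ, ContinuousOn g (Icc 0 T) ∧ ∀ s t, 0 ≤ s → s ≤ t → t ≤ T →
      GloballyStable e R E s (u s) → ‖i (u t) - i (u s)‖ ^ 2 ≤ g t - g s := by
  obtain ⟨μ, hμ, hq⟩ := h.exists_quadratic H
  obtain ⟨γ, ω, hγ, hγ0, hω0, hpow, hmod⟩ := H.exists_modulus h.pos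
  obtain ⟨ρ, hρ, hdist⟩ := h.exists_dist_le H
  obtain ⟨C, hC0, hC⟩ := hmod 1 one_pos
  set Ω := 1 + C * ((v T - v 0) / ρ) with hΩ
  refine ⟨fun t => 2 / μ * Ω * ∫ r in (0 : ℝ)..t, γ r,
    ((memAC_of_intervalIntegral hγ).continuousOn H.pos.le).const_smul (2 / μ * Ω),
    fun s t hs0 hst htT hs => ?_⟩
  have hsI : s ∈ Icc (0 : ℝ) T := ⟨hs0, hst.trans htT⟩
  have htI : t ∈ Icc (0 : ℝ) T := ⟨hs0.trans hst, htT⟩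
  have h1 := hq s t hs0 hst htT hs
  have h2 : ∫ r in s..t, (power E r (u r) - power E r (u t)) ≤ Ω * ∫ r in s..t, γ r := by
    rw [← intervalIntegral.integral_const_mul]
    refine intervalIntegral.integral_mono_ae_restrict hst (h.integrable_diff H hsI htI htI)
      ((hγ.sub_Icc hsI htI).const_mul _) ?_
    have hsub : Icc s t ⊆ Icc 0 T := Icc_subset_Icc hsI.1 htI.2
    filter_upwards [ae_mono (Measure.restrict_mono_set _ hsub) hpow,
      ae_restrict_mem measurableSet_Icc] with r hr hrm
    refine (le_abs_self _).trans ((hr _ _ (h.sublevel r (hsub hrm)) (h.sublevel t htI)).trans ?_)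
    rw [mul_comm]
    refine mul_le_mul_of_nonneg_right ?_ (hγ0 r)
    refine (hC _ _ (h.sublevel r (hsub hrm)) (h.sublevel t htI)).trans ?_
    rw [hΩ]
    gcongr
    refine (hdist 0 r t le_rfl (hs0.trans hrm.1) hrm.2 htI.2).trans ?_
    gcongr
    exact h.v_mono H htI.1 htI.2 le_rfl
  rw [← mul_sub, intervalIntegral_sub_Icc hγ hsI htI, ← map_sub]
  have h3 : ‖i (u t - u s)‖ ^ 2 = 2 / μ * (μ / 2 * ‖i (u t - u s)‖ ^ 2) := by field_simp
  rw [h3, mul_assoc]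
  exact mul_le_mul_of_nonneg_left (h1.trans h2) (by positivity)

lemma norm_le (H : IsRateIndependentSystem e R T E D i) (h : IsLimitCurve e R T E K v u) :
    ∃ C > 0, ∀ t ∈ Icc (0 : ℝ) T, ‖u t‖ ≤ C := by
  obtain ⟨C, hC0, hC⟩ := H.exists_norm_le K
  exact ⟨C, hC0, fun t ht => hC _ (h.sublevel t ht)⟩

/-- Stability holds at every time. -/
lemma stable_all (H : IsRateIndependentSystem e R T E D i) (h : IsLimitCurve e R T E K v u)
    {t : ℝ} (ht : t ∈ Icc (0 : ℝ) T) : GloballyStable e R E t (u t) := by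
  rcases ht.1.eq_or_lt with rfl | ht0
  · exact h.stable_zero
  obtain ⟨g, hg, hig⟩ := h.exists_holder H
  obtain ⟨C, hC0, hC⟩ := h.norm_le H
  have hex : ∀ n : ℕ, ∃ s ∈ Ioo (max 0 (t - 1 / ((n : ℝ) + 1))) t, GloballyStable e R E s (u s) := by
    intro n
    by_contra! hno
    have hlt : max 0 (t - 1 / ((n : ℝ) + 1)) < t :=
      max_lt ht0 (by have : 0 < 1 / ((n : ℝ) + 1) := by positivity
                     linarith)
    have h1 : volume (Ioo (max 0 (t - 1 / ((n : ℝ) + 1))) t) = 0 := by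
      refine measure_mono_null ?_ ((ae_restrict_iff' measurableSet_Icc).1 h.stable)
      intro c hc hcG
      exact hno c hc (hcG ⟨(le_max_left _ _).trans hc.1.le, hc.2.le.trans ht.2⟩)
    rw [Real.volume_Ioo, ENNReal.ofReal_eq_zero] at h1
    linarith
  choose s hs hst using hex
  have hs0 : ∀ n, 0 ≤ s n := fun n => (le_max_left _ _).trans (hs n).1.le
  have hsI : ∀ n, s n ∈ Icc (0 : ℝ) T := fun n => ⟨hs0 n, (hs n).2.le.trans ht.2⟩
  have hlim : Tendsto s atTop (𝓝 t) := by
    have h1 : Tendsto (fun n : ℕ => t - 1 / ((n : ℝ) + 1)) atTop (𝓝 (t - 0)) :=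
      tendsto_const_nhds.sub tendsto_one_div_add_atTop_nhds_zero_nat
    rw [sub_zero] at h1
    exact tendsto_of_tendsto_of_tendsto_of_le_of_le h1 tendsto_const_nhds
      (fun n => (le_max_right _ _).trans (hs n).1.le) (fun n => (hs n).2.le)
  have hglim : Tendsto (fun n => g t - g (s n)) atTop (𝓝 0) := by
    have h1 : Tendsto (fun n => g (s n)) atTop (𝓝 (g t)) :=
      (hg t ht).tendsto.comp (tendsto_nhdsWithin_iff.2 ⟨hlim, Eventually.of_forall hsI⟩)
    simpa using (tendsto_const_nhds (x := g t)).sub h1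
  have hi : Tendsto (fun n => i (u (s n))) atTop (𝓝 (i (u t))) := by
    rw [tendsto_iff_norm_sub_tendsto_zero]
    have h1 : Tendsto (fun n => √(g t - g (s n))) atTop (𝓝 0) := by
      simpa [Function.comp_def] using (Real.continuous_sqrt.tendsto 0).comp hglim
    refine squeeze_zero (fun n => norm_nonneg _) (fun n => ?_) h1
    rw [norm_sub_rev]
    exact Real.le_sqrt_of_sq_le (hig _ _ (hs0 n) (hs n).2.le ht.2 (hst n))
  exact H.stable_of_weak hsI ht hlim (fun n => h.sublevel _ (hsI n))
    (weak_tendsto_of_tendsto H.reflexive i H.injective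
      (Eventually.of_forall fun n => hC _ (hsI n)) hi) hst

lemma continuousOn_X (H : IsRateIndependentSystem e R T E D i) (h : IsLimitCurve e R T E K v u) :
    ContinuousOn (fun t => i (u t)) (Icc 0 T) := by
  obtain ⟨g, hg, hig⟩ := h.exists_holder H
  have key : ∀ s ∈ Icc (0 : ℝ) T, ∀ t ∈ Icc (0 : ℝ) T, ‖i (u s) - i (u t)‖ ≤ √|g s - g t| := by
    intro s hs t ht
    refine Real.le_sqrt_of_sq_le ?_
    rcases le_total s t with hst | hst
    · rw [norm_sub_rev, abs_sub_comm]
      exact (hig s t hs.1 hst ht.2 (h.stable_all H hs)).trans (le_abs_self _)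
    · exact (hig t s ht.1 hst hs.2 (h.stable_all H ht)).trans (le_abs_self _)
  intro t ht
  rw [ContinuousWithinAt, tendsto_iff_norm_sub_tendsto_zero]
  have h1 : Tendsto (fun s => √|g s - g t|) (𝓝[Icc 0 T] t) (𝓝 0) := by
    have h2 : Tendsto (fun s => g s - g t) (𝓝[Icc 0 T] t) (𝓝 0) := by
      simpa using (hg t ht).tendsto.sub_const (g t)
    simpa [Function.comp_def] using (Real.continuous_sqrt.tendsto _).comp h2.abs
  refine squeeze_zero' (Eventually.of_forall fun s => norm_nonneg _) ?_ h1
  filter_upwards [self_mem_nhdsWithin] with s hs using key s hs t ht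

lemma weakly_continuous (H : IsRateIndependentSystem e R T E D i) (h : IsLimitCurve e R T E K v u)
    (L : StrongDual ℝ U) : ContinuousOn (fun t => L (u t)) (Icc 0 T) := by
  obtain ⟨C, hC0, hC⟩ := h.norm_le H
  intro t ht
  exact weak_tendsto_of_tendsto H.reflexive i H.injective
    (by filter_upwards [self_mem_nhdsWithin] with s hs using hC s hs) (h.continuousOn_X H t ht) L

lemma continuousOn_UZ (H : IsRateIndependentSystem e R T E D i) (h : IsLimitCurve e R T E K v u) :
    ContinuousOn (fun t => e.UZ (u t)) (Icc 0 T) := by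
  obtain ⟨C, hC0, hC⟩ := h.norm_le H
  intro t ht
  exact (e.WZ.continuous.tendsto _).comp (IsCompactOperator.tendsto_of_weak (S := e.UW) e.compact_UW
    (by filter_upwards [self_mem_nhdsWithin] with s hs using hC s hs)
    (fun L => h.weakly_continuous H L t ht))

lemma memCw [TopologicalSpace.SeparableSpace U] (H : IsRateIndependentSystem e R T E D i)
    (h : IsLimitCurve e R T E K v u) : MemCw T u := by
  obtain ⟨C, hC0, hC⟩ := h.norm_le H
  refine ⟨⟨stronglyMeasurable_of_weaklyContinuous fun L => ?_, C, hC⟩, h.weakly_continuous H⟩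
  exact continuousOn_iff_continuous_domRestrict.1 (h.weakly_continuous H L)

lemma energy_eq (H : IsRateIndependentSystem e R T E D i) (h : IsLimitCurve e R T E K v u)
    {s t : ℝ} (hs0 : 0 ≤ s) (hst : s ≤ t) (htT : t ≤ T) :
    (E t (u t)).toReal + (v t - v s) = (E s (u s)).toReal + ∫ r in s..t, power E r (u r) :=
  le_antisymm (h.energy_le_of_stable H hs0 hst htT (h.stable_all H ⟨hs0, hst.trans htT⟩))
    (h.energy_ge H hs0 hst htT (h.stable_all H ⟨hs0, hst.trans htT⟩)
      (h.stable_all H ⟨hs0.trans hst, htT⟩))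

lemma rVariation_eq (H : IsRateIndependentSystem e R T E D i) (h : IsLimitCurve e R T E K v u)
    {s t : ℝ} (hs0 : 0 ≤ s) (hst : s ≤ t) (htT : t ≤ T) :
    rVariation R (fun r => e.UZ (u r)) s t = ENNReal.ofReal (v t - v s) := by
  have hsum : ∀ (m : ℕ) (τ : ℕ → ℝ),
      ∑ k ∈ Finset.range m, ENNReal.ofReal (R (e.UZ (u (τ (k + 1))) - e.UZ (u (τ k))))
        = ENNReal.ofReal (∑ k ∈ Finset.range m, R (e.UZ (u (τ (k + 1))) - e.UZ (u (τ k)))) :=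
    fun m τ => (ENNReal.ofReal_sum_of_nonneg fun k _ => H.diss.nonneg _).symm
  apply le_antisymm
  · refine iSup_le fun p => iSup_le fun hp => ?_
    rw [hsum]
    refine ENNReal.ofReal_le_ofReal (sum_diss_le (R := R) (f := fun r => e.UZ (u r)) (v := v)
      (fun a b ha hab hb => ?_) p.2.2 hp.1 hp.2)
    have := h.diss_le a b (hs0.trans ha) hab (hb.trans htT)
    rwa [map_sub] at this
  · refine ENNReal.le_of_forall_pos_le_add fun κ hκ _ => ?_
    obtain ⟨m, τ, hτ, h0, hm, hle⟩ := h.exists_partition H hs0 hst htT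
      (h.stable_all H ⟨hs0, hst.trans htT⟩) (h.stable_all H ⟨hs0.trans hst, htT⟩)
      (show (0 : ℝ) < κ from hκ)
    have h1 := h.energy_eq H hs0 hst htT
    refine (ENNReal.ofReal_le_ofReal (show v t - v s ≤
      (∑ k ∈ Finset.range m, R (e.UZ (u (τ (k + 1))) - e.UZ (u (τ k)))) + κ by linarith)).trans ?_
    rw [ENNReal.ofReal_add (Finset.sum_nonneg (fun k _ => H.diss.nonneg _)) κ.coe_nonneg,
      ENNReal.ofReal_coe_nnreal, ← hsum]
    gcongr
    exact le_iSup₂_of_le (f := fun (p : ℕ × {τ : ℕ → ℝ // Monotone τ})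
      (_ : p.2.1 0 = s ∧ p.2.1 p.1 = t) => ∑ k ∈ Finset.range p.1,
        ENNReal.ofReal (R (e.UZ (u (p.2.1 (k + 1))) - e.UZ (u (p.2.1 k))))) (m, ⟨τ, hτ⟩) ⟨h0, hm⟩ le_rfl

lemma energetic (H : IsRateIndependentSystem e R T E D i) (h : IsLimitCurve e R T E K v u) :
    IsEnergeticSolution e R T E (u 0) u := by
  refine ⟨rfl, h.integrable, fun t ht => ⟨h.stable_all H ht, ?_, ?_⟩⟩
  · rw [h.rVariation_eq H le_rfl ht.1 ht.2]
    exact ENNReal.ofReal_ne_top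
  · rw [h.rVariation_eq H le_rfl ht.1 ht.2, ENNReal.toReal_ofReal
      (sub_nonneg.2 (h.v_mono H le_rfl ht.1 ht.2))]
    exact h.energy_eq H le_rfl ht.1 ht.2

lemma essEnergetic (H : IsRateIndependentSystem e R T E D i) (h : IsLimitCurve e R T E K v u) :
    IsEssentialEnergeticSolution e R T E D (u 0) u := by
  have hess : ∀ s t, essVariation R (fun r => e.UZ (u r)) (fun r => e.UZ (u r))
      (fun r => e.UZ (u r)) s t = rVariation R (fun r => e.UZ (u r)) s t := by
    intro s t
    have hemp : IsEmpty {r : ℝ // r ∈ Icc s t ∧ e.UZ (u r) ≠ e.UZ (u r)} :=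
      ⟨fun r => r.2.2 rfl⟩
    simp [essVariation, jumpPart]
  refine ⟨rfl, fun t ht => h.stable_all H ht.1, h.integrable, u, u, ⟨fun t ht => ?_, rfl,
    fun t ht => ?_, rfl⟩, fun t ht => ⟨h.mem H ht, h.mem H ht⟩, fun s t hs0 hst htT => ?_⟩
  · exact (h.continuousOn_UZ H t ⟨ht.1, ht.2.le⟩).mono_of_mem_nhdsWithin
      (mem_of_superset (Ioo_mem_nhdsGT ht.2) fun r hr => ⟨ht.1.trans hr.1.le, hr.2.le⟩)
  · exact (h.continuousOn_UZ H t ⟨ht.1.le, ht.2⟩).mono_of_mem_nhdsWithin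
      (mem_of_superset (Ioo_mem_nhdsLT ht.1) fun r hr => ⟨hr.1.le, hr.2.le.trans ht.2⟩)
  · rw [hess, h.rVariation_eq H hs0 hst htT, ENNReal.toReal_ofReal
      (sub_nonneg.2 (h.v_mono H hs0 hst htT))]
    exact ⟨ENNReal.ofReal_ne_top, h.energy_eq H hs0 hst htT⟩

lemma boundedVariationOn (H : IsRateIndependentSystem e R T E D i)
    (h : IsLimitCurve e R T E K v u) : BoundedVariationOn (fun t => e.UZ (u t)) (Icc 0 T) := by
  obtain ⟨ρ, hρ, hdist⟩ := h.exists_dist_le H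
  have hmono : MonotoneOn (fun t => v t / ρ) (Icc 0 T) := fun s hs t ht hst => by
    have := h.v_mono H hs.1 hst ht.2
    simp only
    gcongr
  refine ne_top_of_le_ne_top (ENNReal.ofReal_ne_top (r := v T / ρ - v 0 / ρ)) ?_
  have hle := hmono.eVariationOn_eq (left_mem_Icc.2 H.pos.le) (right_mem_Icc.2 H.pos.le)
  rw [inter_self] at hle
  refine le_trans ?_ hle.le
  refine iSup_le fun p => ?_
  refine le_trans (Finset.sum_le_sum fun k _ => ?_) (eVariationOn.sum_le (f := fun t => v t / ρ)
    (s := Icc 0 T) p.2.2.1 p.2.2.2)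
  have hk := p.2.2.1 (Nat.le_succ k)
  rw [edist_dist, edist_dist]
  refine ENNReal.ofReal_le_ofReal ?_
  rw [dist_eq_norm, Real.dist_eq, ← map_sub, ← sub_div, ← neg_sub, map_neg, norm_neg]
  exact (hdist _ _ _ (p.2.2.2 k).1 le_rfl hk (p.2.2.2 (k + 1)).2).trans (le_abs_self _)

/-- Absolute continuity in `X`. -/
lemma memAC_X (H : IsRateIndependentSystem e R T E D i) (h : IsLimitCurve e R T E K v u)
    (hL : LipschitzPower T E i) : MemAC T fun t => i (u t) := by
  obtain ⟨μ, hμ, hq⟩ := h.exists_quadratic H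
  obtain ⟨γ, hγ, hpow⟩ := hL K h.pos
  have key : ∀ s t, 0 ≤ s → s ≤ t → t ≤ T →
      ‖i (u t) - i (u s)‖ ≤ ∫ r in s..t, 2 / μ * |γ r| := by
    intro s t hs0 hst htT
    have hsI : s ∈ Icc (0 : ℝ) T := ⟨hs0, hst.trans htT⟩
    have htI : t ∈ Icc (0 : ℝ) T := ⟨hs0.trans hst, htT⟩
    have hcont : ContinuousOn (fun r => ‖i (u t) - i (u r)‖) (Icc s t) :=
      (continuousOn_const.sub ((h.continuousOn_X H).mono (Icc_subset_Icc hs0 htT))).norm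
    obtain ⟨c, hc, hmax⟩ := isCompact_Icc.exists_isMaxOn ⟨s, left_mem_Icc.2 hst⟩ hcont
    set m := ‖i (u t) - i (u c)‖ with hm
    have hmax' : ∀ r ∈ Icc s t, ‖i (u t) - i (u r)‖ ≤ m := fun r hr => hmax hr
    have hcI : c ∈ Icc (0 : ℝ) T := ⟨hs0.trans hc.1, hc.2.trans htT⟩
    have h1 := hq c t hcI.1 hc.2 htT (h.stable_all H hcI)
    have h2 : ∫ r in c..t, (power E r (u r) - power E r (u t)) ≤ ∫ r in c..t, m * |γ r| := by
      refine intervalIntegral.integral_mono_ae_restrict hc.2 (h.integrable_diff H hcI htI htI)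
        ((hγ.abs.sub_Icc hcI htI).const_mul _) ?_
      have hsub : Icc c t ⊆ Icc 0 T := Icc_subset_Icc hcI.1 htI.2
      filter_upwards [ae_mono (Measure.restrict_mono_set _ hsub) hpow,
        ae_restrict_mem measurableSet_Icc] with r hr hrm
      refine (le_abs_self _).trans ((hr _ _ (h.sublevel r (hsub hrm)) (h.sublevel t htI)).trans ?_)
      rw [mul_comm, map_sub, norm_sub_rev]
      exact (mul_le_mul_of_nonneg_left (le_abs_self _) (norm_nonneg _)).trans
        (mul_le_mul_of_nonneg_right (hmax' r ⟨hc.1.trans hrm.1, hrm.2⟩) (abs_nonneg _))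
    have h3 : ∫ r in c..t, m * |γ r| ≤ m * ∫ r in s..t, |γ r| := by
      rw [intervalIntegral.integral_const_mul]
      refine mul_le_mul_of_nonneg_left ?_ (norm_nonneg _)
      rw [← intervalIntegral.integral_add_adjacent_intervals (hγ.abs.sub_Icc hsI hcI)
        (hγ.abs.sub_Icc hcI htI)]
      linarith [intervalIntegral.integral_nonneg hc.1 (fun r _ => abs_nonneg (γ r)) (μ := volume)]
    have h4 : ‖i (u t) - i (u s)‖ ≤ m := hmax' s (left_mem_Icc.2 hst)
    refine h4.trans ?_
    rw [intervalIntegral.integral_const_mul]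
    have h5 : 0 ≤ ∫ r in s..t, |γ r| :=
      intervalIntegral.integral_nonneg hst (fun r _ => abs_nonneg (γ r))
    rcases (norm_nonneg (i (u t) - i (u c))).eq_or_lt with h0 | hpos
    · rw [hm, ← h0]; positivity
    · rw [map_sub] at h1
      have h6 : m * m ≤ m * (2 / μ * ∫ r in s..t, |γ r|) := by
        have : m * m = 2 / μ * (μ / 2 * m ^ 2) := by field_simp
        rw [this, show m * (2 / μ * ∫ r in s..t, |γ r|) = 2 / μ * (m * ∫ r in s..t, |γ r|) by ring]
        exact mul_le_mul_of_nonneg_left (h1.trans (h2.trans h3)) (by positivity)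
      exact le_of_mul_le_mul_left h6 hpos
  refine ⟨fun r => 2 / μ * |γ r|, hγ.abs.const_mul _, fun t _ => by positivity, fun s hs t ht => ?_⟩
  rcases le_total s t with hst | hst
  · exact (key s t hs.1 hst ht.2).trans (le_abs_self _)
  · rw [norm_sub_rev, intervalIntegral.integral_symm, abs_neg]
    exact (key t s ht.1 hst hs.2).trans (le_abs_self _)

end IsLimitCurve

end LimitCurve

/-! ### Differentiability of absolutely continuous curves in reflexive spaces -/

section Komura

variable {X : Type*} [NormedAddCommGroup X] [NormedSpace ℝ X]

lemma exists_norming_sequence (d : ℕ → X) : ∃ ℓ : ℕ → StrongDual ℝ X, (∀ k, ‖ℓ k‖ ≤ 1) ∧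
    ∀ y ∈ closure (range d), ∀ c : ℝ, (∀ k, ℓ k y ≤ c) → ‖y‖ ≤ c := by
  choose ℓ hℓ using fun k => exists_dual_vector'' ℝ (d k)
  refine ⟨ℓ, fun k => (hℓ k).1, fun y hy c hc => le_of_forall_pos_le_add fun δ hδ => ?_⟩
  obtain ⟨_, ⟨k, rfl⟩, hk⟩ := Metric.mem_closure_iff.1 hy (δ / 2) (by positivity)
  rw [dist_eq_norm] at hk
  have h1 : ℓ k (d k) = ‖d k‖ := (hℓ k).2
  have h2 : ℓ k (d k - y) ≤ ‖y - d k‖ := by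
    refine (le_abs_self _).trans (((ℓ k).le_of_opNorm_le (hℓ k).1 _).trans ?_)
    rw [one_mul, norm_sub_rev]
  have h3 : ‖y‖ ≤ ‖d k‖ + ‖y - d k‖ := by
    have := norm_add_le (d k) (y - d k)
    rwa [add_sub_cancel] at this
  rw [map_sub] at h2
  linarith [hc k]

lemma mem_of_weak_tendsto {Y : Submodule ℝ X} (hY : IsClosed (Y : Set X)) {α : Type*} {l : Filter α}
    [l.NeBot] {x : α → X} {x₀ : X}
    (hw : ∀ L : StrongDual ℝ X, Tendsto (fun a => L (x a)) l (𝓝 (L x₀)))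
    (hx : ∀ᶠ a in l, x a ∈ Y) : x₀ ∈ Y := by
  by_contra hno
  obtain ⟨L, c, h1, h2⟩ := geometric_hahn_banach_closed_point Y.convex hY hno
  exact absurd (le_of_tendsto (hw L) (hx.mono fun a ha => (h1 _ ha).le)) (not_le.2 h2)

/-- Kōmura's theorem. -/
theorem MemAC.ae_hasDerivAt_of_reflexive (hX : IsReflexive X) {T : ℝ} (hT : 0 ≤ T) {f : ℝ → X}
    (hf : MemAC T f) : ∀ᵐ t ∂(volume.restrict (Icc 0 T)), ∃ x, HasDerivAt f x t := by
  obtain ⟨φ, hφ, hφ0, hfφ⟩ := id hf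
  set Y : Submodule ℝ X := (Submodule.span ℝ (f '' Icc 0 T)).topologicalClosure with hY
  have hYcl : IsClosed (Y : Set X) := Submodule.isClosed_topologicalClosure _
  have hfY : ∀ t ∈ Icc (0 : ℝ) T, f t ∈ Y := fun t ht =>
    Submodule.le_topologicalClosure _ (Submodule.subset_span ⟨t, ht, rfl⟩)
  have hYsep : TopologicalSpace.IsSeparable (Y : Set X) :=
    ((isCompact_Icc.image_of_continuousOn (hf.continuousOn hT)).isSeparable.span).closure
  obtain ⟨c, hcY, hcc, hcd⟩ := hYsep.exists_countable_dense_subset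
  have hcne : c.Nonempty := by
    by_contra hno
    rw [not_nonempty_iff_eq_empty] at hno
    rw [hno, closure_empty] at hcd
    exact hcd Y.zero_mem
  obtain ⟨d, rfl⟩ := hcc.exists_eq_range hcne
  have hdY : ∀ k, d k ∈ Y := fun k => hcY ⟨k, rfl⟩
  obtain ⟨ℓ, hℓ1, hℓ⟩ := exists_norming_sequence d
  have hℓAC : ∀ k, MemAC T fun t => ℓ k (f t) := by
    intro k
    refine ⟨φ, hφ, hφ0, fun s hs t ht => ?_⟩
    rw [← map_sub]
    refine ((ℓ k).le_of_opNorm_le (hℓ1 k) _).trans ?_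
    rw [one_mul]
    exact hfφ s hs t ht
  have hder : ∀ᵐ r ∂(volume.restrict (Icc 0 T)), ∀ k, DifferentiableAt ℝ (fun t => ℓ k (f t)) r :=
    ae_all_iff.2 fun k => (hℓAC k).ae_differentiableAt hT
  have hΦ : ∀ᵐ r ∂(volume.restrict (Icc 0 T)),
      HasDerivAt (fun x => ∫ t in (0 : ℝ)..x, φ t) (φ r) r := by
    rw [ae_restrict_iff' measurableSet_Icc]
    have := hφ.ae_hasDerivAt_integral
    rw [uIcc_of_le hT] at this
    filter_upwards [this] with r hr hrm using hr hrm 0 (left_mem_Icc.2 hT)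
  have hint : ∀ᵐ r ∂(volume.restrict (Icc 0 T)), r ∈ Ioo 0 T :=
    ae_Icc_iff_Ioo.2 (Eventually.of_forall fun r hr => hr)
  have hex : ∀ᵐ r ∂(volume.restrict (Icc 0 T)), ∃ y ∈ Y, ‖y‖ ≤ φ r ∧
      ∀ k, ℓ k y = deriv (fun t => ℓ k (f t)) r := by
    filter_upwards [hder, hΦ, hint] with r hr1 hr2 hr3
    have hslope := hasDerivAt_iff_tendsto_slope.1 hr2
    have hrI : r ∈ Icc (0 : ℝ) T := ⟨hr3.1.le, hr3.2.le⟩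
    have hnear : ∀ᶠ x in 𝓝[≠] r, x ∈ Icc (0 : ℝ) T :=
      nhdsWithin_le_nhds (Icc_mem_nhds hr3.1 hr3.2)
    have hbd : ∀ᶠ x in 𝓝[≠] r, ‖slope f r x‖ ≤ |slope (fun x => ∫ t in (0 : ℝ)..x, φ t) r x| := by
      filter_upwards [hnear] with x hx
      rw [slope_def_module, slope_def_module, norm_smul, smul_eq_mul, abs_mul, Real.norm_eq_abs,
        intervalIntegral_sub_Icc hφ hrI hx]
      gcongr
      exact hfφ r hrI x hx
    have hlim := hslope.abs
    rw [abs_of_nonneg (hφ0 r hrI)] at hlim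
    have hδ : ∀ δ > 0, ∀ᶠ x in 𝓝[≠] r, ‖slope f r x‖ ≤ φ r + δ := by
      intro δ hδ
      filter_upwards [hbd, hlim.eventually (gt_mem_nhds (show φ r < φ r + δ by linarith))]
        with x h1 h2 using h1.trans h2.le
    set F := Ultrafilter.of (𝓝[≠] r) with hF
    have hFle : (F : Filter ℝ) ≤ 𝓝[≠] r := Ultrafilter.of_le _
    obtain ⟨y, hy⟩ := exists_weak_limit_ultrafilter hX F (fun x => slope f r x) _
      (hFle (hδ 1 one_pos))
    refine ⟨y, mem_of_weak_tendsto hYcl hy (hFle ?_), ?_, fun k => ?_⟩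
    · filter_upwards [hnear] with x hx
      rw [slope_def_module]
      exact Y.smul_mem _ (Y.sub_mem (hfY x hx) (hfY r hrI))
    · exact le_of_forall_pos_le_add fun δ hδ' =>
        norm_le_of_weak_tendsto hy (Eventually.frequently (hFle (hδ δ hδ')))
    · have h1 := (hasDerivAt_iff_tendsto_slope.1 (hr1 k).hasDerivAt).mono_left hFle
      refine tendsto_nhds_unique (hy (ℓ k)) (h1.congr fun x => ?_)
      simp [slope_def_module]
  classical
  set g : ℝ → X := fun r => if h : ∃ y ∈ Y, ‖y‖ ≤ φ r ∧
      ∀ k, ℓ k y = deriv (fun t => ℓ k (f t)) r then h.choose else 0 with hg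
  have hgY : ∀ r, g r ∈ Y := by
    intro r
    simp only [hg]
    split_ifs with h
    exacts [h.choose_spec.1, Y.zero_mem]
  have hgder : ∀ᵐ r ∂(volume.restrict (Icc 0 T)), ‖g r‖ ≤ φ r ∧
      ∀ k, ℓ k (g r) = deriv (fun t => ℓ k (f t)) r := by
    filter_upwards [hex] with r hr
    simp only [hg, dif_pos hr]
    exact hr.choose_spec.2
  have hclos : ∀ y ∈ Y, y ∈ closure (range d) := fun y hy => hcd hy
  have hmeas : ∀ j, AEStronglyMeasurable (fun r => ‖g r - d j‖) (volume.restrict (Icc 0 T)) := by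
    intro j
    have h1 : Measurable fun r => ⨆ k, ‖deriv (fun t => ℓ k (f t)) r - ℓ k (d j)‖ :=
      Measurable.iSup fun k => ((measurable_deriv _).sub_const _).norm
    refine ⟨_, h1.stronglyMeasurable, ?_⟩
    filter_upwards [hgder] with r hr
    have h2 : ∀ k, ‖deriv (fun t => ℓ k (f t)) r - ℓ k (d j)‖ ≤ ‖g r - d j‖ := by
      intro k
      rw [← hr.2 k, ← map_sub]
      simpa using (ℓ k).le_of_opNorm_le (hℓ1 k) (g r - d j)
    refine le_antisymm ?_ (ciSup_le h2)
    refine hℓ _ (hclos _ (Y.sub_mem (hgY r) (hdY j))) _ fun k => ?_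
    refine le_trans ?_ (le_ciSup (f := fun k => ‖deriv (fun t => ℓ k (f t)) r - ℓ k (d j)‖)
      ⟨_, by rintro _ ⟨k, rfl⟩; exact h2 k⟩ k)
    rw [map_sub, hr.2 k]
    exact le_abs_self _
  have hgint : ∀ j, IntervalIntegrable (fun r => ‖g r - d j‖) volume 0 T := by
    intro j
    rw [integrableOn_Icc_iff hT] at hφ ⊢
    refine Integrable.mono' (g := fun r => φ r + ‖d j‖) (hφ.add (integrableOn_const (by simp)))
      (hmeas j) ?_
    filter_upwards [hgder] with r hr
    rw [norm_norm]
    exact (norm_sub_le _ _).trans (by linarith [hr.1])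
  have hkey : ∀ j, ∀ a ∈ Icc (0 : ℝ) T, ∀ b ∈ Icc (0 : ℝ) T,
      ‖f b - f a - (b - a) • d j‖ ≤ |∫ r in a..b, ‖g r - d j‖| := by
    intro j a ha b hb
    refine hℓ _ (hclos _ (Y.sub_mem (Y.sub_mem (hfY b hb) (hfY a ha)) (Y.smul_mem _ (hdY j)))) _
      fun k => ?_
    have h1 : ℓ k (f b - f a - (b - a) • d j)
        = ∫ r in a..b, (deriv (fun t => ℓ k (f t)) r - ℓ k (d j)) := by
      rw [intervalIntegral.integral_sub ((hℓAC k).intervalIntegrable_deriv ha hb)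
        intervalIntegrable_const, (hℓAC k).integral_deriv ha hb, intervalIntegral.integral_const]
      simp
    rw [h1]
    refine (Real.le_norm_self _).trans (intervalIntegral.norm_integral_le_abs_of_norm_le ?_
      ((hgint j).sub_Icc ha hb))
    refine ae_restrict_uIoc ?_ ha hb
    filter_upwards [hgder] with r hr
    rw [← hr.2 k, ← map_sub]
    simpa using (ℓ k).le_of_opNorm_le (hℓ1 k) (g r - d j)
  have hleb : ∀ᵐ r ∂(volume.restrict (Icc 0 T)), ∀ j,
      HasDerivAt (fun x => ∫ t in (0 : ℝ)..x, ‖g t - d j‖) ‖g r - d j‖ r := by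
    refine ae_all_iff.2 fun j => ?_
    rw [ae_restrict_iff' measurableSet_Icc]
    have := (hgint j).ae_hasDerivAt_integral
    rw [uIcc_of_le hT] at this
    filter_upwards [this] with r hr hrm using hr hrm 0 (left_mem_Icc.2 hT)
  filter_upwards [hleb, hint] with r hr hrI
  have hrI' : r ∈ Icc (0 : ℝ) T := ⟨hrI.1.le, hrI.2.le⟩
  refine ⟨g r, ?_⟩
  rw [hasDerivAt_iff_isLittleO, Asymptotics.isLittleO_iff]
  intro δ hδ
  obtain ⟨_, ⟨j, rfl⟩, hj⟩ := Metric.mem_closure_iff.1 (hclos _ (hgY r)) (δ / 3) (by positivity)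
  rw [dist_eq_norm] at hj
  have h1 := (hasDerivAt_iff_isLittleO.1 (hr j))
  rw [Asymptotics.isLittleO_iff] at h1
  filter_upwards [h1 (show 0 < δ / 3 by positivity), Icc_mem_nhds hrI.1 hrI.2] with x hx hxI
  rw [intervalIntegral_sub_Icc (hgint j) hrI' hxI] at hx
  have h2 := hkey j r hrI' x hxI
  have h3 : f x - f r - (x - r) • g r = (f x - f r - (x - r) • d j) - (x - r) • (g r - d j) := by
    module
  rw [h3]
  refine (norm_sub_le _ _).trans ?_
  rw [norm_smul]
  have h4 : |∫ r in r..x, ‖g r - d j‖| ≤ δ / 3 * ‖x - r‖ + ‖x - r‖ * ‖g r - d j‖ := by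
    have := (abs_add_le ((∫ r in r..x, ‖g r - d j‖) - (x - r) • ‖g r - d j‖)
      ((x - r) • ‖g r - d j‖))
    rw [sub_add_cancel] at this
    refine this.trans (add_le_add hx ?_)
    rw [smul_eq_mul, abs_mul, abs_norm, Real.norm_eq_abs]
  have h5 : ‖x - r‖ * ‖g r - d j‖ ≤ ‖x - r‖ * (δ / 3) := by gcongr
  linarith

end Komura

/-! ### Subdifferentials and classical solutions -/

lemma ereal_coe_ennreal {x : ℝ≥0∞} (hx : x ≠ ⊤) : (x : EReal) = ((x.toReal : ℝ) : EReal) := by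
  lift x to NNReal using hx
  rfl

section Classical

variable {U V W Z X : Type*}
  [NormedAddCommGroup U] [NormedSpace ℝ U] [NormedAddCommGroup V] [InnerProductSpace ℝ V]
  [NormedAddCommGroup W] [InnerProductSpace ℝ W] [NormedAddCommGroup Z] [NormedSpace ℝ Z]
  [NormedAddCommGroup X] [NormedSpace ℝ X]
  {e : Embeddings U V W Z} {R : Z → ℝ} {T : ℝ} {E : ℝ → U → ℝ≥0∞} {D : Set U} {i : U →L[ℝ] X}

namespace IsRateIndependentSystem

lemma mem_energySubdiff_iff (H : IsRateIndependentSystem e R T E D i) {t : ℝ}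
    (ht : t ∈ Icc (0 : ℝ) T) {u : U} {ξ : StrongDual ℝ U} : ξ ∈ energySubdiff E t u ↔
      u ∈ D ∧ ∀ x ∈ D, (E t u).toReal + ξ (x - u) ≤ (E t x).toReal := by
  obtain ⟨μ, hμ, hconv⟩ := H.convex_real
  constructor
  · intro hξ
    have hu : u ∈ D := (H.domain.2 t ht u).1 fun h => hξ.1 (by simp [h])
    refine ⟨hu, fun x hx => ?_⟩
    have key : ∀ δ > 0, (E t u).toReal + ξ (x - u) ≤ (E t x).toReal + δ * ‖x - u‖ := by
      intro δ hδ
      have h1 := hξ.2 δ hδ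
      have h2 : Tendsto (fun a : ℝ => a • x + (1 - a) • u) (𝓝[>] 0) (𝓝 u) := by
        have : Tendsto (fun a : ℝ => a • x + (1 - a) • u) (𝓝 0)
            (𝓝 ((0 : ℝ) • x + (1 - (0 : ℝ)) • u)) := Continuous.tendsto (by fun_prop) 0
        rw [zero_smul, zero_add, sub_zero, one_smul] at this
        exact this.mono_left nhdsWithin_le_nhds
      obtain ⟨a, ha, haI⟩ := ((h2.eventually h1).and (Ioo_mem_nhdsGT (zero_lt_one' ℝ))).exists
      obtain ⟨h3, h4⟩ := hconv t ht a haI x hx u hu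
      have h5 : a • x + (1 - a) • u - u = a • (x - u) := by module
      simp only at ha
      rw [h5, map_smul, norm_smul, Real.norm_of_nonneg haI.1.le, smul_eq_mul,
        ereal_coe_ennreal (H.ne_top ht hu), ereal_coe_ennreal (H.ne_top ht h3)] at ha
      have h6 : (E t u).toReal + (a * ξ (x - u) - δ * (a * ‖x - u‖))
        ≤ (E t (a • x + (1 - a) • u)).toReal := by exact_mod_cast ha
      have h7 : 0 ≤ μ / 2 * a * (1 - a) * ‖i (x - u)‖ ^ 2 := by
        have := haI.1
        have : 0 < 1 - a := by linarith [haI.2]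
        positivity
      have h8 : a * ((E t u).toReal + ξ (x - u)) ≤ a * ((E t x).toReal + δ * ‖x - u‖) := by
        linarith
      exact le_of_mul_le_mul_left h8 haI.1
    refine le_of_forall_pos_le_add fun κ hκ => (key (κ / (‖x - u‖ + 1)) (by positivity)).trans ?_
    have : κ / (‖x - u‖ + 1) * ‖x - u‖ ≤ κ := by
      rw [div_mul_eq_mul_div, div_le_iff₀ (by positivity)]
      nlinarith [norm_nonneg (x - u)]
    linarith
  · rintro ⟨hu, h⟩
    refine ⟨by simpa using H.ne_top ht hu, fun δ hδ => Eventually.of_forall fun y => ?_⟩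
    by_cases hy : y ∈ D
    · simp only
      rw [ereal_coe_ennreal (H.ne_top ht hu), ereal_coe_ennreal (H.ne_top ht hy)]
      have h1 : (E t u).toReal + (ξ (y - u) - δ * ‖y - u‖) ≤ (E t y).toReal := by
        have : 0 ≤ δ * ‖y - u‖ := by positivity
        linarith [h y hy]
      exact_mod_cast h1
    · have : E t y = ⊤ := by
        by_contra hne
        exact hy ((H.domain.2 t ht y).1 hne)
      simp [this]

/-- At stable states the stationarity condition can be split between dissipation and energy. -/
lemma exists_subgradient_of_stable (H : IsRateIndependentSystem e R T E D i) {t : ℝ}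
    (ht : t ∈ Icc (0 : ℝ) T) {u : U} (hu : u ∈ D) (hst : GloballyStable e R E t u) :
    ∃ η : StrongDual ℝ Z, (∀ z, η z ≤ R z) ∧
      ∀ x ∈ D, (E t u).toReal - η (e.UZ (x - u)) ≤ (E t x).toReal := by
  obtain ⟨μ, hμ, hconv⟩ := H.convex_real
  rw [H.stable_iff ht hu] at hst
  set A : Set (Z × ℝ) := {p | p.2 < -R p.1} with hA
  set B : Set (Z × ℝ) := {p | ∃ x ∈ D, p.1 = e.UZ (x - u) ∧ (E t x).toReal - (E t u).toReal ≤ p.2}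
    with hB
  have hAo : IsOpen A := isOpen_lt continuous_snd (H.diss.continuous.comp continuous_fst).neg
  have hAc : Convex ℝ A := by
    intro p hp q hq a b ha hb hab
    simp only [hA, mem_ofPred_eq, Prod.fst_add, Prod.snd_add, Prod.smul_fst, Prod.smul_snd,
      smul_eq_mul] at hp hq ⊢
    have h1 := H.diss.add_le (a • p.1) (b • q.1)
    rw [H.diss.smul ha, H.diss.smul hb] at h1
    have h2 : a * p.2 + b * q.2 < a * (-R p.1) + b * (-R q.1) := by
      rcases ha.eq_or_lt with rfl | ha'
      · have : b = 1 := by linarith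
        subst this; linarith
      · have h3 : a * p.2 < a * (-R p.1) := by gcongr
        have h4 : b * q.2 ≤ b * (-R q.1) := by gcongr
        linarith
    linarith
  have hBc : Convex ℝ B := by
    rintro p ⟨x, hx, hx1, hx2⟩ q ⟨y, hy, hy1, hy2⟩ a b ha hb hab
    rcases ha.eq_or_lt with rfl | ha'
    · have : b = 1 := by linarith
      subst this
      exact ⟨y, hy, by simpa using hy1, by simpa using hy2⟩
    rcases hb.eq_or_lt with rfl | hb'
    · have : a = 1 := by linarith
      subst this
      exact ⟨x, hx, by simpa using hx1, by simpa using hx2⟩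
    obtain rfl : b = 1 - a := by linarith
    obtain ⟨h1, h2⟩ := hconv t ht a ⟨ha', by linarith⟩ x hx y hy
    refine ⟨_, h1, ?_, ?_⟩
    · rw [Prod.fst_add, Prod.smul_fst, Prod.smul_fst, hx1, hy1, ← map_smul, ← map_smul, ← map_add]
      congr 1
      module
    · have h3 : 0 ≤ μ / 2 * a * (1 - a) * ‖i (x - y)‖ ^ 2 := by positivity
      simp only [Prod.snd_add, Prod.smul_snd, smul_eq_mul]
      have h4 : a * ((E t x).toReal - (E t u).toReal) ≤ a * p.2 := by gcongr
      have h5 : (1 - a) * ((E t y).toReal - (E t u).toReal) ≤ (1 - a) * q.2 := by gcongr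
      linarith
  have hdisj : Disjoint A B := by
    rw [Set.disjoint_left]
    rintro p hp ⟨x, hx, hx1, hx2⟩
    simp only [hA, mem_ofPred_eq, hx1] at hp
    linarith [hst x hx]
  obtain ⟨f, c, hfA, hfB⟩ := geometric_hahn_banach_open hAc hAo hBc hdisj
  have hsplit : ∀ (z : Z) (r : ℝ), f (z, r) = f (z, 0) + r * f (0, 1) := by
    intro z r
    rw [← smul_eq_mul, ← map_smul, ← map_add]
    simp
  have hc0 : c ≤ 0 := by
    have := hfB (0, 0) ⟨u, hu, by simp, by simp⟩
    simpa [show ((0 : Z), (0 : ℝ)) = 0 from rfl] using this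
  set β := f (0, 1) with hβ
  have hβ0 : 0 < β := by
    have h1 := hfA (0, -1) (by simp [hA, H.diss.zero])
    rw [hsplit, show ((0 : Z), (0 : ℝ)) = 0 from rfl, map_zero] at h1
    linarith
  have hcz : 0 ≤ c := by
    by_contra! hneg
    have h1 := hfA (0, c / (2 * β)) (by
      simp only [hA, mem_ofPred_eq, H.diss.zero, neg_zero]
      exact div_neg_of_neg_of_pos hneg (by positivity))
    rw [hsplit, show ((0 : Z), (0 : ℝ)) = 0 from rfl, map_zero] at h1
    have : c / (2 * β) * β = c / 2 := by field_simp
    linarith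
  refine ⟨β⁻¹ • (f ∘L ContinuousLinearMap.inl ℝ Z ℝ), fun z => ?_, fun x hx => ?_⟩
  · refine le_of_forall_pos_le_add fun δ hδ => ?_
    have h1 := hfA (z, -R z - δ) (by simp only [hA, mem_ofPred_eq]; linarith)
    rw [hsplit] at h1
    simp only [_root_.smul_apply, ContinuousLinearMap.comp_apply,
      ContinuousLinearMap.inl_apply, smul_eq_mul]
    rw [inv_mul_le_iff₀ hβ0]
    linarith
  · have h1 := hfB (e.UZ (x - u), (E t x).toReal - (E t u).toReal) ⟨x, hx, rfl, le_rfl⟩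
    rw [hsplit] at h1
    simp only [_root_.smul_apply, ContinuousLinearMap.comp_apply,
      ContinuousLinearMap.inl_apply, smul_eq_mul]
    have h2 : 0 ≤ β⁻¹ * (f (e.UZ (x - u), 0) + ((E t x).toReal - (E t u).toReal) * β) := by
      have := inv_pos.2 hβ0
      apply mul_nonneg this.le
      linarith
    have h3 : β⁻¹ * (((E t x).toReal - (E t u).toReal) * β) = (E t x).toReal - (E t u).toReal := by
      field_simp
    linarith

end IsRateIndependentSystem

namespace IsLimitCurve

variable {K : ℝ} {v : ℝ → ℝ} {u : ℝ → U}

lemma classical (H : IsRateIndependentSystem e R T E D i)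
    (h : IsLimitCurve e R T E K v u) (hL : LipschitzPower T E i) (hX : IsReflexive X)
    (j : X →L[ℝ] Z) (hj : j ∘L i = e.UZ) : IsClassicalSolution e R T E i j (u 0) u := by
  refine ⟨?_, rfl⟩
  obtain ⟨γ, hγ, hpow⟩ := hL K h.pos
  have hΓ : ∀ᵐ r ∂(volume.restrict (Icc 0 T)),
      HasDerivAt (fun x => ∫ t in (0 : ℝ)..x, |γ t|) |γ r| r := by
    rw [ae_restrict_iff' measurableSet_Icc]
    have := hγ.abs.ae_hasDerivAt_integral
    rw [uIcc_of_le H.pos.le] at this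
    filter_upwards [this] with r hr hrm using hr hrm 0 (left_mem_Icc.2 H.pos.le)
  have hint : ∀ᵐ r ∂(volume.restrict (Icc 0 T)), r ∈ Ioo 0 T :=
    ae_Icc_iff_Ioo.2 (Eventually.of_forall fun r hr => hr)
  filter_upwards [(h.memAC_X H hL).ae_hasDerivAt_of_reflexive hX H.pos.le, hΓ, hint]
    with t ⟨x, hx⟩ ht1 ht2
  have htI : t ∈ Icc (0 : ℝ) T := ⟨ht2.1.le, ht2.2.le⟩
  obtain ⟨η, hη1, hη2⟩ := H.exists_subgradient_of_stable htI (h.mem H htI) (h.stable_all H htI)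
  refine ⟨x, hx, η, IsDissipationPotential.mem_dissSubdiff hη1 ?_, -(e.ZdualU η),
    (H.mem_energySubdiff_iff htI).2 ⟨h.mem H htI, fun y hy => ?_⟩, by simp⟩
  swap
  · have := hη2 y hy
    simp only [_root_.neg_apply, Embeddings.ZdualU, ContinuousLinearMap.comp_apply]
    linarith
  have hji : ∀ y, j (i y) = e.UZ y := fun y => by rw [← hj]; rfl
  have hquot := (hasDerivAt_iff_tendsto_slope.1 hx).mono_left
    (nhdsWithin_mono t (fun b (hb : t < b) => hb.ne'))
  have hΓq := (hasDerivAt_iff_tendsto_slope.1 ht1).mono_left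
    (nhdsWithin_mono t (fun b (hb : t < b) => hb.ne'))
  have key : ∀ δ > 0, R (j x) - η (j x) ≤ δ * |γ t| := by
    intro δ hδ
    have hlim : Tendsto (fun b => R (j (slope (fun s => i (u s)) t b))
        - η (j (slope (fun s => i (u s)) t b))) (𝓝[>] t) (𝓝 (R (j x) - η (j x))) := by
      have h1 := (j.continuous.tendsto x).comp hquot
      exact ((H.diss.continuous.tendsto _).comp h1).sub ((η.continuous.tendsto _).comp h1)
    refine le_of_tendsto_of_tendsto hlim (hΓq.const_mul δ) ?_
    obtain ⟨κ, hκ, hcont⟩ := Metric.continuousAt_iff.1 hx.continuousAt (δ / 2) (by positivity)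
    filter_upwards [Ioo_mem_nhdsGT (show t < min T (t + κ) from lt_min ht2.2 (by linarith))]
      with b hb
    have hbt : t < b := hb.1
    have hbT : b ≤ T := hb.2.le.trans (min_le_left _ _)
    have hbκ : b < t + κ := hb.2.trans_le (min_le_right _ _)
    have hbI : b ∈ Icc (0 : ℝ) T := ⟨htI.1.trans hbt.le, hbT⟩
    have hpos : 0 < (b - t)⁻¹ := inv_pos.2 (sub_pos.2 hbt)
    have e1 := h.energy_eq H htI.1 hbt.le hbT
    have e2 := h.diss_le t b htI.1 hbt.le hbT
    have e3 := H.integral_power (h.mem H hbI) htI hbI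
    have e4 := hη2 _ (h.mem H hbI)
    have e5 : ∫ r in t..b, (power E r (u r) - power E r (u b)) ≤ ∫ r in t..b, δ * |γ r| := by
      refine intervalIntegral.integral_mono_ae_restrict hbt.le (h.integrable_diff H htI hbI hbI)
        ((hγ.abs.sub_Icc htI hbI).const_mul _) ?_
      have hsub : Icc t b ⊆ Icc 0 T := Icc_subset_Icc htI.1 hbI.2
      filter_upwards [ae_mono (Measure.restrict_mono_set _ hsub) hpow,
        ae_restrict_mem measurableSet_Icc] with r hr hrm
      refine (le_abs_self _).trans ((hr _ _ (h.sublevel r (hsub hrm)) (h.sublevel b hbI)).trans ?_)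
      rw [mul_comm, map_sub]
      refine (mul_le_mul_of_nonneg_left (le_abs_self _) (norm_nonneg _)).trans
        (mul_le_mul_of_nonneg_right ?_ (abs_nonneg _))
      have d1 := hcont (x := r) (by rw [Real.dist_eq, abs_lt]; constructor <;> linarith [hrm.1, hrm.2])
      have d2 := hcont (x := b) (by rw [Real.dist_eq, abs_lt]; constructor <;> linarith)
      have d3 := dist_triangle_right (i (u r)) (i (u b)) (i (u t))
      rw [dist_eq_norm] at d3
      linarith
    rw [intervalIntegral.integral_sub (h.integrable.sub_Icc htI hbI)
      (H.intervalIntegrable_power (h.mem H hbI) htI hbI), intervalIntegral.integral_const_mul] at e5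
    have e6 : j (slope (fun s => i (u s)) t b) = (b - t)⁻¹ • e.UZ (u b - u t) := by
      rw [slope_def_module, ← map_sub, map_smul, hji]
    rw [e6, map_smul, H.diss.smul hpos.le, slope_def_module,
      intervalIntegral_sub_Icc hγ.abs htI hbI, smul_eq_mul, smul_eq_mul, ← mul_sub,
      mul_left_comm δ]
    refine mul_le_mul_of_nonneg_left ?_ hpos.le
    linarith
  have hlast : R (j x) - η (j x) ≤ 0 := by
    refine le_of_forall_pos_le_add fun κ hκ => (key (κ / (|γ t| + 1)) (by positivity)).trans ?_
    rw [zero_add, div_mul_eq_mul_div, div_le_iff₀ (by positivity)]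
    nlinarith [abs_nonneg (γ t)]
  linarith

end IsLimitCurve

end Classical

/-! ### Estimates for dissipative dynamic solutions -/

lemma neBot_nhdsWithin_diff_null {T : ℝ} (hT : 0 < T) {N : Set ℝ} (hN : volume N = 0) {t : ℝ}
    (ht : t ∈ Icc (0 : ℝ) T) : (𝓝[Icc 0 T \ N] t).NeBot := by
  rw [← mem_closure_iff_nhdsWithin_neBot]
  have hd : Dense {x : ℝ | x ∉ N} := Measure.dense_of_ae (μ := volume) (measure_eq_zero_iff_ae_notMem.1 hN)
  have h1 := hd.open_subset_closure_inter (isOpen_Ioo (a := 0) (b := T))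
  have h2 : closure (Ioo 0 T) ⊆ closure (Ioo 0 T ∩ {x | x ∉ N}) :=
    closure_minimal h1 isClosed_closure
  rw [closure_Ioo hT.ne] at h2
  have h3 : Ioo 0 T ∩ {x | x ∉ N} ⊆ Icc 0 T \ N := fun x hx => ⟨⟨hx.1.1.le, hx.1.2.le⟩, hx.2⟩
  exact closure_mono h3 (h2 ht)

section Dynamic

variable {U V W Z X : Type*}
  [NormedAddCommGroup U] [NormedSpace ℝ U] [NormedAddCommGroup V] [InnerProductSpace ℝ V]
  [NormedAddCommGroup W] [InnerProductSpace ℝ W] [NormedAddCommGroup Z] [NormedSpace ℝ Z]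
  [NormedAddCommGroup X] [NormedSpace ℝ X]
  {e : Embeddings U V W Z} {R : Z → ℝ} {T : ℝ} {E : ℝ → U → ℝ≥0∞} {D : Set U} {i : U →L[ℝ] X}
  {M : StrongDual ℝ U ≃L[ℝ] StrongDual ℝ U} {MW : W →L[ℝ] W} {Vis : V →L[ℝ] StrongDual ℝ V}

/-- The properties of a dissipative dynamic solution used for the vanishing-viscosity limit. -/
structure IsDynamicData (e : Embeddings U V W Z)
    (M : StrongDual ℝ U ≃L[ℝ] StrongDual ℝ U) (MW : W →L[ℝ] W)
    (Vis : V →L[ℝ] StrongDual ℝ V) (R : Z → ℝ) (T : ℝ) (E : ℝ → U → ℝ≥0∞) (D : Set U)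
    (ε d : ℝ) (u : ℝ → U) (v : ℝ → V) (w : ℝ → W) (a ξ : ℝ → StrongDual ℝ U)
    (η : ℝ → StrongDual ℝ Z) (Q : ℝ → ℝ) (N : Set ℝ) : Prop where
  pos : 0 < ε
  data_nonneg : 0 ≤ d
  mem : ∀ t ∈ Icc (0 : ℝ) T, u t ∈ D
  memCw : MemCw T u
  memW12 : MemW12 T (fun t => e.UV (u t)) v
  energy_bdd : MemLp (fun t => (E t (u t)).toReal) ⊤ (volume.restrict (Icc 0 T))
  memC1w : MemC1w T (fun t => e.UW (u t)) w
  velocity : ∀ᵐ t ∂(volume.restrict (Icc 0 T)), e.VW (v t) = w t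
  acceleration : MemW12 T (fun t => e.WdualU (w t)) a
  equation : ∀ᵐ t ∂(volume.restrict (Icc 0 T)),
      η t ∈ dissSubdiff R (e.VZ (v t)) ∧ ξ t ∈ energySubdiff E t (u t) ∧
      ε ^ 2 • M (a t) + ε • e.VdualU (Vis (v t)) + e.ZdualU (η t) + ξ t = 0
  integrable_diss : IntervalIntegrable Q volume 0 T
  diss_ge : ∀ t, ε / 2 * Vis (v t) (v t) + R (e.VZ (v t)) ≤ Q t
  integrable_power : IntervalIntegrable (fun r => power E r (u r)) volume 0 T
  null : volume N = 0
  balance : ∀ t ∈ Icc (0 : ℝ) T \ N,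
      ε ^ 2 / 2 * ⟪MW (w t), w t⟫ + (E t (u t)).toReal + ∫ r in (0 : ℝ)..t, Q r
      = d + ∫ r in (0 : ℝ)..t, power E r (u r)

lemma viscousDissipationConj_nonneg (hR : IsDissipationPotential R) (ε : ℝ) (ζ : StrongDual ℝ V) :
    0 ≤ viscousDissipationConj e Vis R ε ζ := by
  refine EReal.toReal_nonneg (le_iSup_of_le (0 : V) ?_)
  simp [viscousDissipation, hR.zero]

lemma IsDissipativeDynamicSolution.exists_data (H : IsRateIndependentSystem e R T E D i)
    (hM : IsMassOperator e M MW) {ε : ℝ} (hε : 0 < ε) {u₀ : U} {u₁ : V} {u : ℝ → U} {v : ℝ → V}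
    (h : IsDissipativeDynamicSolution e M MW Vis R T E D ε u₀ u₁ u v) :
    u 0 = u₀ ∧ ∃ (w : ℝ → W) (a ξ : ℝ → StrongDual ℝ U) (η : ℝ → StrongDual ℝ Z) (Q : ℝ → ℝ)
      (N : Set ℝ), IsDynamicData e M MW Vis R T E D ε
        (ε ^ 2 / 2 * ⟪MW (e.VW u₁), e.VW u₁⟫ + (E 0 u₀).toReal) u v w a ξ η Q N := by
  obtain ⟨h1, h2, h3, h4, w, a, ξ, η, ζ, h5, h6, h7, h8, h9, -, h10, -, h11, h12, N, -, h13, h14⟩ := h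
  refine ⟨h8, w, a, ξ, η, _, N, hε, ?_, h1, h2, h3, h4, h5, h6, h7, h10, h11, fun t => ?_, h12, h13,
    h14⟩
  · obtain ⟨c, hc0, hc⟩ := hM.posDef
    have := hc (e.VW u₁)
    have h15 : 0 ≤ ⟪MW (e.VW u₁), e.VW u₁⟫ := le_trans (by positivity) this
    positivity
  · exact le_add_of_nonneg_right (viscousDissipationConj_nonneg H.diss _ _)

namespace IsDynamicData

variable {ε d : ℝ} {u : ℝ → U} {v : ℝ → V} {w : ℝ → W} {a ξ : ℝ → StrongDual ℝ U}
  {η : ℝ → StrongDual ℝ Z} {Q : ℝ → ℝ} {N : Set ℝ}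

lemma integrable_v (h : IsDynamicData e M MW Vis R T E D ε d u v w a ξ η Q N) (hT : 0 ≤ T) :
    IntervalIntegrable v volume 0 T :=
  (integrableOn_Icc_iff hT).2 (h.memW12.2.1.integrable one_le_two)

lemma integrable_v_sq (h : IsDynamicData e M MW Vis R T E D ε d u v w a ξ η Q N) (hT : 0 ≤ T) :
    IntervalIntegrable (fun r => ‖v r‖ ^ 2) volume 0 T :=
  (integrableOn_Icc_iff hT).2 h.memW12.2.1.norm.integrable_sq

lemma integrable_R (hR : IsDissipationPotential R)
    (h : IsDynamicData e M MW Vis R T E D ε d u v w a ξ η Q N) (hT : 0 ≤ T) :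
    IntervalIntegrable (fun r => R (e.VZ (v r))) volume 0 T := by
  obtain ⟨ρ, hρ, hle⟩ := hR.exists_upper
  rw [integrableOn_Icc_iff hT]
  have hv := h.memW12.2.1.integrable one_le_two
  refine Integrable.mono' (g := fun r => ρ * (‖e.VZ‖ * ‖v r‖)) ((hv.norm.const_mul _).const_mul _)
    ((hR.continuous.comp e.VZ.continuous).comp_aestronglyMeasurable hv.1)
    (Eventually.of_forall fun r => ?_)
  rw [Real.norm_of_nonneg (hR.nonneg _)]
  refine (hle _).trans ?_
  gcongr
  exact e.VZ.le_opNorm _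

lemma sub_eq_integral [CompleteSpace V] (h : IsDynamicData e M MW Vis R T E D ε d u v w a ξ η Q N)
    {s t : ℝ} (hs : s ∈ Icc (0 : ℝ) T) (ht : t ∈ Icc (0 : ℝ) T) :
    e.UV (u t) - e.UV (u s) = ∫ r in s..t, v r := by
  have h1 : e.UV (u t) = e.UV (u 0) + ∫ r in (0 : ℝ)..t, v r := h.memW12.2.2 t ht
  have h2 : e.UV (u s) = e.UV (u 0) + ∫ r in (0 : ℝ)..s, v r := h.memW12.2.2 s hs
  rw [h1, h2, add_sub_add_left_eq_sub,
    intervalIntegral_sub_Icc (h.integrable_v (hs.1.trans hs.2)) hs ht]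

lemma continuousOn_UV (h : IsDynamicData e M MW Vis R T E D ε d u v w a ξ η Q N) (hT : 0 ≤ T) :
    ContinuousOn (fun t => e.UV (u t)) (Icc 0 T) :=
  ((continuousOn_const (c := e.UV (u 0))).add
    ((memAC_of_intervalIntegral (h.integrable_v hT)).continuousOn hT)).congr h.memW12.2.2

/-- The distance in `Z` is controlled by the dissipated energy. -/
lemma diss_le [CompleteSpace V] [CompleteSpace Z] (hR : IsDissipationPotential R)
    (h : IsDynamicData e M MW Vis R T E D ε d u v w a ξ η Q N)
    {s t : ℝ} (hs : 0 ≤ s) (hst : s ≤ t) (ht : t ≤ T) :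
    R (e.UZ (u t - u s)) ≤ ∫ r in s..t, R (e.VZ (v r)) := by
  have hsI : s ∈ Icc (0 : ℝ) T := ⟨hs, hst.trans ht⟩
  have htI : t ∈ Icc (0 : ℝ) T := ⟨hs.trans hst, ht⟩
  have hT := hsI.1.trans hsI.2
  have h1 : e.UZ (u t - u s) = ∫ r in s..t, e.VZ (v r) := by
    rw [ContinuousLinearMap.intervalIntegral_comp_comm _ ((h.integrable_v hT).sub_Icc hsI htI),
      ← h.sub_eq_integral hsI htI, ← map_sub]
    rfl
  rw [h1]
  exact hR.map_integral_le hst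
    ⟨e.VZ.integrable_comp ((h.integrable_v hT).sub_Icc hsI htI).1,
      e.VZ.integrable_comp ((h.integrable_v hT).sub_Icc hsI htI).2⟩
    ((h.integrable_R hR hT).sub_Icc hsI htI)

lemma mass_nonneg (hM : IsMassOperator e M MW) (x : W) : 0 ≤ ⟪MW x, x⟫ := by
  obtain ⟨c, hc0, hc⟩ := hM.posDef
  exact le_trans (by positivity) (hc x)

lemma Q_nonneg (hR : IsDissipationPotential R) (hVis : IsViscosityOperator Vis)
    (h : IsDynamicData e M MW Vis R T E D ε d u v w a ξ η Q N) (t : ℝ) : 0 ≤ Q t := by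
  obtain ⟨c, hc0, hc⟩ := hVis.posDef
  refine le_trans ?_ (h.diss_ge t)
  have h1 := h.pos
  have h2 : 0 ≤ Vis (v t) (v t) := le_trans (by positivity) (hc _)
  have h3 := hR.nonneg (e.VZ (v t))
  positivity

/-- The Gronwall estimate. -/
lemma gronwall (H : IsRateIndependentSystem e R T E D i) (hM : IsMassOperator e M MW)
    (hVis : IsViscosityOperator Vis) (h : IsDynamicData e M MW Vis R T E D ε d u v w a ξ η Q N)
    {b : ℝ → ℝ} (hb : IntervalIntegrable b volume 0 T) (hb0 : ∀ t, 0 ≤ b t)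
    (hbE : ∀ᵐ t ∂(volume.restrict (Icc 0 T)), ∀ x ∈ D, |power E t x| ≤ b t * ((E t x).toReal + 1))
    {t : ℝ} (ht : t ∈ Icc (0 : ℝ) T) :
    d + 1 + ∫ r in (0 : ℝ)..t, power E r (u r) ≤ (d + 1) * Real.exp (∫ r in (0 : ℝ)..T, b r) := by
  have hT := H.pos.le
  set y : ℝ → ℝ := fun t => (E t (u t)).toReal + 1 with hy
  have hby : IntervalIntegrable (fun r => b r * y r) volume 0 T := by
    rw [integrableOn_Icc_iff hT] at hb ⊢
    have := Integrable.mul_of_top_left hb (h.energy_bdd.add (memLp_const 1))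
    exact this
  set G : ℝ → ℝ := fun t => d + 1 + ∫ r in (0 : ℝ)..t, b r * y r with hG
  have hy0 : ∀ r, 0 ≤ y r := fun r => by positivity
  have hGAC : MemAC T G := by
    obtain ⟨φ, hφ, hφ0, hf⟩ := memAC_of_intervalIntegral hby
    exact ⟨φ, hφ, hφ0, fun s hs t ht => by
      rw [hG, add_sub_add_left_eq_sub]; exact hf s hs t ht⟩
  have hG1 : ∀ t ∈ Icc (0 : ℝ) T, d + 1 ≤ G t := by
    intro t ht
    have := intervalIntegral.integral_nonneg (μ := volume) ht.1
      (fun r _ => mul_nonneg (hb0 r) (hy0 r))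
    simp only [hG]
    linarith
  have hpow : ∀ t ∈ Icc (0 : ℝ) T, d + 1 + ∫ r in (0 : ℝ)..t, power E r (u r) ≤ G t := by
    intro t ht
    simp only [hG]
    gcongr
    refine intervalIntegral.integral_mono_ae_restrict ht.1
      (h.integrable_power.sub_Icc H.zero_mem ht) (hby.sub_Icc H.zero_mem ht) ?_
    have hsub : Icc 0 t ⊆ Icc 0 T := Icc_subset_Icc le_rfl ht.2
    filter_upwards [ae_mono (Measure.restrict_mono_set _ hsub) hbE,
      ae_restrict_mem measurableSet_Icc] with r hr hrm
    exact (le_abs_self _).trans (hr _ (h.mem r (hsub hrm)))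
  have hyG : ∀ᵐ t ∂(volume.restrict (Icc 0 T)), y t ≤ G t := by
    have hN : ∀ᵐ t ∂(volume.restrict (Icc 0 T)), t ∉ N :=
      ae_restrict_of_ae (measure_eq_zero_iff_ae_notMem.1 h.null)
    filter_upwards [hN, ae_restrict_mem measurableSet_Icc] with t htN ht
    have h1 := h.balance t ⟨ht, htN⟩
    have h2 := intervalIntegral.integral_nonneg (μ := volume) ht.1
      (fun r _ => h.Q_nonneg H.diss hVis r)
    have h3 := mass_nonneg hM (w t)
    have h4 : 0 ≤ ε ^ 2 / 2 * ⟪MW (w t), w t⟫ := by positivity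
    have h5 := hpow t ht
    simp only [hy]
    linarith
  have hder : ∀ᵐ t ∂(volume.restrict (Icc 0 T)), |deriv G t| ≤ b t * G t := by
    have h1 : ∀ᵐ r ∂(volume.restrict (Icc 0 T)),
        HasDerivAt (fun x => ∫ t in (0 : ℝ)..x, b t * y t) (b r * y r) r := by
      rw [ae_restrict_iff' measurableSet_Icc]
      have := hby.ae_hasDerivAt_integral
      rw [uIcc_of_le hT] at this
      filter_upwards [this] with r hr hrm using hr hrm 0 H.zero_mem
    filter_upwards [h1, hyG] with t h2 h3
    rw [(h2.const_add (d + 1)).deriv, abs_of_nonneg (mul_nonneg (hb0 t) (hy0 t))]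
    exact mul_le_mul_of_nonneg_left h3 (hb0 t)
  have hd1 : 0 < d + 1 := by linarith [h.data_nonneg]
  have hlog := (le_abs_self _).trans (abs_log_sub_log_le hT hGAC
    (fun t ht => by linarith [hG1 t ht, h.data_nonneg]) hb hder H.zero_mem ht)
  have hG0 : G 0 = d + 1 := by simp [hG]
  have hGt : 0 < G t := hd1.trans_le (hG1 t ht)
  rw [hG0, ← Real.log_div hGt.ne' hd1.ne', Real.log_le_iff_le_exp (by positivity),
    div_le_iff₀ hd1, mul_comm] at hlog
  refine (hpow t ht).trans (hlog.trans ?_)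
  gcongr
  rw [abs_of_nonneg (intervalIntegral.integral_nonneg ht.1 fun r _ => hb0 r)]
  exact intervalIntegral.integral_mono_interval le_rfl ht.1 ht.2
    (Eventually.of_forall hb0) hb

lemma weak_tendsto (h : IsDynamicData e M MW Vis R T E D ε d u v w a ξ η Q N) {t : ℝ}
    (ht : t ∈ Icc (0 : ℝ) T) (L : StrongDual ℝ U) :
    Tendsto (fun s => L (u s)) (𝓝[Icc 0 T \ N] t) (𝓝 (L (u t))) :=
  (h.memCw.2 L t ht).tendsto.mono_left (nhdsWithin_mono _ sdiff_subset)

lemma diss_R_le (hVis : IsViscosityOperator Vis)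
    (h : IsDynamicData e M MW Vis R T E D ε d u v w a ξ η Q N) (t : ℝ) : R (e.VZ (v t)) ≤ Q t := by
  obtain ⟨c, hc0, hc⟩ := hVis.posDef
  have h1 := h.pos
  have h2 : 0 ≤ Vis (v t) (v t) := le_trans (by positivity) (hc _)
  have h3 : 0 ≤ ε / 2 * Vis (v t) (v t) := by positivity
  linarith [h.diss_ge t]

/-- The energy inequality at every time. -/
lemma energy_le (H : IsRateIndependentSystem e R T E D i) (hM : IsMassOperator e M MW)
    (hVis : IsViscosityOperator Vis) (h : IsDynamicData e M MW Vis R T E D ε d u v w a ξ η Q N)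
    {t : ℝ} (ht : t ∈ Icc (0 : ℝ) T) :
    (E t (u t)).toReal + ∫ r in (0 : ℝ)..t, R (e.VZ (v r))
      ≤ d + ∫ r in (0 : ℝ)..t, power E r (u r) := by
  obtain ⟨b, hb, hb0, -, hbE⟩ := H.exists_control
  have hT := H.pos.le
  have hne := neBot_nhdsWithin_diff_null H.pos h.null ht
  have hR := h.integrable_R H.diss hT
  set l := 𝓝[Icc 0 T \ N] t with hl
  have hll : l ≤ 𝓝[Icc 0 T] t := nhdsWithin_mono _ sdiff_subset
  have hmem : ∀ᶠ s in l, s ∈ Icc (0 : ℝ) T \ N := self_mem_nhdsWithin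
  have hcont : ∀ f : ℝ → ℝ, IntervalIntegrable f volume 0 T →
      Tendsto (fun s => ∫ r in (0 : ℝ)..s, f r) l (𝓝 (∫ r in (0 : ℝ)..t, f r)) := fun f hf =>
    ((memAC_of_intervalIntegral hf).continuousOn hT t ht).tendsto.mono_left hll
  have hB : Tendsto (fun s => Real.exp |(∫ r in (0 : ℝ)..t, b r) - ∫ r in (0 : ℝ)..s, b r|) l
      (𝓝 1) := by
    have h1 := ((tendsto_const_nhds (x := ∫ r in (0 : ℝ)..t, b r)).sub (hcont b hb)).abs
    have h2 := (Real.continuous_exp.tendsto _).comp h1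
    simpa [Function.comp_def] using h2
  have hle : ∀ᶠ s in l, (E t (u s)).toReal ≤
      Real.exp |(∫ r in (0 : ℝ)..t, b r) - ∫ r in (0 : ℝ)..s, b r| *
        (d + (∫ r in (0 : ℝ)..s, power E r (u r)) - (∫ r in (0 : ℝ)..s, R (e.VZ (v r))) + 1) - 1 := by
    filter_upwards [hmem] with s hs
    have h1 := h.balance s hs
    have h2 : ∫ r in (0 : ℝ)..s, R (e.VZ (v r)) ≤ ∫ r in (0 : ℝ)..s, Q r :=
      intervalIntegral.integral_mono_on hs.1.1 (hR.sub_Icc H.zero_mem hs.1)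
        (h.integrable_diss.sub_Icc H.zero_mem hs.1) fun r _ => h.diss_R_le hVis r
    have h3 := mass_nonneg hM (w s)
    have h4 : 0 ≤ ε ^ 2 / 2 * ⟪MW (w s), w s⟫ := by positivity
    have h5 := hbE _ (h.mem s hs.1) s hs.1 t ht
    rw [intervalIntegral_sub_Icc hb hs.1 ht]
    have h6 : Real.exp |∫ r in s..t, b r| * ((E s (u s)).toReal + 1) ≤
        Real.exp |∫ r in s..t, b r| * (d + (∫ r in (0 : ℝ)..s, power E r (u r))
          - (∫ r in (0 : ℝ)..s, R (e.VZ (v r))) + 1) := by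
      gcongr
      linarith
    linarith
  have hlim := (hB.mul ((((hcont _ h.integrable_power).const_add d).sub (hcont _ hR)).add_const
    1)).sub_const 1
  have := (H.toReal_le_of_weak ht (by filter_upwards [hmem] with s hs using h.mem s hs.1)
    (h.weak_tendsto ht) hle hlim).2
  linarith

lemma integral_Q_le (H : IsRateIndependentSystem e R T E D i) (hM : IsMassOperator e M MW)
    (h : IsDynamicData e M MW Vis R T E D ε d u v w a ξ η Q N)
    {P : ℝ} (hP : ∀ t ∈ Icc (0 : ℝ) T, d + 1 + ∫ r in (0 : ℝ)..t, power E r (u r) ≤ P) :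
    ∫ r in (0 : ℝ)..T, Q r ≤ P := by
  have hT := H.pos.le
  have hTI : T ∈ Icc (0 : ℝ) T := right_mem_Icc.2 hT
  have hne := neBot_nhdsWithin_diff_null H.pos h.null hTI
  have hll : 𝓝[Icc 0 T \ N] T ≤ 𝓝[Icc 0 T] T := nhdsWithin_mono _ sdiff_subset
  refine le_of_tendsto (((memAC_of_intervalIntegral h.integrable_diss).continuousOn hT T
    hTI).tendsto.mono_left hll) ?_
  filter_upwards [self_mem_nhdsWithin] with t ht
  have h1 := h.balance t ht
  have h3 := mass_nonneg hM (w t)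
  have h4 : 0 ≤ ε ^ 2 / 2 * ⟪MW (w t), w t⟫ := by positivity
  have h5 : 0 ≤ (E t (u t)).toReal := ENNReal.toReal_nonneg
  linarith [hP t ht.1]

lemma viscous_le (H : IsRateIndependentSystem e R T E D i) (hM : IsMassOperator e M MW)
    (h : IsDynamicData e M MW Vis R T E D ε d u v w a ξ η Q N)
    {P : ℝ} (hP : ∀ t ∈ Icc (0 : ℝ) T, d + 1 + ∫ r in (0 : ℝ)..t, power E r (u r) ≤ P)
    {c : ℝ} (hc0 : 0 < c) (hc : ∀ v, c * ‖v‖ ^ 2 ≤ Vis v v) :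
    ε * ∫ r in (0 : ℝ)..T, ‖v r‖ ^ 2 ≤ 2 / c * P := by
  have h1 : ∫ r in (0 : ℝ)..T, ε * c / 2 * ‖v r‖ ^ 2 ≤ ∫ r in (0 : ℝ)..T, Q r := by
    refine intervalIntegral.integral_mono_on H.pos.le
      ((h.integrable_v_sq H.pos.le).const_mul _) h.integrable_diss fun r _ => ?_
    refine le_trans ?_ (h.diss_ge r)
    have h2 : ε / 2 * (c * ‖v r‖ ^ 2) ≤ ε / 2 * Vis (v r) (v r) := by
      have := h.pos
      gcongr
      exact hc _
    linarith [H.diss.nonneg (e.VZ (v r))]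
  rw [intervalIntegral.integral_const_mul] at h1
  have h3 := h1.trans (h.integral_Q_le H hM hP)
  have h4 : ε * ∫ r in (0 : ℝ)..T, ‖v r‖ ^ 2 = 2 / c * (ε * c / 2 * ∫ r in (0 : ℝ)..T, ‖v r‖ ^ 2) := by
    field_simp
  rw [h4]
  gcongr

lemma kinetic_le (H : IsRateIndependentSystem e R T E D i) (hVis : IsViscosityOperator Vis)
    (h : IsDynamicData e M MW Vis R T E D ε d u v w a ξ η Q N)
    {P : ℝ} (hP : ∀ t ∈ Icc (0 : ℝ) T, d + 1 + ∫ r in (0 : ℝ)..t, power E r (u r) ≤ P)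
    {c : ℝ} (hc0 : 0 < c) (hc : ∀ w, c * ‖w‖ ^ 2 ≤ ⟪MW w, w⟫) {t : ℝ} (ht : t ∈ Icc (0 : ℝ) T) :
    ε * ‖w t‖ ≤ √(2 / c * P) := by
  have hne := neBot_nhdsWithin_diff_null H.pos h.null ht
  have hε := h.pos
  have key : ‖w t‖ ≤ √(2 / c * P) / ε := by
    refine norm_le_of_weak_tendsto (l := 𝓝[Icc 0 T \ N] t) (x := w)
      (fun L => (h.memC1w.2.1.2 L t ht).tendsto.mono_left (nhdsWithin_mono _ sdiff_subset))
      (Eventually.frequently ?_)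
    filter_upwards [self_mem_nhdsWithin] with s hs
    have h1 := h.balance s hs
    have h2 := intervalIntegral.integral_nonneg (μ := volume) hs.1.1
      (fun r _ => h.Q_nonneg H.diss hVis r)
    have h5 : 0 ≤ (E s (u s)).toReal := ENNReal.toReal_nonneg
    have h6 : ε ^ 2 / 2 * (c * ‖w s‖ ^ 2) ≤ ε ^ 2 / 2 * ⟪MW (w s), w s⟫ := by
      gcongr
      exact hc _
    rw [le_div_iff₀ hε]
    refine Real.le_sqrt_of_sq_le ?_
    have h7 : (‖w s‖ * ε) ^ 2 = 2 / c * (ε ^ 2 / 2 * (c * ‖w s‖ ^ 2)) := by field_simp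
    rw [h7]
    gcongr
    linarith [hP s hs.1]
  rw [le_div_iff₀ hε] at key
  linarith

/-- The momentum tested with `x - u`. -/
lemma momentum [CompleteSpace V] (H : IsRateIndependentSystem e R T E D i)
    (hM : IsMassOperator e M MW)
    (h : IsDynamicData e M MW Vis R T E D ε d u v w a ξ η Q N) (x : U) :
    MemAC T (fun t => ⟪MW (w t), e.UW (x - u t)⟫) ∧
    ∀ᵐ t ∂(volume.restrict (Icc 0 T)), deriv (fun t => ⟪MW (w t), e.UW (x - u t)⟫) t
      = M (a t) (x - u t) - ⟪MW (w t), w t⟫ := by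
  have hT := H.pos.le
  obtain ⟨Cu, hCu⟩ := h.memCw.1.2
  obtain ⟨Cw, hCw⟩ := h.memC1w.2.1.1.2
  have hCu0 : 0 ≤ Cu := (norm_nonneg _).trans (hCu 0 H.zero_mem)
  have hCw0 : 0 ≤ Cw := (norm_nonneg _).trans (hCw 0 H.zero_mem)
  have ha : IntervalIntegrable a volume 0 T :=
    (integrableOn_Icc_iff hT).2 (h.acceleration.2.1.integrable one_le_two)
  have hMa : IntervalIntegrable (fun r => M (a r)) volume 0 T :=
    ⟨(M : StrongDual ℝ U →L[ℝ] StrongDual ℝ U).integrable_comp ha.1,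
      (M : StrongDual ℝ U →L[ℝ] StrongDual ℝ U).integrable_comp ha.2⟩
  set A : ℝ → StrongDual ℝ U := fun t => e.WdualU (MW (w t)) with hA
  have hAsub : ∀ s ∈ Icc (0 : ℝ) T, ∀ t ∈ Icc (0 : ℝ) T, A t - A s = ∫ r in s..t, M (a r) := by
    intro s hs t ht
    have e1 : e.WdualU (w t) = e.WdualU (w 0) + ∫ r in (0 : ℝ)..t, a r := h.acceleration.2.2 t ht
    have e2 : e.WdualU (w s) = e.WdualU (w 0) + ∫ r in (0 : ℝ)..s, a r := h.acceleration.2.2 s hs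
    simp only [hA]
    rw [← hM.restrict, ← hM.restrict, ← map_sub, e1, e2, add_sub_add_left_eq_sub,
      intervalIntegral_sub_Icc ha hs ht]
    exact ((M : StrongDual ℝ U →L[ℝ] StrongDual ℝ U).intervalIntegral_comp_comm
      (ha.sub_Icc hs ht)).symm
  have hpA : ∀ t y, A t y = ⟪MW (w t), e.UW y⟫ := fun t y => rfl
  have hincr : ∀ s t, A t (x - u t) - A s (x - u s)
      = (A t - A s) (x - u t) - ⟪MW (w s), e.UW (u t) - e.UW (u s)⟫ := by
    intro s t
    rw [← map_sub, ← hpA, _root_.sub_apply, map_sub (A t), map_sub (A s), map_sub (A s) (u t),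
      map_sub (A s)]
    ring
  have hv := h.integrable_v hT
  constructor
  · refine ⟨fun r => (‖x‖ + Cu) * ‖M (a r)‖ + ‖MW‖ * Cw * (‖e.VW‖ * ‖v r‖),
      (hMa.norm.const_mul _).add ((hv.norm.const_mul _).const_mul _),
      fun t _ => by positivity, fun s hs t ht => ?_⟩
    show ‖A t (x - u t) - A s (x - u s)‖ ≤ _
    rw [hincr, intervalIntegral.integral_add ((hMa.norm.sub_Icc hs ht).const_mul _)
      (((hv.norm.sub_Icc hs ht).const_mul _).const_mul _), intervalIntegral.integral_const_mul,
      intervalIntegral.integral_const_mul, intervalIntegral.integral_const_mul]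
    have b1 : ‖(A t - A s) (x - u t)‖ ≤ (‖x‖ + Cu) * |∫ r in s..t, ‖M (a r)‖| := by
      refine ((A t - A s).le_opNorm _).trans ?_
      rw [mul_comm, hAsub s hs t ht]
      gcongr
      · exact (norm_sub_le _ _).trans (by linarith [hCu t ht])
      · exact intervalIntegral.norm_integral_le_abs_integral_norm
    have b2 : ‖⟪MW (w s), e.UW (u t) - e.UW (u s)⟫‖
        ≤ ‖MW‖ * Cw * (‖e.VW‖ * |∫ r in s..t, ‖v r‖|) := by
      refine (norm_inner_le_norm _ _).trans ?_
      have b3 : e.UW (u t) - e.UW (u s) = e.VW (∫ r in s..t, v r) := by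
        rw [← h.sub_eq_integral hs ht, map_sub]
        rfl
      rw [b3]
      gcongr
      · exact (MW.le_opNorm _).trans (by gcongr; exact hCw s hs)
      · refine (e.VW.le_opNorm _).trans ?_
        gcongr
        exact intervalIntegral.norm_integral_le_abs_integral_norm
    refine (norm_sub_le _ _).trans ((add_le_add b1 b2).trans ?_)
    rcases le_total s t with hst | hst
    · have c1 := intervalIntegral.integral_nonneg hst (fun r _ => norm_nonneg (M (a r))) (μ := volume)
      have c2 := intervalIntegral.integral_nonneg hst (fun r _ => norm_nonneg (v r)) (μ := volume)
      rw [abs_of_nonneg c1, abs_of_nonneg c2]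
      exact le_abs_self _
    · have c1 := intervalIntegral.integral_nonneg hst (fun r _ => norm_nonneg (M (a r))) (μ := volume)
      have c2 := intervalIntegral.integral_nonneg hst (fun r _ => norm_nonneg (v r)) (μ := volume)
      rw [intervalIntegral.integral_symm t s, intervalIntegral.integral_symm t s, abs_neg, abs_neg,
        abs_of_nonneg c1, abs_of_nonneg c2]
      refine le_trans (le_of_eq ?_) (neg_le_abs _)
      ring
  · have hleb : ∀ᵐ r ∂(volume.restrict (Icc 0 T)),
        HasDerivAt (fun x => ∫ t in (0 : ℝ)..x, M (a t)) (M (a r)) r := by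
      rw [ae_restrict_iff' measurableSet_Icc]
      have := hMa.ae_hasDerivAt_integral
      rw [uIcc_of_le hT] at this
      filter_upwards [this] with r hr hrm using hr hrm 0 H.zero_mem
    have hint : ∀ᵐ r ∂(volume.restrict (Icc 0 T)), r ∈ Ioo 0 T :=
      ae_Icc_iff_Ioo.2 (Eventually.of_forall fun r hr => hr)
    filter_upwards [hleb, hint] with t ht htI
    have htI' : t ∈ Icc (0 : ℝ) T := ⟨htI.1.le, htI.2.le⟩
    have hnb : Icc (0 : ℝ) T ∈ 𝓝 t := Icc_mem_nhds htI.1 htI.2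
    refine HasDerivAt.deriv ?_
    rw [hasDerivAt_iff_tendsto_slope]
    have hev : ∀ᶠ s in 𝓝[≠] t, s ∈ Icc (0 : ℝ) T := nhdsWithin_le_nhds hnb
    have hu : Tendsto (fun s => M (a t) (x - u s)) (𝓝[≠] t) (𝓝 (M (a t) (x - u t))) := by
      have h1 : ContinuousAt (fun s => M (a t) (u s)) t := (h.memCw.2 (M (a t)) t htI').continuousAt hnb
      simp only [map_sub]
      exact (tendsto_const_nhds.sub h1.tendsto).mono_left nhdsWithin_le_nhds
    have hzero : Tendsto (fun s => (slope (fun x => ∫ t in (0 : ℝ)..x, M (a t)) t s - M (a t))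
        (x - u s)) (𝓝[≠] t) (𝓝 0) := by
      have h1 := tendsto_iff_norm_sub_tendsto_zero.1 (hasDerivAt_iff_tendsto_slope.1 ht)
      have h2 := h1.mul_const (‖x‖ + Cu)
      rw [zero_mul] at h2
      refine squeeze_zero_norm' ?_ h2
      filter_upwards [hev] with s hs
      refine (ContinuousLinearMap.le_opNorm _ _).trans ?_
      gcongr
      exact (norm_sub_le _ _).trans (by linarith [hCu s hs])
    have hw : HasDerivAt (fun s => innerSL ℝ (MW (w t)) (e.UW (u s))) (innerSL ℝ (MW (w t)) (w t)) t :=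
      (h.memC1w.2.2 (innerSL ℝ (MW (w t))) t htI').hasDerivAt hnb
    have hw' := hasDerivAt_iff_tendsto_slope.1 hw
    have hsum := (hzero.add hu).sub hw'
    rw [zero_add] at hsum
    refine hsum.congr' ?_
    filter_upwards [hev] with s hs
    rw [_root_.sub_apply, sub_add_cancel, slope_def_module, slope_def_module, slope_def_module,
      intervalIntegral_sub_Icc hMa htI' hs, ← hAsub t htI' s hs, _root_.smul_apply, smul_eq_mul,
      smul_eq_mul, smul_eq_mul, ← mul_sub, innerSL_apply_apply, innerSL_apply_apply,
      ← inner_sub_right, ← hincr]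
    rfl

/-- The integrated stability inequality with its error terms. -/
lemma integral_energy_le [CompleteSpace V] (H : IsRateIndependentSystem e R T E D i)
    (hM : IsMassOperator e M MW)
    (h : IsDynamicData e M MW Vis R T E D ε d u v w a ξ η Q N) {x : U} (hx : x ∈ D)
    {Y P₁ P₂ : ℝ} (hY : ∀ t ∈ Icc (0 : ℝ) T, ‖x - u t‖ ≤ Y)
    (hP₁ : ∀ t ∈ Icc (0 : ℝ) T, ε * ‖w t‖ ≤ P₁)
    (hP₂ : ε * ∫ r in (0 : ℝ)..T, ‖v r‖ ^ 2 ≤ P₂) {s t : ℝ} (hs : s ∈ Icc (0 : ℝ) T)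
    (ht : t ∈ Icc (0 : ℝ) T) (hst : s ≤ t) :
    ∫ r in s..t, (E r (u r)).toReal ≤
      (∫ r in s..t, ((E r x).toReal + R (e.UZ (x - u r))))
        + (2 * ε * (‖MW‖ * P₁ * (‖e.UW‖ * Y)) + ε * (‖MW‖ * ‖e.VW‖ ^ 2 * P₂)
          + √ε * (‖Vis‖ * (‖e.UV‖ * Y) * (T + P₂) / 2)) := by
  have hT := H.pos.le
  have hε := h.pos
  obtain ⟨hAC, hder⟩ := h.momentum H hM x
  set p : ℝ → ℝ := fun t => ⟪MW (w t), e.UW (x - u t)⟫ with hp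
  have hY0 : 0 ≤ Y := (norm_nonneg _).trans (hY 0 H.zero_mem)
  have hP10 : 0 ≤ P₁ := le_trans (by positivity) (hP₁ 0 H.zero_mem)
  have hvsq := h.integrable_v_sq hT
  set c₁ := ε ^ 2 * (‖MW‖ * ‖e.VW‖ ^ 2) + ε * √ε * (‖Vis‖ * (‖e.UV‖ * Y)) / 2 with hc₁
  set c₂ := √ε * (‖Vis‖ * (‖e.UV‖ * Y)) / 2 with hc₂
  have hc₁0 : 0 ≤ c₁ := by positivity
  have hc₂0 : 0 ≤ c₂ := by positivity
  have hpt : ∀ᵐ r ∂(volume.restrict (Icc 0 T)), (E r (u r)).toReal ≤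
      ((E r x).toReal + R (e.UZ (x - u r))) + (ε ^ 2 * deriv p r + (c₁ * ‖v r‖ ^ 2 + c₂)) := by
    filter_upwards [h.equation, h.velocity, hder, ae_restrict_mem measurableSet_Icc]
      with r ⟨h1, h2, h3⟩ h4 h5 hr
    have h6 := ((H.mem_energySubdiff_iff hr).1 h2).2 x hx
    have h7 := H.diss.le_of_mem_dissSubdiff h1 (e.UZ (x - u r))
    have h8 : ε ^ 2 * M (a r) (x - u r) + ε * Vis (v r) (e.UV (x - u r)) + η r (e.UZ (x - u r))
        + ξ r (x - u r) = 0 := by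
      have := congrArg (fun f => f (x - u r)) h3
      simpa [Embeddings.VdualU, Embeddings.ZdualU] using this
    have h9 : ⟪MW (w r), w r⟫ ≤ ‖MW‖ * ‖e.VW‖ ^ 2 * ‖v r‖ ^ 2 := by
      rw [← h4]
      refine (real_inner_le_norm _ _).trans ?_
      have e1 := MW.le_opNorm (e.VW (v r))
      have e2 := e.VW.le_opNorm (v r)
      calc ‖MW (e.VW (v r))‖ * ‖e.VW (v r)‖ ≤ (‖MW‖ * (‖e.VW‖ * ‖v r‖)) * (‖e.VW‖ * ‖v r‖) := by
            gcongr
            exact e1.trans (by gcongr)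
        _ = _ := by ring
    have h10 : Vis (v r) (e.UV (x - u r)) ≤ ‖Vis‖ * (‖e.UV‖ * Y) * ‖v r‖ := by
      refine (le_abs_self _).trans (((Vis (v r)).le_opNorm _).trans ?_)
      calc ‖Vis (v r)‖ * ‖e.UV (x - u r)‖ ≤ (‖Vis‖ * ‖v r‖) * (‖e.UV‖ * Y) := by
            gcongr
            · exact Vis.le_opNorm _
            · exact (e.UV.le_opNorm _).trans (by gcongr; exact hY r hr)
        _ = _ := by ring
    have hsq : √ε * √ε = ε := Real.mul_self_sqrt hε.le
    have h11 : ε * ‖v r‖ ≤ (√ε + ε * √ε * ‖v r‖ ^ 2) / 2 := by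
      have h12 : 0 ≤ √ε * (√ε * ‖v r‖ - 1) ^ 2 := by positivity
      have h13 : √ε * (√ε * ‖v r‖ - 1) ^ 2 = (√ε * √ε) * √ε * ‖v r‖ ^ 2 - 2 * (√ε * √ε) * ‖v r‖ + √ε := by
        ring
      rw [h13, hsq] at h12
      linarith
    have h14 : ε * Vis (v r) (e.UV (x - u r)) ≤
        ‖Vis‖ * (‖e.UV‖ * Y) * ((√ε + ε * √ε * ‖v r‖ ^ 2) / 2) := by
      calc ε * Vis (v r) (e.UV (x - u r)) ≤ ε * (‖Vis‖ * (‖e.UV‖ * Y) * ‖v r‖) := by gcongr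
        _ = ‖Vis‖ * (‖e.UV‖ * Y) * (ε * ‖v r‖) := by ring
        _ ≤ _ := by gcongr
    have h15 : ε ^ 2 * ⟪MW (w r), w r⟫ ≤ ε ^ 2 * (‖MW‖ * ‖e.VW‖ ^ 2 * ‖v r‖ ^ 2) := by gcongr
    rw [h5, hc₁, hc₂, mul_sub]
    have h16 : (ε ^ 2 * (‖MW‖ * ‖e.VW‖ ^ 2) + ε * √ε * (‖Vis‖ * (‖e.UV‖ * Y)) / 2) * ‖v r‖ ^ 2
        + √ε * (‖Vis‖ * (‖e.UV‖ * Y)) / 2 = ε ^ 2 * (‖MW‖ * ‖e.VW‖ ^ 2 * ‖v r‖ ^ 2)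
        + ‖Vis‖ * (‖e.UV‖ * Y) * ((√ε + ε * √ε * ‖v r‖ ^ 2) / 2) := by ring
    rw [h16]
    linarith
  have hEi : IntervalIntegrable (fun r => (E r (u r)).toReal) volume 0 T :=
    (integrableOn_Icc_iff hT).2 (h.energy_bdd.integrable le_top)
  have hxi : IntervalIntegrable (fun r => (E r x).toReal + R (e.UZ (x - u r))) volume 0 T := by
    refine ContinuousOn.intervalIntegrable ?_
    rw [uIcc_of_le hT]
    refine ((H.control.1 x hx).continuousOn hT).add (H.diss.continuous.comp_continuousOn ?_)
    have h1 := e.VZ.continuous.comp_continuousOn (h.continuousOn_UV hT)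
    simp only [map_sub]
    exact continuousOn_const.sub h1
  have hdi := hAC.intervalIntegrable_deriv hs ht
  have hmono := intervalIntegral.integral_mono_ae_restrict hst (hEi.sub_Icc hs ht)
    ((hxi.sub_Icc hs ht).add ((hdi.const_mul (ε ^ 2)).add
      (((hvsq.sub_Icc hs ht).const_mul c₁).add (intervalIntegrable_const (c := c₂)))))
    (ae_mono (Measure.restrict_mono_set _ (Icc_subset_Icc hs.1 ht.2)) hpt)
  refine hmono.trans ?_
  rw [intervalIntegral.integral_add (hxi.sub_Icc hs ht) ((hdi.const_mul (ε ^ 2)).add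
      (((hvsq.sub_Icc hs ht).const_mul c₁).add (intervalIntegrable_const (c := c₂)))),
    intervalIntegral.integral_add (hdi.const_mul (ε ^ 2))
      (((hvsq.sub_Icc hs ht).const_mul c₁).add (intervalIntegrable_const (c := c₂))),
    intervalIntegral.integral_add ((hvsq.sub_Icc hs ht).const_mul c₁)
      (intervalIntegrable_const (c := c₂)),
    intervalIntegral.integral_const_mul, intervalIntegral.integral_const_mul,
    hAC.integral_deriv hs ht, intervalIntegral.integral_const, smul_eq_mul]
  have hpb : ∀ r ∈ Icc (0 : ℝ) T, ε * |p r| ≤ ‖MW‖ * P₁ * (‖e.UW‖ * Y) := by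
    intro r hr
    have e1 : |p r| ≤ (‖MW‖ * ‖w r‖) * (‖e.UW‖ * Y) := by
      refine (abs_real_inner_le_norm _ _).trans ?_
      gcongr
      · exact MW.le_opNorm _
      · exact (e.UW.le_opNorm _).trans (by gcongr; exact hY r hr)
    calc ε * |p r| ≤ ε * ((‖MW‖ * ‖w r‖) * (‖e.UW‖ * Y)) := by gcongr
      _ = ‖MW‖ * (ε * ‖w r‖) * (‖e.UW‖ * Y) := by ring
      _ ≤ _ := by gcongr; exact hP₁ r hr
  have hpp : ε ^ 2 * (p t - p s) ≤ 2 * ε * (‖MW‖ * P₁ * (‖e.UW‖ * Y)) := by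
    have e1 : p t - p s ≤ |p t| + |p s| := by linarith [le_abs_self (p t), neg_abs_le (p s)]
    calc ε ^ 2 * (p t - p s) ≤ ε ^ 2 * (|p t| + |p s|) := by gcongr
      _ = ε * (ε * |p t| + ε * |p s|) := by ring
      _ ≤ ε * (‖MW‖ * P₁ * (‖e.UW‖ * Y) + ‖MW‖ * P₁ * (‖e.UW‖ * Y)) := by
          exact mul_le_mul_of_nonneg_left (add_le_add (hpb t ht) (hpb s hs)) hε.le
      _ = _ := by ring
  have hvle : ε * ∫ r in s..t, ‖v r‖ ^ 2 ≤ P₂ := by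
    refine le_trans ?_ hP₂
    gcongr
    exact intervalIntegral.integral_mono_interval hs.1 hst ht.2
      (Eventually.of_forall fun r => by positivity) hvsq
  have hc1v : c₁ * ∫ r in s..t, ‖v r‖ ^ 2 ≤
      ε * (‖MW‖ * ‖e.VW‖ ^ 2 * P₂) + √ε * (‖Vis‖ * (‖e.UV‖ * Y)) / 2 * P₂ := by
    have e1 : c₁ * ∫ r in s..t, ‖v r‖ ^ 2 = (ε * (‖MW‖ * ‖e.VW‖ ^ 2)
        + √ε * (‖Vis‖ * (‖e.UV‖ * Y)) / 2) * (ε * ∫ r in s..t, ‖v r‖ ^ 2) := by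
      rw [hc₁]; ring
    rw [e1]
    refine (mul_le_mul_of_nonneg_left hvle (by positivity)).trans (le_of_eq (by ring))
  have hc2t : (t - s) * c₂ ≤ T * c₂ := by
    gcongr
    linarith [hs.1, ht.2]
  rw [hc₂] at hc2t ⊢
  linarith

end IsDynamicData

end Dynamic

lemma ae_le_of_intervalIntegral_le {T : ℝ} {f g : ℝ → ℝ} (hT : 0 < T)
    (hf : IntervalIntegrable f volume 0 T) (hg : IntervalIntegrable g volume 0 T)
    (h : ∀ s t, 0 ≤ s → s ≤ t → t ≤ T → ∫ r in s..t, f r ≤ ∫ r in s..t, g r) :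
    ∀ᵐ t ∂(volume.restrict (Icc 0 T)), f t ≤ g t := by
  rw [ae_Icc_iff_Ioo]
  filter_upwards [hf.ae_hasDerivAt_integral, hg.ae_hasDerivAt_integral] with t h1 h2 ht
  have h0 : (0 : ℝ) ∈ uIcc 0 T := left_mem_uIcc
  have htI : t ∈ uIcc 0 T := by rw [uIcc_of_le hT.le]; exact ⟨ht.1.le, ht.2.le⟩
  have h3 := ((h2 htI 0 h0).sub (h1 htI 0 h0)).tendsto_slope.mono_left
    (nhdsWithin_mono _ (fun x (hx : t < x) => ne_of_gt hx) : 𝓝[>] t ≤ _)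
  suffices 0 ≤ g t - f t by linarith
  refine ge_of_tendsto h3 ?_
  filter_upwards [Ioo_mem_nhdsGT ht.2] with s hs
  have h4 := h t s ht.1.le hs.1.le hs.2.le
  have hsI : s ∈ Icc (0 : ℝ) T := ⟨(ht.1.trans hs.1).le, hs.2.le⟩
  have htI' : t ∈ Icc (0 : ℝ) T := ⟨ht.1.le, ht.2.le⟩
  have h5 := intervalIntegral_sub_Icc hf htI' hsI
  have h6 := intervalIntegral_sub_Icc hg htI' hsI
  rw [slope_def_field]
  refine div_nonneg ?_ (by linarith [hs.1])
  simp only [Pi.sub_apply]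
  linarith

section Approximation

variable {U V W Z X : Type*}
  [NormedAddCommGroup U] [NormedSpace ℝ U] [NormedAddCommGroup V] [InnerProductSpace ℝ V]
  [NormedAddCommGroup W] [InnerProductSpace ℝ W] [NormedAddCommGroup Z] [NormedSpace ℝ Z]
  [NormedAddCommGroup X] [NormedSpace ℝ X]
  {e : Embeddings U V W Z} {R : Z → ℝ} {T : ℝ} {E : ℝ → U → ℝ≥0∞} {D : Set U} {i : U →L[ℝ] X}

namespace IsRateIndependentSystem

/-- Energy and power are uniformly controlled on sublevels. -/
lemma exists_bound (H : IsRateIndependentSystem e R T E D i) {K : ℝ} (hK : 0 < K) :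
    ∃ C > 0, ∃ B : ℝ → ℝ, IntervalIntegrable B volume 0 T ∧
      (∀ x, E 0 x ≤ ENNReal.ofReal K → ∀ t ∈ Icc (0 : ℝ) T, (E t x).toReal ≤ C) ∧
      ∀ᵐ t ∂(volume.restrict (Icc 0 T)), ∀ x, E 0 x ≤ ENNReal.ofReal K → |power E t x| ≤ B t := by
  obtain ⟨b, hb, hb0, hbp, hbE⟩ := H.exists_control
  have key : ∀ x, E 0 x ≤ ENNReal.ofReal K → ∀ t ∈ Icc (0 : ℝ) T,
      (E t x).toReal + 1 ≤ Real.exp (∫ r in (0 : ℝ)..T, b r) * (K + 1) := by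
    intro x hx t ht
    have hxD := H.mem_of_le H.zero_mem hx
    refine (hbE x hxD 0 H.zero_mem t ht).trans ?_
    rw [abs_of_nonneg (intervalIntegral.integral_nonneg ht.1 fun r _ => hb0 r)]
    gcongr
    · exact intervalIntegral.integral_mono_interval le_rfl ht.1 ht.2
        (Eventually.of_forall hb0) hb
    · exact (H.toReal_le H.zero_mem hxD hK.le).1 hx
  refine ⟨Real.exp (∫ r in (0 : ℝ)..T, b r) * (K + 1), by positivity,
    fun t => b t * (Real.exp (∫ r in (0 : ℝ)..T, b r) * (K + 1)), hb.mul_const _,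
    fun x hx t ht => by linarith [key x hx t ht], ?_⟩
  filter_upwards [hbp, ae_restrict_mem measurableSet_Icc] with t h1 ht x hx
  exact (h1 x (H.mem_of_le H.zero_mem hx)).trans (mul_le_mul_of_nonneg_left (key x hx t ht) (hb0 t))

/-- Convergence in energy at the initial time propagates to later times. -/
lemma energy_tendsto (H : IsRateIndependentSystem e R T E D i) {K : ℝ} (hK : 0 < K) {x : ℕ → U}
    {x₀ : U} (hx : ∀ n, E 0 (x n) ≤ ENNReal.ofReal K) (hx₀ : E 0 x₀ ≤ ENNReal.ofReal K)
    (hlim : Tendsto (fun n => e.UZ (x n)) atTop (𝓝 (e.UZ x₀)))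
    (h0 : Tendsto (fun n => (E 0 (x n)).toReal) atTop (𝓝 (E 0 x₀).toReal)) {t : ℝ}
    (ht : t ∈ Icc (0 : ℝ) T) :
    Tendsto (fun n => (E t (x n)).toReal) atTop (𝓝 (E t x₀).toReal) := by
  obtain ⟨C, -, B, hB, -, hpB⟩ := H.exists_bound hK
  have h1 : Tendsto (fun n => ∫ r in (0 : ℝ)..t, power E r (x n)) atTop
      (𝓝 (∫ r in (0 : ℝ)..t, power E r x₀)) := by
    refine intervalIntegral.tendsto_integral_filter_of_dominated_convergence B
      (Eventually.of_forall fun n => (H.intervalIntegrable_power (H.mem_of_le H.zero_mem (hx n))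
        H.zero_mem ht).aestronglyMeasurable_restrict_uIoc) (Eventually.of_forall fun n => ?_)
      (hB.sub_Icc H.zero_mem ht) ?_
    · exact ae_imp_of_ae_Icc (hpB.mono fun r hr => hr _ (hx n)) H.zero_mem ht
    · exact ae_imp_of_ae_Icc ((H.ae_power_tendsto hK).mono fun r hr => hr _ _ hx hx₀ hlim)
        H.zero_mem ht
  have h2 := h0.add h1
  have h3 : ∀ y, E 0 y ≤ ENNReal.ofReal K →
      (E 0 y).toReal + ∫ r in (0 : ℝ)..t, power E r y = (E t y).toReal := fun y hy => by
    rw [H.integral_power (H.mem_of_le H.zero_mem hy) H.zero_mem ht]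
    ring
  rw [h3 _ hx₀] at h2
  exact h2.congr fun n => h3 _ (hx n)

/-- Stability need only be tested on a countable set which is dense in energy. -/
lemma exists_countable_test [TopologicalSpace.SeparableSpace U]
    (H : IsRateIndependentSystem e R T E D i) :
    ∃ y : ℕ → U, (∀ k, y k ∈ D) ∧ ∀ t ∈ Icc (0 : ℝ) T, ∀ u ∈ D,
      (∀ k, (E t u).toReal ≤ (E t (y k)).toReal + R (e.UZ (y k - u))) →
        GloballyStable e R E t u := by
  have : SecondCountableTopology U := UniformSpace.secondCountable_of_separable U
  set G : Set (U × ℝ) := (fun x => (x, (E 0 x).toReal)) '' D with hG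
  have : Nonempty G := (H.domain.1.image _).to_subtype
  obtain ⟨p, hp⟩ := TopologicalSpace.exists_dense_seq G
  have hpG : ∀ k, (p k : U × ℝ).1 ∈ D ∧ (p k : U × ℝ).2 = (E 0 (p k : U × ℝ).1).toReal := by
    intro k
    obtain ⟨x, hx, he⟩ := (p k).2
    rw [← he]
    exact ⟨hx, rfl⟩
  refine ⟨fun k => (p k : U × ℝ).1, fun k => (hpG k).1, fun t ht u hu h => ?_⟩
  rw [H.stable_iff ht hu]
  intro x hx
  have hq : (⟨(x, (E 0 x).toReal), x, hx, rfl⟩ : G) ∈ closure (range p) := hp _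
  obtain ⟨q, hq1, hq2⟩ := mem_closure_iff_seq_limit.1 hq
  choose k hk using hq1
  have h1 : Tendsto (fun n => (p (k n) : U × ℝ)) atTop (𝓝 (x, (E 0 x).toReal)) := by
    have := (continuous_subtype_val.tendsto _).comp hq2
    simpa [Function.comp_def, hk] using this
  have hy : Tendsto (fun n => (p (k n) : U × ℝ).1) atTop (𝓝 x) := (continuous_fst.tendsto _).comp h1
  have hy0 : Tendsto (fun n => (E 0 (p (k n) : U × ℝ).1).toReal) atTop (𝓝 (E 0 x).toReal) :=
    ((continuous_snd.tendsto _).comp h1).congr fun n => (hpG _).2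
  obtain ⟨K, hK⟩ := hy0.bddAbove_range
  have hKy : ∀ n, (E 0 (p (k n) : U × ℝ).1).toReal ≤ K := fun n => hK ⟨n, rfl⟩
  set K' := max (max K (E 0 x).toReal) 1 with hK'
  have hpos : 0 < K' := lt_of_lt_of_le one_pos (le_max_right _ _)
  have h2 := H.energy_tendsto hpos (x := fun n => (p (k n) : U × ℝ).1) (x₀ := x)
    (fun n => (H.toReal_le H.zero_mem (hpG _).1 hpos.le).2
      ((hKy n).trans ((le_max_left _ _).trans (le_max_left _ _))))
    ((H.toReal_le H.zero_mem hx hpos.le).2 ((le_max_right _ _).trans (le_max_left _ _)))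
    ((e.UZ.continuous.tendsto _).comp hy) hy0 ht
  have h3 : Tendsto (fun n => R (e.UZ ((p (k n) : U × ℝ).1 - u))) atTop (𝓝 (R (e.UZ (x - u)))) :=
    ((H.diss.continuous.comp e.UZ.continuous).tendsto _).comp (hy.sub_const u)
  exact ge_of_tendsto' (h2.add h3) fun n => h (k n)

end IsRateIndependentSystem

/-- Sequences which satisfy an approximate energy inequality and an approximate stability
condition; `q n` is a dissipation rate of `u n`. -/
structure IsApproximatingSequence (e : Embeddings U V W Z) (R : Z → ℝ) (T : ℝ) (E : ℝ → U → ℝ≥0∞)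
    (D : Set U) (K : ℝ) (u₀ : U) (u : ℕ → ℝ → U) (q : ℕ → ℝ → ℝ) : Prop where
  pos : 0 < K
  sublevel : ∀ n, ∀ t ∈ Icc (0 : ℝ) T, E 0 (u n t) ≤ ENNReal.ofReal K
  rate_nonneg : ∀ n t, 0 ≤ q n t
  rate_integrable : ∀ n, IntervalIntegrable (q n) volume 0 T
  rate_le : ∀ n, ∫ r in (0 : ℝ)..T, q n r ≤ K
  diss_le : ∀ n s t, 0 ≤ s → s ≤ t → t ≤ T → R (e.UZ (u n t - u n s)) ≤ ∫ r in s..t, q n r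
  integrable : ∀ n, IntervalIntegrable (fun r => power E r (u n r)) volume 0 T
  measurable : ∀ n, AEStronglyMeasurable (fun r => (E r (u n r)).toReal) (volume.restrict (Icc 0 T))
  initial : WeakTendsto (fun n => u n 0) u₀
  stable_zero : GloballyStable e R E 0 u₀
  energy_le : ∃ d : ℕ → ℝ, Tendsto d atTop (𝓝 (E 0 u₀).toReal) ∧ ∀ n, ∀ t ∈ Icc (0 : ℝ) T,
    (E t (u n t)).toReal + ∫ r in (0 : ℝ)..t, q n r ≤ d n + ∫ r in (0 : ℝ)..t, power E r (u n r)
  stable : ∀ x ∈ D, ∃ κ : ℕ → ℝ, Tendsto κ atTop (𝓝 0) ∧ ∀ n s t, 0 ≤ s → s ≤ t → t ≤ T →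
    ∫ r in s..t, (E r (u n r)).toReal
      ≤ (∫ r in s..t, ((E r x).toReal + R (e.UZ (x - u n r)))) + κ n

namespace IsApproximatingSequence

variable {K : ℝ} {u₀ : U} {u : ℕ → ℝ → U} {q : ℕ → ℝ → ℝ}

lemma comp (h : IsApproximatingSequence e R T E D K u₀ u q) {φ : ℕ → ℕ} (hφ : StrictMono φ) :
    IsApproximatingSequence e R T E D K u₀ (fun n => u (φ n)) (fun n => q (φ n)) where
  pos := h.pos
  sublevel n := h.sublevel _
  rate_nonneg n := h.rate_nonneg _
  rate_integrable n := h.rate_integrable _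
  rate_le n := h.rate_le _
  diss_le n := h.diss_le _
  integrable n := h.integrable _
  measurable n := h.measurable _
  initial L := (h.initial L).comp hφ.tendsto_atTop
  stable_zero := h.stable_zero
  energy_le := by
    obtain ⟨d, hd, hle⟩ := h.energy_le
    exact ⟨_, hd.comp hφ.tendsto_atTop, fun n => hle _⟩
  stable x hx := by
    obtain ⟨κ, hκ, hle⟩ := h.stable x hx
    exact ⟨_, hκ.comp hφ.tendsto_atTop, fun n => hle _⟩

/-- Helly's selection principle. -/
lemma exists_limit (H : IsRateIndependentSystem e R T E D i)
    (h : IsApproximatingSequence e R T E D K u₀ u q) :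
    ∃ φ : ℕ → ℕ, StrictMono φ ∧ ∃ (v : ℝ → ℝ) (ul : ℝ → U), ∀ t ∈ Icc (0 : ℝ) T,
      Tendsto (fun n => e.UZ (u (φ n) t)) atTop (𝓝 (e.UZ (ul t))) ∧
      Tendsto (fun n => ∫ r in (0 : ℝ)..t, q (φ n) r) atTop (𝓝 (v t)) := by
  obtain ⟨C, hC0, hC⟩ := H.exists_norm_le K
  obtain ⟨ρ, hρ, hR⟩ := H.diss.exists_lower
  set p : ℝ → ℝ := fun t => max 0 (min t T) with hp
  have hpI : ∀ t, p t ∈ Icc (0 : ℝ) T := fun t =>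
    ⟨le_max_left _ _, max_le H.pos.le (min_le_right _ _)⟩
  have hpm : Monotone p := fun s t hst => max_le_max le_rfl (min_le_min hst le_rfl)
  have hpe : ∀ t ∈ Icc (0 : ℝ) T, p t = t := fun t ht => by
    simp only [hp, min_eq_left ht.2, max_eq_right ht.1]
  set Q : ℕ → ℝ → ℝ := fun n t => ∫ r in (0 : ℝ)..p t, q n r with hQ
  have hsub : ∀ n s t, Q n t - Q n s = ∫ r in p s..p t, q n r := fun n s t =>
    intervalIntegral_sub_Icc (h.rate_integrable n) (hpI s) (hpI t)
  have hQm : ∀ n, Monotone (Q n) := fun n s t hst => by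
    have h1 := intervalIntegral.integral_nonneg (μ := volume) (hpm hst)
      (fun r _ => h.rate_nonneg n r)
    rw [← hsub] at h1
    linarith
  have hQI : ∀ n t, Q n t ∈ Icc 0 K := fun n t =>
    ⟨intervalIntegral.integral_nonneg (hpI t).1 fun r _ => h.rate_nonneg n r,
      (intervalIntegral.integral_mono_interval le_rfl (hpI t).1 (hpI t).2
        (Eventually.of_forall (h.rate_nonneg n)) (h.rate_integrable n)).trans (h.rate_le n)⟩
  have hK1 : IsCompact (closure (e.UZ '' Metric.closedBall 0 C)) := by
    have h1 : IsCompactOperator e.UZ := e.compact_UW.continuous_comp e.WZ.continuous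
    exact h1.isCompact_closure_image_closedBall (f := (e.UZ : U →ₗ[ℝ] Z)) C
  obtain ⟨φ, hφ, l, hl⟩ := helly_selection (hK1.prod (isCompact_Icc (a := 0) (b := K)))
    (fun n t => (e.UZ (u n (p t)), Q n t))
    (fun n t => ⟨subset_closure ⟨_, mem_closedBall_zero_iff.2 (hC _ (h.sublevel n _ (hpI t))), rfl⟩,
      hQI n t⟩)
    (fun n t => (1 / ρ + 1) * Q n t)
    (fun n => (hQm n).const_mul (by positivity)) ((1 / ρ + 1) * K)
    (fun n t => ⟨mul_nonneg (by positivity) (hQI n t).1,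
      mul_le_mul_of_nonneg_left (hQI n t).2 (by positivity)⟩)
    (fun n s t hst => by
      have hd : 0 ≤ Q n t - Q n s := sub_nonneg.2 (hQm n hst)
      have h1 := (hR _).trans (h.diss_le n _ _ (hpI s).1 (hpm hst) (hpI t).2)
      rw [← hsub] at h1
      have h2 : ‖e.UZ (u n (p t) - u n (p s))‖ ≤ 1 / ρ * (Q n t - Q n s) := by
        rw [one_div_mul_eq_div, le_div_iff₀ hρ, mul_comm]
        exact h1
      rw [Prod.dist_eq, ← mul_sub]
      refine max_le ?_ ?_
      · rw [dist_comm, dist_eq_norm, ← map_sub]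
        linarith
      · rw [dist_comm, Real.dist_eq, abs_of_nonneg hd]
        have : 0 ≤ 1 / ρ * (Q n t - Q n s) := by positivity
        linarith)
  have hz : ∀ t ∈ Icc (0 : ℝ) T, ∃ x : U, e.UZ x = (l t).1 := by
    intro t ht
    have h1 : Tendsto (fun n => e.UZ (u (φ n) t)) atTop (𝓝 (l t).1) := by
      have := (continuous_fst.tendsto _).comp (hl t)
      simpa only [Function.comp_def, hpe t ht] using this
    obtain ⟨x, hx, -⟩ := exists_weak_limit_of_tendsto H.reflexive e.UZ e.injective_UZ
      (Eventually.of_forall fun n => hC _ (h.sublevel (φ n) t ht)) h1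
    exact ⟨x, hx⟩
  choose! ul hul using hz
  refine ⟨φ, hφ, fun t => (l t).2, ul, fun t ht => ⟨?_, ?_⟩⟩
  · rw [hul t ht]
    have := (continuous_fst.tendsto _).comp (hl t)
    simpa only [Function.comp_def, hpe t ht] using this
  · have := (continuous_snd.tendsto _).comp (hl t)
    simpa only [Function.comp_def, hQ, hpe t ht] using this

section Limit

variable {v : ℝ → ℝ} {ul : ℝ → U}

lemma weak_tendsto (H : IsRateIndependentSystem e R T E D i)
    (h : IsApproximatingSequence e R T E D K u₀ u q) {t : ℝ} (ht : t ∈ Icc (0 : ℝ) T)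
    (hu : Tendsto (fun n => e.UZ (u n t)) atTop (𝓝 (e.UZ (ul t)))) :
    WeakTendsto (fun n => u n t) (ul t) := by
  obtain ⟨C, hC0, hC⟩ := H.exists_norm_le K
  exact weak_tendsto_of_tendsto H.reflexive e.UZ e.injective_UZ
    (Eventually.of_forall fun n => hC _ (h.sublevel n t ht)) hu

lemma limit_zero (H : IsRateIndependentSystem e R T E D i)
    (h : IsApproximatingSequence e R T E D K u₀ u q)
    (hu : Tendsto (fun n => e.UZ (u n 0)) atTop (𝓝 (e.UZ (ul 0)))) : ul 0 = u₀ :=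
  (SeparatingDual.eq_iff_forall_dual_eq (R := ℝ)).2 fun L =>
    tendsto_nhds_unique (h.weak_tendsto H H.zero_mem hu L) (h.initial L)

lemma limit_sublevel (H : IsRateIndependentSystem e R T E D i)
    (h : IsApproximatingSequence e R T E D K u₀ u q) {t : ℝ} (ht : t ∈ Icc (0 : ℝ) T)
    (hu : Tendsto (fun n => e.UZ (u n t)) atTop (𝓝 (e.UZ (ul t)))) :
    E 0 (ul t) ≤ ENNReal.ofReal K :=
  H.le_of_weak H.zero_mem (h.weak_tendsto H ht hu)
    (Frequently.of_forall fun n => h.sublevel n t ht)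

lemma continuousOn_UZ (H : IsRateIndependentSystem e R T E D i)
    (h : IsApproximatingSequence e R T E D K u₀ u q) (n : ℕ) :
    ContinuousOn (fun t => e.UZ (u n t)) (Icc 0 T) := by
  obtain ⟨ρ, hρ, hR⟩ := H.diss.exists_lower
  refine MemAC.continuousOn H.pos.le ⟨fun r => 1 / ρ * q n r, (h.rate_integrable n).const_mul _,
    fun t _ => mul_nonneg (by positivity) (h.rate_nonneg n t), ?_⟩
  have key : ∀ s ∈ Icc (0 : ℝ) T, ∀ t ∈ Icc (0 : ℝ) T, s ≤ t →
      ‖e.UZ (u n t) - e.UZ (u n s)‖ ≤ |∫ r in s..t, 1 / ρ * q n r| := by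
    intro s hs t ht hst
    have h1 := (hR _).trans (h.diss_le n s t hs.1 hst ht.2)
    refine le_trans ?_ (le_abs_self _)
    rw [← map_sub, intervalIntegral.integral_const_mul, one_div_mul_eq_div, le_div_iff₀ hρ, mul_comm]
    exact h1
  intro s hs t ht
  rcases le_total s t with hst | hst
  · exact key s hs t ht hst
  · rw [norm_sub_rev, intervalIntegral.integral_symm, abs_neg]
    exact key t ht s hs hst

lemma tendsto_integral_power (H : IsRateIndependentSystem e R T E D i)
    (h : IsApproximatingSequence e R T E D K u₀ u q)
    (hu : ∀ t ∈ Icc (0 : ℝ) T, Tendsto (fun n => e.UZ (u n t)) atTop (𝓝 (e.UZ (ul t)))) :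
    IntervalIntegrable (fun r => power E r (ul r)) volume 0 T ∧ ∀ t ∈ Icc (0 : ℝ) T,
      Tendsto (fun n => ∫ r in (0 : ℝ)..t, power E r (u n r)) atTop
        (𝓝 (∫ r in (0 : ℝ)..t, power E r (ul r))) := by
  obtain ⟨C, -, B, hB, -, hpB⟩ := H.exists_bound h.pos
  have hlim : ∀ᵐ r ∂(volume.restrict (Icc 0 T)),
      Tendsto (fun n => power E r (u n r)) atTop (𝓝 (power E r (ul r))) := by
    filter_upwards [H.ae_power_tendsto h.pos, ae_restrict_mem measurableSet_Icc] with r h1 hr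
    exact h1 _ _ (fun n => h.sublevel n r hr) (h.limit_sublevel H hr (hu r hr)) (hu r hr)
  have hint := fun n => (integrableOn_Icc_iff H.pos.le).1 (h.integrable n)
  refine ⟨(integrableOn_Icc_iff H.pos.le).2 (Integrable.mono'
    ((integrableOn_Icc_iff H.pos.le).1 hB)
    (aestronglyMeasurable_of_tendsto_ae atTop (fun n => (hint n).1) hlim) ?_), fun t ht => ?_⟩
  · filter_upwards [hpB, ae_restrict_mem measurableSet_Icc] with r h1 hr
    exact h1 _ (h.limit_sublevel H hr (hu r hr))
  · refine intervalIntegral.tendsto_integral_filter_of_dominated_convergence B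
      (Eventually.of_forall fun n =>
        ((h.integrable n).sub_Icc H.zero_mem ht).aestronglyMeasurable_restrict_uIoc)
      (Eventually.of_forall fun n => ?_) (hB.sub_Icc H.zero_mem ht)
      (ae_imp_of_ae_Icc hlim H.zero_mem ht)
    refine ae_imp_of_ae_Icc ?_ H.zero_mem ht
    filter_upwards [hpB, ae_restrict_mem measurableSet_Icc] with r h1 hr
    exact h1 _ (h.sublevel n r hr)

end Limit

end IsApproximatingSequence

end Approximation

section Limit

variable {U V W Z X : Type*}
  [NormedAddCommGroup U] [NormedSpace ℝ U] [NormedAddCommGroup V] [InnerProductSpace ℝ V]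
  [NormedAddCommGroup W] [InnerProductSpace ℝ W] [NormedAddCommGroup Z] [NormedSpace ℝ Z]
  [NormedAddCommGroup X] [NormedSpace ℝ X]
  {e : Embeddings U V W Z} {R : Z → ℝ} {T : ℝ} {E : ℝ → U → ℝ≥0∞} {D : Set U} {i : U →L[ℝ] X}

namespace IsApproximatingSequence

variable {K : ℝ} {u₀ : U} {u : ℕ → ℝ → U} {q : ℕ → ℝ → ℝ} {v : ℝ → ℝ} {ul : ℝ → U}

lemma ae_le_of_integral_le (H : IsRateIndependentSystem e R T E D i)
    (h : IsApproximatingSequence e R T E D K u₀ u q)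
    (hu : ∀ t ∈ Icc (0 : ℝ) T, Tendsto (fun n => e.UZ (u n t)) atTop (𝓝 (e.UZ (ul t))))
    {x : U} (hx : x ∈ D) :
    ∀ᵐ t ∂(volume.restrict (Icc 0 T)),
      (E t (ul t)).toReal ≤ (E t x).toReal + R (e.UZ (x - ul t)) := by
  obtain ⟨κ, hκ, hle⟩ := h.stable x hx
  obtain ⟨C, hC0, -, -, hEC, -⟩ := H.exists_bound h.pos
  obtain ⟨Cu, hCu0, hCu⟩ := H.exists_norm_le K
  obtain ⟨ρ, hρ, hR⟩ := H.diss.exists_upper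
  set f : ℕ → ℝ → ℝ := fun n r => (E r (u n r)).toReal with hf
  set g : ℕ → ℝ → ℝ := fun n r => (E r x).toReal + R (e.UZ (x - u n r)) with hg
  set gl : ℝ → ℝ := fun r => (E r x).toReal + R (e.UZ (x - ul r)) with hgl
  have hfC : ∀ n, ∀ r ∈ Icc (0 : ℝ) T, f n r ≤ C := fun n r hr => hEC _ (h.sublevel n r hr) r hr
  have hEx : ContinuousOn (fun r => (E r x).toReal) (Icc 0 T) := (H.control.1 x hx).continuousOn H.pos.le
  have hgcont : ∀ n, ContinuousOn (g n) (Icc 0 T) := fun n =>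
    hEx.add (H.diss.continuous.comp_continuousOn (by
      simp only [map_sub]
      exact continuousOn_const.sub (h.continuousOn_UZ H n)))
  have hglim : ∀ r ∈ Icc (0 : ℝ) T, Tendsto (fun n => g n r) atTop (𝓝 (gl r)) := fun r hr => by
    refine Tendsto.const_add _ ((H.diss.continuous.tendsto _).comp ?_)
    simp only [map_sub]
    exact (hu r hr).const_sub _
  set B : ℝ → ℝ := fun r => (E r x).toReal + ρ * (‖e.UZ‖ * (‖x‖ + Cu)) with hB
  have hBint : IntervalIntegrable B volume 0 T :=
    ((hEx.add continuousOn_const).intervalIntegrable_of_Icc H.pos.le)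
  have hgB : ∀ y, ‖y‖ ≤ Cu → ∀ r, ‖(E r x).toReal + R (e.UZ (x - y))‖ ≤ B r := by
    intro y hy r
    rw [Real.norm_of_nonneg (add_nonneg ENNReal.toReal_nonneg (H.diss.nonneg _))]
    refine add_le_add_right ((hR _).trans ?_) _
    gcongr
    exact (e.UZ.le_opNorm _).trans (by gcongr; exact (norm_sub_le _ _).trans (by gcongr))
  have hgint : ∀ n, IntervalIntegrable (g n) volume 0 T := fun n =>
    (hgcont n).intervalIntegrable_of_Icc H.pos.le
  have hmemIcc : ∀ᵐ r ∂(volume.restrict (Icc 0 T)), r ∈ Icc (0 : ℝ) T :=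
    ae_restrict_mem measurableSet_Icc
  have hglint : IntervalIntegrable gl volume 0 T := by
    refine (integrableOn_Icc_iff H.pos.le).2 (Integrable.mono'
      ((integrableOn_Icc_iff H.pos.le).1 hBint)
      (aestronglyMeasurable_of_tendsto_ae atTop
        (fun n => ((integrableOn_Icc_iff H.pos.le).1 (hgint n)).1) (hmemIcc.mono hglim))
      (hmemIcc.mono fun r hr => hgB _ (hCu _ ?_) r))
    exact h.limit_sublevel H hr (hu r hr)
  have hfint : ∀ n, IntervalIntegrable (f n) volume 0 T := fun n => by
    refine (integrableOn_Icc_iff H.pos.le).2 (Integrable.mono' (integrable_const C)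
      (h.measurable n) (hmemIcc.mono fun r hr => ?_))
    rw [Real.norm_of_nonneg ENNReal.toReal_nonneg]
    exact hfC n r hr
  set F : ℝ → ℝ≥0∞ := fun r => liminf (fun n => ENNReal.ofReal (f n r)) atTop with hF
  have hFm : AEMeasurable F (volume.restrict (Icc 0 T)) := by
    have hm := fun n => (h.measurable n).aemeasurable.ennreal_ofReal
    refine ⟨_, Measurable.liminf fun n => (hm n).measurable_mk, ?_⟩
    filter_upwards [ae_all_iff.2 fun n => (hm n).ae_eq_mk] with r hr
    simp only [hF, hf, hr]
  have hFC : ∀ r ∈ Icc (0 : ℝ) T, F r ≤ ENNReal.ofReal C := fun r hr =>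
    liminf_le_of_frequently_le' (Frequently.of_forall fun n =>
      ENNReal.ofReal_le_ofReal (hfC n r hr))
  have hFint : IntervalIntegrable (fun r => (F r).toReal) volume 0 T := by
    refine (integrableOn_Icc_iff H.pos.le).2 (Integrable.mono' (integrable_const C)
      hFm.ennreal_toReal.aestronglyMeasurable (hmemIcc.mono fun r hr => ?_))
    rw [Real.norm_of_nonneg ENNReal.toReal_nonneg]
    exact ENNReal.toReal_le_of_le_ofReal hC0.le (hFC r hr)
  have hEF : ∀ r ∈ Icc (0 : ℝ) T, (E r (ul r)).toReal ≤ (F r).toReal := by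
    intro r hr
    refine ENNReal.toReal_mono ((hFC r hr).trans_lt ENNReal.ofReal_lt_top).ne ?_
    refine le_of_forall_gt fun c hc => ?_
    obtain ⟨c', hc1, hc2⟩ := exists_between hc
    obtain ⟨a, rfl⟩ : ∃ a : NNReal, (a : ℝ≥0∞) = c' := ⟨c'.toNNReal, ENNReal.coe_toNNReal (ne_top_of_lt hc2)⟩
    refine (H.le_of_weak hr (h.weak_tendsto H hr (hu r hr)) (c := a) ?_).trans_lt hc2
    refine (frequently_lt_of_liminf_lt (by isBoundedDefault) hc1).mono fun n hn => ?_
    have : E r (u n r) = ENNReal.ofReal (f n r) :=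
      (ENNReal.ofReal_toReal (H.ne_top hr (H.mem_of_le H.zero_mem (h.sublevel n r hr)))).symm
    rw [this]
    exact hn.le
  have key := ae_le_of_intervalIntegral_le H.pos hFint hglint (fun s t hs hst ht => by
    have hsI : s ∈ Icc (0 : ℝ) T := ⟨hs, hst.trans ht⟩
    have htI : t ∈ Icc (0 : ℝ) T := ⟨hs.trans hst, ht⟩
    have hsub : Ioc s t ⊆ Icc 0 T := fun r hr => ⟨hs.trans hr.1.le, hr.2.trans ht⟩
    have hres : volume.restrict (Ioc s t) ≤ volume.restrict (Icc (0 : ℝ) T) :=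
      Measure.restrict_mono_set _ hsub
    have hG : Tendsto (fun n => (∫ r in s..t, g n r) + κ n) atTop (𝓝 ((∫ r in s..t, gl r) + 0)) := by
      refine Tendsto.add ?_ hκ
      refine intervalIntegral.tendsto_integral_filter_of_dominated_convergence B
        (Eventually.of_forall fun n =>
          ((hgint n).sub_Icc hsI htI).aestronglyMeasurable_restrict_uIoc)
        (Eventually.of_forall fun n => ?_) (hBint.sub_Icc hsI htI) ?_
      · exact ae_imp_of_ae_Icc (hmemIcc.mono fun r hr => hgB _ (hCu _ (h.sublevel n r hr)) r) hsI htI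
      · exact ae_imp_of_ae_Icc (hmemIcc.mono hglim) hsI htI
    rw [add_zero] at hG
    have h1 : ∀ n, ∫⁻ r in Ioc s t, ENNReal.ofReal (f n r)
        ≤ ENNReal.ofReal ((∫ r in s..t, g n r) + κ n) := fun n => by
      rw [← ofReal_integral_eq_lintegral_ofReal
        ((intervalIntegrable_iff_integrableOn_Ioc_of_le hst).1 ((hfint n).sub_Icc hsI htI))
        (Eventually.of_forall fun r => ENNReal.toReal_nonneg), ← intervalIntegral.integral_of_le hst]
      exact ENNReal.ofReal_le_ofReal (hle n s t hs hst ht)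
    have h2 : ∫⁻ r in Ioc s t, F r ≤ ENNReal.ofReal (∫ r in s..t, gl r) := by
      refine (lintegral_liminf_le' fun n =>
        ((h.measurable n).mono_measure hres).aemeasurable.ennreal_ofReal).trans ?_
      refine (liminf_le_liminf (Eventually.of_forall h1)).trans (le_of_eq ?_)
      exact (ENNReal.tendsto_ofReal hG).liminf_eq
    rw [intervalIntegral.integral_of_le hst, integral_toReal (hFm.mono_measure hres)
      ((ae_restrict_mem measurableSet_Ioc).mono fun r hr =>
        (hFC r (hsub hr)).trans_lt ENNReal.ofReal_lt_top)]
    exact ENNReal.toReal_le_of_le_ofReal (intervalIntegral.integral_nonneg hst fun r _ =>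
      add_nonneg ENNReal.toReal_nonneg (H.diss.nonneg _)) h2)
  filter_upwards [key, hmemIcc] with r h1 hr using (hEF r hr).trans h1

lemma isLimitCurve [TopologicalSpace.SeparableSpace U] (H : IsRateIndependentSystem e R T E D i)
    (h : IsApproximatingSequence e R T E D K u₀ u q)
    (hu : ∀ t ∈ Icc (0 : ℝ) T, Tendsto (fun n => e.UZ (u n t)) atTop (𝓝 (e.UZ (ul t))))
    (hv : ∀ t ∈ Icc (0 : ℝ) T, Tendsto (fun n => ∫ r in (0 : ℝ)..t, q n r) atTop (𝓝 (v t))) :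
    IsLimitCurve e R T E K v ul := by
  have hzero := h.limit_zero H (hu 0 H.zero_mem)
  have hmem : ∀ t ∈ Icc (0 : ℝ) T, ul t ∈ D := fun t ht =>
    H.mem_of_le H.zero_mem (h.limit_sublevel H ht (hu t ht))
  obtain ⟨hint, hlim⟩ := h.tendsto_integral_power H hu
  refine ⟨h.pos, fun t ht => h.limit_sublevel H ht (hu t ht), fun s t hs hst ht => ?_, ?_, ?_, hint,
    fun t ht => ?_, ?_⟩
  · have hsI : s ∈ Icc (0 : ℝ) T := ⟨hs, hst.trans ht⟩
    have htI : t ∈ Icc (0 : ℝ) T := ⟨hs.trans hst, ht⟩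
    refine le_of_tendsto_of_tendsto' ?_ ((hv t htI).sub (hv s hsI)) (fun n => ?_)
      (f := fun n => R (e.UZ (u n t - u n s)))
    · simp only [map_sub]
      exact (H.diss.continuous.tendsto _).comp ((hu t htI).sub (hu s hsI))
    · rw [intervalIntegral_sub_Icc (h.rate_integrable n) hsI htI]
      exact h.diss_le n s t hs hst ht
  · have := hv 0 H.zero_mem
    simp only [intervalIntegral.integral_same] at this
    exact tendsto_nhds_unique this tendsto_const_nhds
  · rw [hzero]
    exact h.stable_zero
  · obtain ⟨d, hd, hle⟩ := h.energy_le
    have h1 := (H.toReal_le_of_weak ht (Eventually.of_forall fun n =>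
      H.mem_of_le H.zero_mem (h.sublevel n t ht)) (h.weak_tendsto H ht (hu t ht))
      (Eventually.of_forall fun n => le_sub_right_of_add_le (hle n t ht))
      ((hd.add (hlim t ht)).sub (hv t ht))).2
    rw [hzero]
    linarith
  · obtain ⟨y, hyD, hy⟩ := H.exists_countable_test
    filter_upwards [ae_all_iff.2 fun k => h.ae_le_of_integral_le H hu (hyD k),
      ae_restrict_mem measurableSet_Icc] with t h1 ht
    exact hy t ht _ (hmem t ht) h1

end IsApproximatingSequence

end Limit

lemma exists_subseq_ae_tendsto_zero {X : Type*} [NormedAddCommGroup X] {T : ℝ} (hT : 0 ≤ T)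
    {f : ℕ → ℝ → X} (hf : ∀ n, IntervalIntegrable (fun r => ‖f n r‖ ^ 2) volume 0 T)
    (h : Tendsto (fun n => ∫ r in (0 : ℝ)..T, ‖f n r‖ ^ 2) atTop (𝓝 0)) :
    ∃ φ : ℕ → ℕ, StrictMono φ ∧ ∀ᵐ t ∂(volume.restrict (Icc 0 T)),
      Tendsto (fun n => f (φ n) t) atTop (𝓝 0) := by
  have hint := fun n => (integrableOn_Icc_iff hT).1 (hf n)
  have h1 : TendstoInMeasure (volume.restrict (Icc 0 T)) (fun n r => ‖f n r‖ ^ 2) atTop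
      (fun _ => (0 : ℝ)) := by
    refine tendstoInMeasure_of_tendsto_eLpNorm (p := 1) one_ne_zero (fun n => (hint n).1)
      aestronglyMeasurable_const ?_
    have h2 : ∀ n, eLpNorm ((fun r => ‖f n r‖ ^ 2) - fun _ => (0 : ℝ)) 1 (volume.restrict (Icc 0 T))
        = ENNReal.ofReal (∫ r in (0 : ℝ)..T, ‖f n r‖ ^ 2) := by
      intro n
      rw [show ((fun r => ‖f n r‖ ^ 2) - fun _ => (0 : ℝ)) = fun r => ‖f n r‖ ^ 2 from
        funext fun r => sub_zero _, eLpNorm_one_eq_lintegral_enorm,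
        ← ofReal_integral_norm_eq_lintegral_enorm (hint n), intervalIntegral.integral_of_le hT,
        integral_Icc_eq_integral_Ioc]
      simp only [norm_pow, norm_norm]
    simp only [h2]
    have := ENNReal.tendsto_ofReal h
    rwa [ENNReal.ofReal_zero] at this
  obtain ⟨φ, hφ, hae⟩ := h1.exists_seq_tendsto_ae
  refine ⟨φ, hφ, ?_⟩
  filter_upwards [hae] with t ht
  rw [tendsto_zero_iff_norm_tendsto_zero]
  have := (Real.continuous_sqrt.tendsto 0).comp ht
  simpa only [Function.comp_def, Real.sqrt_sq (norm_nonneg _), Real.sqrt_zero] using this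

section Dynamic

variable {U V W Z X : Type*}
  [NormedAddCommGroup U] [NormedSpace ℝ U] [NormedAddCommGroup V] [InnerProductSpace ℝ V]
  [NormedAddCommGroup W] [InnerProductSpace ℝ W] [NormedAddCommGroup Z] [NormedSpace ℝ Z]
  [NormedAddCommGroup X] [NormedSpace ℝ X] [CompleteSpace V] [CompleteSpace Z]
  {e : Embeddings U V W Z} {M : StrongDual ℝ U ≃L[ℝ] StrongDual ℝ U} {MW : W →L[ℝ] W}
  {Vis : V →L[ℝ] StrongDual ℝ V} {R : Z → ℝ} {T : ℝ} {E : ℝ → U → ℝ≥0∞} {D : Set U} {i : U →L[ℝ] X}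

/-- A vanishing sequence of dynamic solutions is an approximating sequence. -/
lemma exists_isApproximatingSequence (H : IsRateIndependentSystem e R T E D i)
    (hM : IsMassOperator e M MW) (hVis : IsViscosityOperator Vis) {ε : ℕ → ℝ} (hεpos : ∀ n, 0 < ε n)
    (hε : Tendsto ε atTop (𝓝 0)) {u₀ε : ℕ → U} {u₁ε : ℕ → V} {u : ℕ → ℝ → U} {v : ℕ → ℝ → V}
    (hsol : ∀ n, IsDissipativeDynamicSolution e M MW Vis R T E D (ε n) (u₀ε n) (u₁ε n) (u n) (v n))
    (hu₁ : Tendsto (fun n => ε n • e.VW (u₁ε n)) atTop (𝓝 0)) {u₀ : U} (hu₀ : WeakTendsto u₀ε u₀)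
    (hE₀ : Tendsto (fun n => E 0 (u₀ε n)) atTop (𝓝 (E 0 u₀))) (hstab : GloballyStable e R E 0 u₀) :
    (∃ K, IsApproximatingSequence e R T E D K u₀ u fun n r => R (e.VZ (v n r))) ∧
      (∀ n, IntervalIntegrable (fun r => ‖v n r‖ ^ 2) volume 0 T) ∧
      ∃ P₂, ∀ n, ε n * ∫ r in (0 : ℝ)..T, ‖v n r‖ ^ 2 ≤ P₂ := by
  have hT := H.pos.le
  have hTI : T ∈ Icc (0 : ℝ) T := right_mem_Icc.2 hT
  have hu₀D : u₀ ∈ D := IsRateIndependentSystem.GloballyStable.mem H H.zero_mem hstab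
  choose hinit w a ξ η Q N hdata using fun n => (hsol n).exists_data H hM (hεpos n)
  set d : ℕ → ℝ := fun n => ε n ^ 2 / 2 * ⟪MW (e.VW (u₁ε n)), e.VW (u₁ε n)⟫ + (E 0 (u₀ε n)).toReal
    with hd
  replace hdata : ∀ n, IsDynamicData e M MW Vis R T E D (ε n) (d n) (u n) (v n) (w n) (a n) (ξ n)
    (η n) (Q n) (N n) := hdata
  have hdlim : Tendsto d atTop (𝓝 (E 0 u₀).toReal) := by
    have h1 := (ENNReal.tendsto_toReal (H.ne_top H.zero_mem hu₀D)).comp hE₀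
    have h2 : Tendsto (fun n => 1 / 2 * ⟪MW (ε n • e.VW (u₁ε n)), ε n • e.VW (u₁ε n)⟫) atTop
        (𝓝 (1 / 2 * ⟪MW (0 : W), (0 : W)⟫)) :=
      (((MW.continuous.tendsto _).comp hu₁).inner hu₁).const_mul _
    have h3 := h2.add h1
    simp only [map_zero, inner_zero_left, mul_zero, zero_add] at h3
    refine h3.congr fun n => ?_
    simp only [hd, Function.comp_apply, map_smul, inner_smul_left, inner_smul_right,
      conj_trivial]
    ring
  obtain ⟨b, hb, hb0, hbp, hbE⟩ := H.exists_control
  set β := ∫ r in (0 : ℝ)..T, b r with hβ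
  obtain ⟨d', hd'⟩ := hdlim.bddAbove_range
  have hdle : ∀ n, d n ≤ d' := fun n => hd' ⟨n, rfl⟩
  set P := (d' + 1) * Real.exp β with hPdef
  have hP : ∀ n, ∀ t ∈ Icc (0 : ℝ) T, d n + 1 + ∫ r in (0 : ℝ)..t, power E r (u n r) ≤ P :=
    fun n t ht => ((hdata n).gronwall H hM hVis hb hb0 hbp ht).trans
      (mul_le_mul_of_nonneg_right (by linarith [hdle n]) (Real.exp_nonneg _))
  have hEP : ∀ n, ∀ t ∈ Icc (0 : ℝ) T,
      (E t (u n t)).toReal + 1 + ∫ r in (0 : ℝ)..t, R (e.VZ (v n r)) ≤ P := fun n t ht => by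
    linarith [(hdata n).energy_le H hM hVis ht, hP n t ht]
  have hR0 : ∀ n, ∀ t ∈ Icc (0 : ℝ) T, 0 ≤ ∫ r in (0 : ℝ)..t, R (e.VZ (v n r)) := fun n t ht =>
    intervalIntegral.integral_nonneg ht.1 fun r _ => H.diss.nonneg _
  have hPpos : 0 < P := lt_of_lt_of_le one_pos (by
    linarith [hEP 0 0 H.zero_mem, hR0 0 0 H.zero_mem, ENNReal.toReal_nonneg (a := E 0 (u 0 0))])
  set K := Real.exp β * P + P with hK
  have hKpos : 0 < K := by positivity
  have hsub : ∀ n, ∀ t ∈ Icc (0 : ℝ) T, E 0 (u n t) ≤ ENNReal.ofReal K := by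
    intro n t ht
    have hD := (hdata n).mem t ht
    rw [H.toReal_le H.zero_mem hD hKpos.le]
    have h1 := hbE _ hD t ht 0 H.zero_mem
    rw [intervalIntegral.integral_symm, abs_neg,
      abs_of_nonneg (intervalIntegral.integral_nonneg ht.1 fun r _ => hb0 r)] at h1
    have h2 : Real.exp (∫ r in (0 : ℝ)..t, b r) * ((E t (u n t)).toReal + 1) ≤ Real.exp β * P := by
      gcongr
      · exact intervalIntegral.integral_mono_interval le_rfl ht.1 ht.2 (Eventually.of_forall hb0) hb
      · linarith [hEP n t ht, hR0 n t ht]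
    linarith
  obtain ⟨C, hC0, hC⟩ := H.exists_norm_le K
  obtain ⟨c, hc0, hc⟩ := hM.posDef
  obtain ⟨c', hc'0, hc'⟩ := hVis.posDef
  have hP₁ : ∀ n, ∀ t ∈ Icc (0 : ℝ) T, ε n * ‖w n t‖ ≤ √(2 / c * P) := fun n t ht =>
    (hdata n).kinetic_le H hVis (hP n) hc0 hc ht
  have hP₂ : ∀ n, ε n * ∫ r in (0 : ℝ)..T, ‖v n r‖ ^ 2 ≤ 2 / c' * P := fun n =>
    (hdata n).viscous_le H hM (hP n) hc'0 hc'
  refine ⟨⟨K, hKpos, hsub, fun n t => H.diss.nonneg _, fun n => (hdata n).integrable_R H.diss hT,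
    fun n => ?_, fun n s t hs hst ht => (hdata n).diss_le H.diss hs hst ht,
    fun n => (hdata n).integrable_power, fun n => (hdata n).energy_bdd.1, ?_, hstab,
    ⟨d, hdlim, fun n t ht => (hdata n).energy_le H hM hVis ht⟩, fun x hx => ?_⟩,
    fun n => (hdata n).integrable_v_sq hT, _, hP₂⟩
  · have : 0 ≤ Real.exp β * P := by positivity
    linarith [hEP n T hTI, ENNReal.toReal_nonneg (a := E T (u n T))]
  · simpa only [hinit] using hu₀
  · refine ⟨fun n => 2 * ε n * (‖MW‖ * √(2 / c * P) * (‖e.UW‖ * (‖x‖ + C)))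
      + ε n * (‖MW‖ * ‖e.VW‖ ^ 2 * (2 / c' * P))
      + √(ε n) * (‖Vis‖ * (‖e.UV‖ * (‖x‖ + C)) * (T + 2 / c' * P) / 2), ?_,
      fun n s t hs hst ht => (hdata n).integral_energy_le H hM hx
        (fun r hr => (norm_sub_le _ _).trans (by gcongr; exact hC _ (hsub n r hr))) (hP₁ n) (hP₂ n)
        ⟨hs, hst.trans ht⟩ ⟨hs.trans hst, ht⟩ hst⟩
    have h1 := (((hε.const_mul 2).mul_const (‖MW‖ * √(2 / c * P) * (‖e.UW‖ * (‖x‖ + C)))).add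
      (hε.mul_const (‖MW‖ * ‖e.VW‖ ^ 2 * (2 / c' * P)))).add
      (((Real.continuous_sqrt.tendsto 0).comp hε).mul_const
        (‖Vis‖ * (‖e.UV‖ * (‖x‖ + C)) * (T + 2 / c' * P) / 2))
    simpa using h1

end Dynamic

end RateIndependent

theorem mainTheorem3
    {U V W Z X : Type*}
    [NormedAddCommGroup U] [NormedSpace ℝ U] [CompleteSpace U]
    [TopologicalSpace.SeparableSpace U]
    [NormedAddCommGroup V] [InnerProductSpace ℝ V] [CompleteSpace V]
    [NormedAddCommGroup W] [InnerProductSpace ℝ W] [CompleteSpace W]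
    [NormedAddCommGroup Z] [NormedSpace ℝ Z] [CompleteSpace Z]
    [NormedAddCommGroup X] [NormedSpace ℝ X] [CompleteSpace X]
    (hU : IsReflexive U)
    (e : Embeddings U V W Z)
    (M : StrongDual ℝ U ≃L[ℝ] StrongDual ℝ U) (MW : W →L[ℝ] W) (hM : IsMassOperator e M MW)
    (Vis : V →L[ℝ] StrongDual ℝ V) (hVis : IsViscosityOperator Vis)
    (R : Z → ℝ) (hR : IsDissipationPotential R)
    (T : ℝ) (hT : 0 < T)
    (E : ℝ → U → ℝ≥0∞) (D : Set U) (hD : HasDomain T E D)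
    (hE1 : WeaklyLSC T E) (hE2 : PowerControl T E D) (hE3 : Coercive E)
    (hE4 : PowerContinuity e T E)
    (i : U →L[ℝ] X) (hi : Function.Injective i)
    (hE5' : UniformlyConvexEnergy T E i)
    (ε : ℕ → ℝ) (hεpos : ∀ n, 0 < ε n) (hε : Tendsto ε atTop (𝓝 0))
    (u₀ε : ℕ → U) (hu₀ε : ∀ n, u₀ε n ∈ D) (u₁ε : ℕ → V)
    (uε : ℕ → ℝ → U) (vε : ℕ → ℝ → V)
    (hsol : ∀ n, IsDissipativeDynamicSolution e M MW Vis R T E D (ε n) (u₀ε n) (u₁ε n)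
      (uε n) (vε n))
    (hu₁ : Tendsto (fun n => ε n • e.VW (u₁ε n)) atTop (𝓝 0))
    (u₀ : U) (hu₀ : WeakTendsto u₀ε u₀)
    (hE₀ : Tendsto (fun n => E 0 (u₀ε n)) atTop (𝓝 (E 0 u₀)))
    (hstab : GloballyStable e R E 0 u₀) :
    ∃ (φ : ℕ → ℕ) (u : ℝ → U), StrictMono φ ∧
      (∀ t ∈ Icc (0 : ℝ) T, u t ∈ D) ∧
      MemB T u ∧ BoundedVariationOn (fun t => e.UZ (u t)) (Icc 0 T) ∧
      (∀ t ∈ Icc (0 : ℝ) T, WeakTendsto (fun n => uε (φ n) t) (u t)) ∧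
      (∀ᵐ t ∂(volume.restrict (Icc 0 T)),
        Tendsto (fun n => ε (φ n) • vε (φ n) t) atTop (𝓝 0)) ∧
      IsEssentialEnergeticSolution e R T E D u₀ u ∧
      ContinuousOn (fun t => i (u t)) (Icc 0 T) ∧
      MemCw T u ∧
      IsEnergeticSolution e R T E u₀ u ∧
      (LipschitzPower T E i →
        MemAC T (fun t => i (u t)) ∧
        ∀ j : X →L[ℝ] Z, Function.Injective j → j ∘L i = e.UZ → IsReflexive X →
          IsClassicalSolution e R T E i j u₀ u) := by
  have H : IsRateIndependentSystem e R T E D i :=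
    ⟨hT, hU, hR, hD, hE1, hE2, hE3, hE4, hi, hE5'⟩
  obtain ⟨⟨K, happ⟩, hv, P₂, hP₂⟩ :=
    exists_isApproximatingSequence H hM hVis hεpos hε hsol hu₁ hu₀ hE₀ hstab
  obtain ⟨φ₁, hφ₁, v, u, hlim⟩ := happ.exists_limit H
  have hvan : Tendsto (fun n => ∫ r in (0 : ℝ)..T, ‖ε (φ₁ n) • vε (φ₁ n) r‖ ^ 2) atTop (𝓝 0) := by
    have h1 : Tendsto (fun n => ε (φ₁ n) * P₂) atTop (𝓝 0) := by
      simpa using (hε.comp hφ₁.tendsto_atTop).mul_const P₂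
    refine squeeze_zero (fun n => intervalIntegral.integral_nonneg hT.le fun r _ => by positivity)
      (fun n => ?_) h1
    simp only [norm_smul, mul_pow, intervalIntegral.integral_const_mul, Real.norm_eq_abs, sq_abs]
    rw [sq, mul_assoc]
    exact mul_le_mul_of_nonneg_left (hP₂ _) (hεpos _).le
  obtain ⟨φ₂, hφ₂, hae⟩ := exists_subseq_ae_tendsto_zero hT.le
    (f := fun n r => ε (φ₁ n) • vε (φ₁ n) r) (fun n => by
      simp only [norm_smul, mul_pow]
      exact (hv _).const_mul _) hvan
  have hcurve := (happ.comp hφ₁).isLimitCurve H (fun t ht => (hlim t ht).1) fun t ht => (hlim t ht).2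
  have h0 : u 0 = u₀ := (happ.comp hφ₁).limit_zero H (hlim 0 H.zero_mem).1
  refine ⟨φ₁ ∘ φ₂, u, hφ₁.comp hφ₂, fun t ht => hcurve.mem H ht, (hcurve.memCw H).1,
    hcurve.boundedVariationOn H, fun t ht L => ?_, hae, h0 ▸ hcurve.essEnergetic H,
    hcurve.continuousOn_X H, hcurve.memCw H, h0 ▸ hcurve.energetic H,
    fun hL => ⟨hcurve.memAC_X H hL, fun j _ hj hX => h0 ▸ hcurve.classical H hL hX j hj⟩⟩
  exact ((happ.comp hφ₁).weak_tendsto H ht (hlim t ht).1 L).comp hφ₂.tendsto_atTop
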